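/- For $\tau$ in the upper half-plane $\mathbb H$ and $\alpha\in\mathbb C$ put $q=e^{2\pi i\tau}$, $w=e^{2\pi i\alpha}$, $q^x=e^{2\pi i x\tau}$, $w^{x}=e^{2\pi i x\alpha}$, $(a;q)_n=\prod_{j=0}^{n-1}(1-aq^j)$, and $$K'(w;\tau)=\sum_{n=0}^\infty\frac{(-1)^nq^{n^2}(q;q^2)_n}{(wq^2;q^2)_n(q^2/w;q^2)_n},\qquad K''(w;\tau)=\sum_{n=1}^\infty\frac{(-1)^nq^{n^2}(q;q^2)_{n-1}}{(wq;q^2)_n(q/w;q^2)_n},$$ $$\vartheta(\alpha;\tau)=-\sum_{n\in\mathbb Z}(-1)^ne^{\pi i(2n+1)\alpha}q^{\frac{n(n+1)}2+\frac18},\qquad \eta(\tau)=q^{1/24}\prod_{n\ge1}(1-q^n),$$ $$A_2(u,v;\tau)=e^{2\pi iu}\sum_{n\in\mathbb Z}\frac{q^{n(n+1)}e^{2\pi inv}}{1-e^{2\pi iu}q^n}\quad(\text{the Appell function of level }2),$$ $$F(\alpha;\tau)=\frac{q^{-1/8}}{w^{-1/2}-w^{1/2}}K'(w;\tau)+q^{-1/8}(w^{1/2}-w^{-1/2})K''(w;\tau).$$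 (1) If $\alpha\notin\mathbb Z\tau+\mathbb Z$, then the series $K'(w;\tau)$ and $K''(w;\tau)$ converge absolutely, $\vartheta(\alpha;\tau)\ne0$, and $$F(\alpha;\tau)=\frac{\eta^4(\tau)}{\eta^2(2\tau)\,\vartheta(\alpha;\tau)}.$$ Moreover, the two summands of $F$ are multiples of level $2$ Appell functions: $$\frac{q^{-1/8}}{w^{-1/2}-w^{1/2}}K'(w;\tau)=w^{-1/2}\frac{\eta(\tau)}{\eta^2(2\tau)}A_2(\alpha,-\tau;2\tau),\qquad q^{-1/8}(w^{1/2}-w^{-1/2})K''(w;\tau)=-w^{-1/2}\frac{\eta(\tau)}{\eta^2(2\tau)}A_2(\alpha+\tau,\tau;2\tau).$$ (2) $F$ is a meromorphic Jacobi form of weight $\frac12$ and index $-\frac12$ on $\Gamma_0(2)$. Here a Jacobi form of weight $k\in\frac12\mathbb Z$ and index $m\in\frac12\mathbb Z$ on $\Gamma\le SL_2(\mathbb Z)$ is a holomorphic function $\varphi$ on $\mathbb C\times\mathbb H$ with $\varphi(z+\lambda\tau+\mu,\tau)=(-1)^{2m(\lambda+\mu)}e^{-2\pi im(\lambda^2\tau+2\lambda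 z)}\varphi(z,\tau)$ for $\lambda,\mu\in\mathbb Z$ and $\varphi\big(\frac z{c\tau+d},\frac{a\tau+b}{c\tau+d}\big)=\nu(\gamma)(c\tau+d)^ke^{2\pi imcz^2/(c\tau+d)}\varphi(z,\tau)$ for $\gamma=\begin{pmatrix}a&b\\c&d\end{pmatrix}\in\Gamma$ (principal branch), where the $\nu(\gamma)$ are roots of unity of bounded order, such that for all $a,b\in\mathbb Q$ the function $q^{ma^2}\varphi(a\tau+b,\tau)$ is bounded at all cusps (as a function of weight $k$); a meromorphic Jacobi form of weight $k$ and index $m$ is a quotient $g/h$ of Jacobi forms whose weights differ by $k$ and whose indices differ by $m$, with $h(\cdot,\tau)\not\equiv0$ for every $\tau$. (3) For all $r,s\in\mathbb Q$, not both integers, there is a finite-index subgroup $\Gamma$ of $SL_2(\mathbb Z)$, depending on $r$ and $s$ and contained in $\Gamma_0(4)$, such that $f(\tau)=q^{-r^2/2}F(r\tau+s;\tau)$ is a weakly holomorphic modular form of weight $\frac12$ on $\Gamma$: $f$ is holomorphic on $\mathbb H$ and meromorphic at all cusps, and $f(\gamma\tau)=\frac{\theta(\gamma\tau)}{\theta(\tau)}f(\tau)$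 for $\gamma\in\Gamma$, where $\theta(\tau)=\sum_{n\in\mathbb Z}q^{n^2}$. -/

import Mathlib

open Complex
open UpperHalfPlane hiding I
open scoped MatrixGroups

noncomputable section

namespace AppellCompletion

/-- The finite `q`-Pochhammer symbol `(a; q)_n = ∏_{j < n} (1 - a q^j)`. -/
def qPoch (a q : ℂ) (n : ℕ) : ℂ := ∏ j ∈ Finset.range n, (1 - a * q ^ j)

/-- The complex power `q ^ x = e^{2πi x τ}` of `q = e^{2πiτ}`. -/
def qpow (τ : ℂ) (x : ℂ) : ℂ := cexp (2 * Real.pi * I * x * τ)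

/-- The complex power `w ^ x = e^{2πi x α}` of `w = e^{2πiα}`; in particular
`w ^ (1/2) = e^{πiα}`. -/
def wpow (α : ℂ) (x : ℂ) : ℂ := cexp (2 * Real.pi * I * x * α)

/-- The `n`-th term of `K'(w; τ)`, `n ≥ 0`. -/
def K₁Term (w q : ℂ) (n : ℕ) : ℂ :=
  (-1) ^ n * q ^ (n ^ 2) * qPoch q (q ^ 2) n /
    (qPoch (w * q ^ 2) (q ^ 2) n * qPoch (q ^ 2 / w) (q ^ 2) n)

/-- `K'(w; τ) = ∑_{n ≥ 0} (-1)^n q^{n²} (q;q²)_n / ((wq²;q²)_n (q²/w;q²)_n)`, as a function of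
`w` and `q`. -/
def K₁ (w q : ℂ) : ℂ := ∑' n : ℕ, K₁Term w q n

/-- The `n`-th term of `K''(w; τ)`, `n ≥ 1`. -/
def K₂Term (w q : ℂ) (n : ℕ) : ℂ :=
  (-1) ^ n * q ^ (n ^ 2) * qPoch q (q ^ 2) (n - 1) /
    (qPoch (w * q) (q ^ 2) n * qPoch (q / w) (q ^ 2) n)

/-- `K''(w; τ) = ∑_{n ≥ 1} (-1)^n q^{n²} (q;q²)_{n-1} / ((wq;q²)_n (q/w;q²)_n)`, as a function
of `w` and `q`. The index of summation is shifted by one. -/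
def K₂ (w q : ℂ) : ℂ := ∑' n : ℕ, K₂Term w q (n + 1)

/-- The Jacobi theta function
`ϑ(z; τ) = - ∑_{n ∈ ℤ} (-1)^n e^{πi(2n+1)z} q^{n(n+1)/2 + 1/8}`. With this sign its product
expansion is `q^{1/8} x^{-1/2} ∏_{n ≥ 1} (1 - q^n)(1 - x q^{n-1})(1 - x⁻¹ q^n)`,
`x = e^{2πiz}`. -/
def theta (z τ : ℂ) : ℂ :=
  -∑' n : ℤ, (-1 : ℂ) ^ n * cexp (Real.pi * I * (2 * n + 1) * z) *
    qpow τ ((n : ℂ) * (n + 1) / 2 + 1 / 8)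

/-- The Appell function of level `2`,
`A₂(u, v; τ) = a ∑_{n ∈ ℤ} q^{n(n+1)} b^n / (1 - a q^n)` with `a = e^{2πiu}`,
`b = e^{2πiv}`. -/
def appell₂ (u v τ : ℂ) : ℂ :=
  wpow u 1 * ∑' n : ℤ, qpow τ ((n : ℂ) * (n + 1)) * wpow v n / (1 - wpow u 1 * qpow τ n)

/-- First summand: `q^{-1/8} K'(w; τ) / (w^{-1/2} - w^{1/2})`, `w = e^{2πiα}`. -/
def summand₁ (α τ : ℂ) : ℂ :=
  qpow τ (-1 / 8) / (wpow α (-1 / 2) - wpow α (1 / 2)) * K₁ (wpow α 1) (qpow τ 1)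

/-- Second summand: `q^{-1/8} (w^{1/2} - w^{-1/2}) K''(w; τ)`, `w = e^{2πiα}`. -/
def summand₂ (α τ : ℂ) : ℂ :=
  qpow τ (-1 / 8) * (wpow α (1 / 2) - wpow α (-1 / 2)) * K₂ (wpow α 1) (qpow τ 1)

/-- The automorphy factor `cτ + d` of `γ = (a b; c d)`. -/
def autFactor (γ : SL(2, ℤ)) (τ : ℍ) : ℂ := (γ 1 0 : ℂ) * (τ : ℂ) + (γ 1 1 : ℂ)

/-- The function `(cτ + d)^{-K/2} f(γτ)` (principal branch). -/
def slashHalf (K : ℤ) (γ : SL(2, ℤ)) (f : ℍ → ℂ) (τ : ℍ) : ℂ :=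
  autFactor γ τ ^ (-(K : ℂ) / 2) * f (γ • τ)

/-- A function of `(z, τ) ∈ ℂ × ℍ` restricted to `z = a τ + b` and multiplied by
`q ^ (m a²)`, where `m = M / 2` is the index. -/
def torsionValue (M : ℤ) (φ : ℂ → ℍ → ℂ) (a b : ℚ) (τ : ℍ) : ℂ :=
  qpow τ ((M : ℂ) / 2 * (a : ℂ) ^ 2) * φ ((a : ℂ) * τ + b) τ

/-- (Holomorphic) Jacobi forms of weight `K / 2` and index `M / 2` on `Γ ≤ SL₂(ℤ)`, with a
multiplier system of finite order. The growth condition is the usual one at all cusps: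
for all `a, b ∈ ℚ`, the function `q^{m a²} φ(aτ + b, τ)` is bounded at every cusp. For a Fourier
expansion `∑ c(n, r) q^n e^{2πirz}` and index `m` it says that `c(n, r) = 0` unless
`n + r a + m a² ≥ 0` for all `a`; if `m > 0`, this is the condition `4 n m ≥ r²`. -/
structure IsJacobiForm (K M : ℤ) (Γ : Subgroup SL(2, ℤ)) (φ : ℂ → ℍ → ℂ) : Prop where
  holomorphic : DifferentiableOn ℂ (fun p : ℂ × ℂ => φ p.1 (ofComplex p.2)) {p | 0 < p.2.im}
  elliptic : ∀ (l m : ℤ) (z : ℂ) (τ : ℍ),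
    φ (z + l * τ + m) τ =
      (-1 : ℂ) ^ (M * (l + m)) * cexp (-(Real.pi * I * M * (l ^ 2 * τ + 2 * l * z))) * φ z τ
  modular : ∃ (ν : SL(2, ℤ) → ℂ) (N : ℕ), 0 < N ∧ ∀ γ ∈ Γ, ν γ ^ N = 1 ∧
    ∀ (z : ℂ) (τ : ℍ), φ (z / autFactor γ τ) (γ • τ) =
      ν γ * autFactor γ τ ^ ((K : ℂ) / 2) *
        cexp (Real.pi * I * M * (γ 1 0 : ℂ) * z ^ 2 / autFactor γ τ) * φ z τ
  growth : ∀ (γ : SL(2, ℤ)) (a b : ℚ),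
    IsBoundedAtImInfty (slashHalf K γ (torsionValue M φ a b))

/-- Meromorphic Jacobi forms of weight `K / 2` and index `M / 2` on `Γ`: the quotients `g / h` of
Jacobi forms whose weights and indices differ by `K / 2` and `M / 2`, where `h(·, τ)` does not
vanish identically for any `τ`. The values of `φ` on the zero set of `h` are irrelevant. -/
def IsMeromorphicJacobiForm (K M : ℤ) (Γ : Subgroup SL(2, ℤ)) (φ : ℂ → ℍ → ℂ) : Prop :=
  ∃ (k₁ k₂ m₁ m₂ : ℤ) (g h : ℂ → ℍ → ℂ),
    IsJacobiForm k₁ m₁ Γ g ∧ IsJacobiForm k₂ m₂ Γ h ∧ K = k₁ - k₂ ∧ M = m₁ - m₂ ∧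
    (∀ τ : ℍ, ∃ z : ℂ, h z τ ≠ 0) ∧
    ∀ (z : ℂ) (τ : ℍ), h z τ ≠ 0 → φ z τ = g z τ / h z τ

/-- The theta constant `θ(τ) = ∑_{n ∈ ℤ} q^{n²}`, `q = e^{2πiτ}`, which defines the automorphy
factor `θ(γτ) / θ(τ)` of weight `1/2` on `Γ₀(4)`. -/
def thetaConst (τ : ℍ) : ℂ := ∑' n : ℤ, qpow τ ((n : ℂ) ^ 2)

/-- Weakly holomorphic modular forms of half-integral weight `K / 2` (`K` odd) on a finite-index
subgroup `Γ` of `Γ₀(4)`: holomorphic on `ℍ`, transforming under `Γ` by the automorphy factor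
`(θ(γτ) / θ(τ))^K`, and meromorphic at every cusp, that is, of at most exponential growth
in `Im τ` at `i∞` after applying any `γ ∈ SL₂(ℤ)`. -/
structure IsWeaklyHolomorphicModularForm (K : ℤ) (Γ : Subgroup SL(2, ℤ)) (f : ℍ → ℂ) :
    Prop where
  le_gamma0 : Γ ≤ CongruenceSubgroup.Gamma0 4
  finiteIndex : Γ.FiniteIndex
  holomorphic : DifferentiableOn ℂ (fun t : ℂ => f (ofComplex t)) {t | 0 < t.im}
  modular : ∀ γ ∈ Γ, ∀ τ : ℍ, f (γ • τ) = (thetaConst (γ • τ) / thetaConst τ) ^ K * f τ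
  meromorphic_at_cusps : ∀ γ : SL(2, ℤ), ∃ C : ℝ,
    slashHalf K γ f =O[atImInfty] fun τ : ℍ => Real.exp (C * τ.im)

end AppellCompletion

end

noncomputable section

namespace AppellCompletion

open Filter Topology Asymptotics

/-- The infinite `q`-Pochhammer symbol `(a; q)_∞ = ∏_{j ≥ 0} (1 - a q^j)`. -/
def qPochInf (a q : ℂ) : ℂ := ∏' j : ℕ, (1 - a * q ^ j)

@[simp] lemma qPoch_zero (a q : ℂ) : qPoch a q 0 = 1 := by simp [qPoch]

lemma qPoch_succ (a q : ℂ) (n : ℕ) : qPoch a q (n + 1) = qPoch a q n * (1 - a * q ^ n) := by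
  simp [qPoch, Finset.prod_range_succ]

lemma qPoch_add (a q : ℂ) (m n : ℕ) :
    qPoch a q (m + n) = qPoch a q m * qPoch (a * q ^ m) q n := by
  simp only [qPoch, Finset.prod_range_add, pow_add, mul_assoc]

lemma qPoch_succ' (a q : ℂ) (n : ℕ) : qPoch a q (n + 1) = (1 - a) * qPoch (a * q) q n := by
  rw [add_comm, qPoch_add, qPoch_succ]
  simp

lemma qPoch_ne_zero {a q : ℂ} (h : ∀ j : ℕ, a * q ^ j ≠ 1) (n : ℕ) : qPoch a q n ≠ 0 :=
  Finset.prod_ne_zero_iff.2 fun j _ => sub_ne_zero.2 (h j).symm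

lemma summable_mul_pow (a : ℂ) {q : ℂ} (hq : ‖q‖ < 1) : Summable fun j : ℕ => ‖-(a * q ^ j)‖ := by
  simpa using (summable_geometric_of_lt_one (norm_nonneg _) hq).mul_left ‖a‖

lemma multipliable_qPoch (a : ℂ) {q : ℂ} (hq : ‖q‖ < 1) :
    Multipliable fun j : ℕ => 1 - a * q ^ j := by
  simpa [sub_eq_add_neg] using multipliable_one_add_of_summable (summable_mul_pow a hq)

lemma tendsto_qPoch (a : ℂ) {q : ℂ} (hq : ‖q‖ < 1) :
    Tendsto (qPoch a q) atTop (𝓝 (qPochInf a q)) :=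
  (multipliable_qPoch a hq).hasProd.tendsto_prod_nat

lemma qPochInf_ne_zero {a q : ℂ} (hq : ‖q‖ < 1) (h : ∀ j : ℕ, a * q ^ j ≠ 1) :
    qPochInf a q ≠ 0 := by
  have := tprod_one_add_ne_zero_of_summable (f := fun j : ℕ => -(a * q ^ j))
    (fun j => by simpa [← sub_eq_add_neg] using sub_ne_zero.2 (h j).symm) (summable_mul_pow a hq)
  simpa [qPochInf, sub_eq_add_neg] using this

lemma qPochInf_eq_mul (a : ℂ) {q : ℂ} (hq : ‖q‖ < 1) (m : ℕ) :
    qPochInf a q = qPoch a q m * qPochInf (a * q ^ m) q := by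
  refine tendsto_nhds_unique ((tendsto_add_atTop_iff_nat m).2 (tendsto_qPoch a hq)) ?_
  simp_rw [add_comm _ m, qPoch_add]
  exact (tendsto_qPoch _ hq).const_mul _

lemma exists_norm_qPoch_le (a : ℂ) {q : ℂ} (hq : ‖q‖ < 1) :
    ∃ C : ℝ, 0 < C ∧ ∀ n, ‖qPoch a q n‖ ≤ C := by
  obtain ⟨C, hC⟩ := (tendsto_qPoch a hq).norm.bddAbove_range
  exact ⟨max C 1, by positivity, fun n => le_max_of_le_left (hC ⟨n, rfl⟩)⟩

lemma exists_norm_qPoch_inv_le {a q : ℂ} (hq : ‖q‖ < 1) (h : ∀ j : ℕ, a * q ^ j ≠ 1) :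
    ∃ C : ℝ, 0 < C ∧ ∀ n, ‖(qPoch a q n)⁻¹‖ ≤ C := by
  obtain ⟨C, hC⟩ := ((tendsto_qPoch a hq).inv₀ (qPochInf_ne_zero hq h)).norm.bddAbove_range
  exact ⟨max C 1, by positivity, fun n => le_max_of_le_left (hC ⟨n, rfl⟩)⟩

lemma mul_pow_ne_one_of_norm_lt_one {a q : ℂ} (ha : ‖a‖ < 1) (hq : ‖q‖ < 1) (j : ℕ) :
    a * q ^ j ≠ 1 := by
  intro h
  have h1 : ‖a * q ^ j‖ < 1 := by
    rw [norm_mul, norm_pow]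
    exact mul_lt_one_of_nonneg_of_lt_one_left (norm_nonneg _) ha (pow_le_one₀ (norm_nonneg _) hq.le)
  simp [h] at h1

/-- The terms `(a; q)_k (-z)^k q^{k(k-1)/2} / ((q; q)_k (az; q)_k)` of the basic hypergeometric
series `₁φ₁(a; az; q, z)`. -/
def phiTerm (a q z : ℂ) (k : ℕ) : ℂ :=
  qPoch a q k * (-z) ^ k * q ^ (k.choose 2) / (qPoch q q k * qPoch (a * z) q k)

lemma summable_pow_mul_pow_choose (x : ℝ) {r : ℝ} (hr0 : 0 ≤ r) (hr : r < 1) :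
    Summable fun k : ℕ => x ^ k * r ^ (k.choose 2) := by
  rcases eq_or_ne x 0 with rfl | hx
  · exact summable_of_ne_finset_zero (s := {0}) fun k hk => by simp at hk; simp [hk]
  rcases hr0.eq_or_lt with rfl | hr0
  · refine summable_of_ne_finset_zero (s := {0, 1}) fun k hk => ?_
    simp only [Finset.mem_insert, Finset.mem_singleton, not_or] at hk
    have : k.choose 2 ≠ 0 := (Nat.choose_pos (by omega)).ne'
    simp [this]
  refine summable_of_ratio_test_tendsto_lt_one (l := 0) one_pos
    (Eventually.of_forall fun k => by positivity) ?_
  have : (fun k : ℕ => ‖x ^ (k + 1) * r ^ ((k + 1).choose 2)‖ / ‖x ^ k * r ^ (k.choose 2)‖) =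
      fun k : ℕ => |x| * r ^ k := by
    ext k
    have h1 : (k + 1).choose 2 = k + k.choose 2 := by
      rw [Nat.choose_succ_succ' k 1, Nat.choose_one_right]
    rw [h1, ← norm_div, Real.norm_eq_abs]
    have : x ^ (k + 1) * r ^ (k + k.choose 2) / (x ^ k * r ^ k.choose 2) = x * r ^ k := by
      field_simp
      ring
    rw [this, abs_mul, abs_of_nonneg (pow_nonneg hr0.le k)]
  rw [this]
  simpa using (tendsto_pow_atTop_nhds_zero_of_lt_one hr0.le hr).const_mul |x|

lemma exists_norm_phiTerm_le {a q z : ℂ} (hq : ‖q‖ < 1) (h : ∀ j : ℕ, a * z * q ^ j ≠ 1) :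
    ∃ C : ℝ, 0 < C ∧ ∀ N k, ‖phiTerm a q (z * q ^ N) k‖ ≤ C * (‖z‖ ^ k * ‖q‖ ^ (k.choose 2)) := by
  obtain ⟨C₁, h1, H1⟩ := exists_norm_qPoch_le a hq
  obtain ⟨C₂, h2, H2⟩ := exists_norm_qPoch_inv_le hq (mul_pow_ne_one_of_norm_lt_one hq hq)
  obtain ⟨C₃, h3, H3⟩ := exists_norm_qPoch_inv_le hq h
  obtain ⟨C₄, h4, H4⟩ := exists_norm_qPoch_le (a * z) hq
  refine ⟨C₁ * C₂ * (C₃ * C₄), by positivity, fun N k => ?_⟩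
  have e : (qPoch (a * (z * q ^ N)) q k)⁻¹ = (qPoch (a * z) q (N + k))⁻¹ * qPoch (a * z) q N := by
    rw [qPoch_add, mul_inv, mul_assoc a z, mul_right_comm,
      inv_mul_cancel₀ (by simpa [mul_assoc] using qPoch_ne_zero h N), one_mul]
  have hz : ‖z * q ^ N‖ ≤ ‖z‖ := by
    rw [norm_mul, norm_pow]
    exact mul_le_of_le_one_right (norm_nonneg _) (pow_le_one₀ (norm_nonneg _) hq.le)
  calc ‖phiTerm a q (z * q ^ N) k‖
      = ‖qPoch a q k‖ * ‖(qPoch q q k)⁻¹‖ * (‖(qPoch (a * z) q (N + k))⁻¹‖ * ‖qPoch (a * z) q N‖)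
        * (‖z * q ^ N‖ ^ k * ‖q‖ ^ (k.choose 2)) := by
        rw [phiTerm, div_eq_mul_inv, mul_inv, e]
        simp only [norm_mul, norm_pow, norm_neg]
        ring
    _ ≤ _ := by
        gcongr
        exacts [H1 _, H2 _, H3 _, H4 _]

lemma summable_phiTerm {a q z : ℂ} (hq : ‖q‖ < 1) (h : ∀ j : ℕ, a * z * q ^ j ≠ 1) :
    Summable (phiTerm a q z) := by
  obtain ⟨C, -, hC⟩ := exists_norm_phiTerm_le hq h
  refine Summable.of_norm_bounded
    ((summable_pow_mul_pow_choose ‖z‖ (norm_nonneg q) hq).mul_left C) fun k => ?_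
  simpa using hC 0 k

lemma phiTerm_succ_mul {a q z : ℂ} (hq : ‖q‖ < 1) (h : ∀ j : ℕ, a * z * q ^ j ≠ 1) (k : ℕ) :
    phiTerm a q z (k + 1) * (1 - q ^ (k + 1)) =
      phiTerm a q z k * ((1 - a * q ^ k) * (-z * q ^ k) / (1 - a * z * q ^ k)) := by
  have h1 := qPoch_ne_zero (mul_pow_ne_one_of_norm_lt_one hq hq) k
  have h2 := qPoch_ne_zero h k
  have h3 : 1 - a * z * q ^ k ≠ 0 := sub_ne_zero.2 (h k).symm
  have h4 : 1 - q * q ^ k ≠ 0 := sub_ne_zero.2 (mul_pow_ne_one_of_norm_lt_one hq hq k).symm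
  have h5 : (k + 1).choose 2 = k + k.choose 2 := by
    rw [Nat.choose_succ_succ' k 1, Nat.choose_one_right]
  rw [phiTerm, phiTerm, qPoch_succ, qPoch_succ, qPoch_succ, h5, pow_succ' q k, pow_add q k]
  generalize q ^ k = x at *
  generalize hd : 1 - a * z * x = d at *
  generalize 1 - q * x = e at *
  field_simp
  ring

lemma phiTerm_mul_base {a q z : ℂ} (h : ∀ j : ℕ, a * z * q ^ j ≠ 1) (k : ℕ) :
    phiTerm a q (z * q) k = phiTerm a q z k * (q ^ k * (1 - a * z) / (1 - a * z * q ^ k)) := by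
  have h2 := qPoch_ne_zero h k
  have h3 : 1 - a * z * q ^ k ≠ 0 := sub_ne_zero.2 (h k).symm
  have h4 : 1 - a * z ≠ 0 := by simpa using sub_ne_zero.2 (h 0).symm
  have e : qPoch (a * (z * q)) q k = qPoch (a * z) q k * (1 - a * z * q ^ k) / (1 - a * z) := by
    rw [eq_div_iff h4, ← qPoch_succ, qPoch_succ', mul_comm, mul_assoc]
  rw [phiTerm, phiTerm, e]
  rcases eq_or_ne (qPoch q q k) 0 with h0 | h0
  · simp [h0]
  field_simp
  ring

lemma tsum_phiTerm_eq_mul {a q z : ℂ} (hq : ‖q‖ < 1) (h : ∀ j : ℕ, a * z * q ^ j ≠ 1) :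
    ∑' k, phiTerm a q z k = (1 - z) / (1 - a * z) * ∑' k, phiTerm a q (z * q) k := by
  have h4 : 1 - a * z ≠ 0 := by simpa using sub_ne_zero.2 (h 0).symm
  have h' : ∀ j : ℕ, a * (z * q) * q ^ j ≠ 1 := fun j => by
    simpa [pow_succ', mul_assoc] using h (j + 1)
  have s1 := summable_phiTerm hq h
  have s2 := (summable_phiTerm hq h').mul_left ((1 - z) / (1 - a * z))
  set g : ℕ → ℂ := fun k => phiTerm a q z k * (1 - q ^ k) with hg
  have hg0 : Tendsto g atTop (𝓝 0) := by
    have h1 : Tendsto (fun k : ℕ => 1 - q ^ k) atTop (𝓝 (1 - 0)) :=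
      tendsto_const_nhds.sub (tendsto_pow_atTop_nhds_zero_of_norm_lt_one hq)
    simpa using s1.tendsto_atTop_zero.mul h1
  have key : ∀ k, phiTerm a q z k - (1 - z) / (1 - a * z) * phiTerm a q (z * q) k =
      g k - g (k + 1) := fun k => by
    have h3 : 1 - a * z * q ^ k ≠ 0 := sub_ne_zero.2 (h k).symm
    simp only [hg]
    rw [phiTerm_succ_mul hq h, phiTerm_mul_base h]
    generalize q ^ k = x at *
    generalize 1 - a * z = e at *
    generalize hd : 1 - a * z * x = d at *
    field_simp
    rw [← hd]
    ring
  rw [← tsum_mul_left, ← sub_eq_zero, ← s1.tsum_sub s2]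
  simp_rw [key]
  have : HasSum (fun k => g k - g (k + 1)) (g 0 - 0) := by
    have hs : Summable fun k => g k - g (k + 1) := by
      simpa only [key] using s1.sub s2
    rw [hs.hasSum_iff_tendsto_nat]
    simp_rw [Finset.sum_range_sub' g]
    exact tendsto_const_nhds.sub hg0
  rw [this.tsum_eq]
  simp [hg]

/-- The summation formula `₁φ₁(a; az; q, z) = (z; q)_∞ / (az; q)_∞`. -/
theorem tsum_phiTerm {a q z : ℂ} (hq : ‖q‖ < 1) (h : ∀ j : ℕ, a * z * q ^ j ≠ 1) :
    ∑' k, phiTerm a q z k = qPochInf z q / qPochInf (a * z) q := by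
  have h' : ∀ N j : ℕ, a * (z * q ^ N) * q ^ j ≠ 1 := fun N j => by
    simpa [pow_add, mul_assoc] using h (N + j)
  have step : ∀ N : ℕ, ∑' k, phiTerm a q z k =
      qPoch z q N / qPoch (a * z) q N * ∑' k, phiTerm a q (z * q ^ N) k := fun N => by
    induction N with
    | zero => simp
    | succ N ih =>
      rw [ih, tsum_phiTerm_eq_mul hq (h' N), qPoch_succ, qPoch_succ, ← mul_assoc,
        ← mul_assoc, div_mul_div_comm, mul_assoc z, ← pow_succ]
  have lim : Tendsto (fun N : ℕ => ∑' k, phiTerm a q (z * q ^ N) k) atTop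
      (𝓝 (∑' k : ℕ, if k = 0 then 1 else 0)) := by
    obtain ⟨C, -, hC⟩ := exists_norm_phiTerm_le hq h
    refine tendsto_tsum_of_dominated_convergence
      ((summable_pow_mul_pow_choose ‖z‖ (norm_nonneg q) hq).mul_left C) (fun k => ?_)
      (Eventually.of_forall fun N k => hC N k)
    have h0 : Tendsto (fun N : ℕ => z * q ^ N) atTop (𝓝 0) := by
      simpa using (tendsto_pow_atTop_nhds_zero_of_norm_lt_one hq).const_mul z
    have hc : ContinuousAt (fun y => phiTerm a q y k) 0 := by
      unfold phiTerm qPoch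
      rcases eq_or_ne (∏ j ∈ Finset.range k, (1 - q * q ^ j)) 0 with h0 | h0
      · simp only [h0, zero_mul, div_zero]
        exact continuousAt_const
      · refine ContinuousAt.div (by fun_prop) (by fun_prop) ?_
        simpa using h0
    have := hc.tendsto.comp h0
    refine (this.congr fun _ => rfl).trans_eq ?_
    congr 1
    rcases eq_or_ne k 0 with rfl | hk
    · simp [phiTerm]
    · simp [phiTerm, hk]
  rw [tsum_ite_eq] at lim
  have l2 := ((tendsto_qPoch z hq).div (tendsto_qPoch (a * z) hq) (qPochInf_ne_zero hq h)).mul lim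
  rw [mul_one] at l2
  exact tendsto_nhds_unique (tendsto_const_nhds.congr step) l2

/-- The reciprocal `1 / (q; q)_k` for `k ∈ ℤ`, which is `0` for negative `k`. -/
def qFactInv (q : ℂ) (k : ℤ) : ℂ := if 0 ≤ k then (qPoch q q k.toNat)⁻¹ else 0

lemma qFactInv_natCast (q : ℂ) (k : ℕ) : qFactInv q k = (qPoch q q k)⁻¹ := by simp [qFactInv]

lemma qFactInv_of_neg (q : ℂ) {k : ℤ} (hk : k < 0) : qFactInv q k = 0 := by
  simp [qFactInv, hk]

lemma qFactInv_eq_mul {q : ℂ} (hq : ‖q‖ < 1) (k : ℤ) :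
    qFactInv q (k - 1) = qFactInv q k * (1 - q ^ k) := by
  rcases lt_trichotomy k 0 with hk | rfl | hk
  · rw [qFactInv_of_neg q hk, qFactInv_of_neg q (by omega), zero_mul]
  · simp [qFactInv_of_neg]
  · obtain ⟨m, rfl⟩ : ∃ m : ℕ, k = (m + 1 : ℕ) := ⟨(k - 1).toNat, by omega⟩
    have h4 : 1 - q * q ^ m ≠ 0 := sub_ne_zero.2 (mul_pow_ne_one_of_norm_lt_one hq hq m).symm
    rw [show ((m + 1 : ℕ) : ℤ) - 1 = (m : ℤ) by push_cast; ring, qFactInv_natCast,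
      qFactInv_natCast, qPoch_succ, zpow_natCast, pow_succ']
    generalize 1 - q * q ^ m = d at *
    rw [mul_inv, mul_assoc, inv_mul_cancel₀ h4, mul_one]

lemma qPoch_div_pow {q w : ℂ} (hq : q ≠ 0) (hw : w ≠ 0) (n : ℕ) :
    qPoch (w / q ^ n) q n = (-w) ^ n / q ^ ((n + 1).choose 2) * qPoch (q / w) q n := by
  induction n with
  | zero => simp
  | succ n ih =>
    have e : w / q ^ (n + 1) * q = w / q ^ n := by
      field_simp
      ring
    have h5 : (n + 1 + 1).choose 2 = (n + 1) + (n + 1).choose 2 := by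
      rw [Nat.choose_succ_succ' (n + 1) 1, Nat.choose_one_right]
    rw [qPoch_succ', e, ih, qPoch_succ, h5, pow_add q]
    field_simp
    ring

lemma prod_erase_range {f : ℕ → ℂ} {N i : ℕ} (hi : i ≤ N) :
    ∏ j ∈ (Finset.range (N + 1)).erase i, f j =
      (∏ j ∈ Finset.range i, f j) * ∏ j ∈ Finset.range (N - i), f (i + 1 + j) := by
  have h : ∏ j ∈ (Finset.range (N + 1)).erase i, f j =
      ∏ j ∈ Finset.range (N + 1), if j = i then 1 else f j := by
    rw [← Finset.mul_prod_erase (Finset.range (N + 1)) (fun j => if j = i then 1 else f j)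
      (Finset.mem_range.2 (Nat.lt_succ_of_le hi)), if_pos rfl, one_mul]
    exact Finset.prod_congr rfl fun j hj => by rw [if_neg (Finset.ne_of_mem_erase hj)]
  rw [h, show N + 1 = i + 1 + (N - i) by omega, Finset.prod_range_add, Finset.prod_range_succ,
    if_pos rfl, mul_one]
  congr 1
  · exact Finset.prod_congr rfl fun j hj => by rw [if_neg (Finset.mem_range.1 hj).ne]
  · exact Finset.prod_congr (by congr 1) fun j _ => by rw [if_neg (by omega)]

/-- Partial fractions for the reciprocal of a finite product `(x; q)_{N+1}`. -/
lemma pow_div_qPoch_eq_sum {q : ℂ} (hq0 : q ≠ 0) (hq : ‖q‖ < 1) {x : ℂ} {N m : ℕ} (hm : m ≤ N)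
    (hx : ∀ k : ℕ, x * q ^ k ≠ 1) :
    x ^ m / qPoch x q (N + 1) = ∑ k ∈ Finset.range (N + 1),
      (-1) ^ k * q ^ ((k + 1).choose 2) / (q ^ k) ^ m *
        (qFactInv q k * qFactInv q (N - k)) / (1 - x * q ^ k) := by
  set v : ℕ → ℂ := fun k => (q ^ k)⁻¹ with hv
  have hqk : ∀ k : ℕ, q ^ k ≠ 0 := fun k => pow_ne_zero _ hq0
  have hinj : Set.InjOn v (Finset.range (N + 1)) := fun i _ j _ hij => by
    have h1 : ‖q‖ ^ i = ‖q‖ ^ j := by simpa [hv] using congrArg norm (inv_injective hij)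
    exact pow_right_injective₀ (norm_pos_iff.2 hq0) hq.ne h1
  have hne : ∀ i ∈ Finset.range (N + 1), x ≠ v i := fun i _ h => hx i (by
    rw [h]; exact inv_mul_cancel₀ (hqk i))
  have h1 := Lagrange.eq_interpolate (s := Finset.range (N + 1)) (v := v)
    (f := (Polynomial.X : Polynomial ℂ) ^ m) hinj (by
      rw [Polynomial.degree_X_pow, Finset.card_range]
      exact_mod_cast Nat.lt_succ_of_le hm)
  have h2 := congrArg (Polynomial.eval x) h1
  rw [Lagrange.eval_interpolate_not_at_node _ hne, Lagrange.eval_nodal] at h2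
  simp only [Polynomial.eval_pow, Polynomial.eval_X] at h2
  have h3 : ∏ i ∈ Finset.range (N + 1), (x - v i) =
      (∏ i ∈ Finset.range (N + 1), (-v i)) * qPoch x q (N + 1) := by
    rw [qPoch, ← Finset.prod_mul_distrib]
    refine Finset.prod_congr rfl fun i _ => ?_
    have := hqk i
    simp only [hv]
    field_simp
    ring
  rw [h3] at h2
  rw [h2, mul_assoc, mul_comm (qPoch x q (N + 1)), ← mul_assoc,
    mul_div_cancel_right₀ _ (qPoch_ne_zero hx _), Finset.mul_sum]
  refine Finset.sum_congr rfl fun k hk => ?_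
  have hkN : k ≤ N := Nat.lt_succ_iff.1 (Finset.mem_range.1 hk)
  have h4 : ∏ j ∈ (Finset.range (N + 1)).erase k, (1 - q ^ j / q ^ k) =
      (-1) ^ k / q ^ ((k + 1).choose 2) * qPoch q q k * qPoch q q (N - k) := by
    rw [prod_erase_range hkN]
    congr 1
    · have := qPoch_div_pow hq0 one_ne_zero k
      rw [div_one] at this
      rw [← this, qPoch]
      exact Finset.prod_congr rfl fun j _ => by ring
    · rw [qPoch]
      refine Finset.prod_congr rfl fun j _ => ?_
      rw [pow_add, pow_add, mul_assoc, mul_div_cancel_left₀ _ (hqk k), pow_one]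
  have h5 : Lagrange.nodalWeight (Finset.range (N + 1)) v k *
      ∏ i ∈ Finset.range (N + 1), (-v i) = -v k *
        (∏ j ∈ (Finset.range (N + 1)).erase k, (1 - q ^ j / q ^ k))⁻¹ := by
    rw [Lagrange.nodalWeight, ← Finset.mul_prod_erase _ _ hk, mul_left_comm,
      ← Finset.prod_mul_distrib, ← Finset.prod_inv_distrib]
    congr 1
    refine Finset.prod_congr rfl fun j _ => ?_
    have h6 : v k - v j = -v j * (1 - q ^ j / q ^ k) := by
      simp only [hv]
      field_simp [hqk j, hqk k]
      ring
    have h7 : -v j ≠ 0 := neg_ne_zero.2 (inv_ne_zero (hqk j))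
    rw [h6, mul_inv, mul_right_comm, inv_mul_cancel₀ h7, one_mul]
  have h8 : x - v k = -v k * (1 - x * q ^ k) := by
    simp only [hv]
    field_simp [hqk k]
    ring
  have h9 : 1 - x * q ^ k ≠ 0 := sub_ne_zero.2 (hx k).symm
  have h10 := qPoch_ne_zero (mul_pow_ne_one_of_norm_lt_one hq hq) k
  have h11 := qPoch_ne_zero (mul_pow_ne_one_of_norm_lt_one hq hq) (N - k)
  have h12 : -v k ≠ 0 := neg_ne_zero.2 (inv_ne_zero (hqk k))
  have h13 : ((-1 : ℂ) ^ k) * (-1) ^ k = 1 := by rw [← mul_pow]; simp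
  rw [← mul_assoc, ← mul_assoc, mul_comm (∏ i ∈ Finset.range (N + 1), (-v i)), h5, h4, h8,
    show (N : ℤ) - k = ((N - k : ℕ) : ℤ) by omega, qFactInv_natCast, qFactInv_natCast]
  have h14 : v k ^ m = 1 / (q ^ k) ^ m := by simp [hv]
  have h15 : ((-1 : ℂ) ^ k)⁻¹ = (-1) ^ k := by
    rw [← inv_pow]
    norm_num
  rw [h14]
  simp only [mul_inv, div_eq_mul_inv, h15, inv_inv, one_mul]
  generalize (1 - x * q ^ k)⁻¹ = d
  generalize ((q ^ k) ^ m)⁻¹ = e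
  rw [show ∀ a b c f g : ℂ, -v k * (a * b * c * f) * ((-v k)⁻¹ * d) * g =
    (-v k * (-v k)⁻¹) * (a * b * c * f * d * g) by intros; ring, mul_inv_cancel₀ h12]
  ring

lemma two_mul_int_choose (r : ℤ) : 2 * (r * (r + 1) / 2) = r * (r + 1) :=
  Int.mul_ediv_cancel' (Int.even_mul_succ_self r).two_dvd

lemma two_mul_int_choose' (r : ℤ) : 2 * (r * (r - 1) / 2) = r * (r - 1) :=
  Int.mul_ediv_cancel' (Int.even_mul_pred_self r).two_dvd

lemma two_mul_natCast_choose (n : ℕ) : 2 * (((n + 1).choose 2 : ℕ) : ℤ) = n * (n + 1) := by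
  have := Nat.triangle_succ n
  rw [Nat.choose_two_right]
  have h : 2 * ((n + 1) * (n + 1 - 1) / 2) = (n + 1) * (n + 1 - 1) :=
    Nat.mul_div_cancel' (by simpa [mul_comm] using (Nat.even_mul_succ_self n).two_dvd)
  have h2 : (2 * ((n + 1) * (n + 1 - 1) / 2 : ℕ) : ℤ) = ((n + 1) * (n + 1 - 1) : ℕ) := by
    exact_mod_cast h
  rw [h2]
  push_cast [Nat.add_sub_cancel]
  ring

lemma mul_zpow_ne_one_of_nat {q w : ℂ} (hq0 : q ≠ 0) (h : ∀ r : ℤ, w * q ^ r ≠ 1) (n k : ℕ) :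
    w / q ^ n * q ^ k ≠ 1 := by
  have := h (k - n)
  rwa [zpow_sub₀ hq0, zpow_natCast, zpow_natCast, mul_div_assoc', mul_comm w, mul_div_assoc,
    mul_comm] at this

lemma neg_one_zpow_eq_pow_mul (n k : ℕ) : (-1 : ℂ) ^ ((k : ℤ) - n) = (-1) ^ k * (-1) ^ n := by
  rw [zpow_sub₀ (by simp), zpow_natCast, zpow_natCast, div_eq_mul_inv]
  congr 1
  rw [← inv_pow]
  norm_num

lemma sum_range_eq_sum_Icc (f : ℤ → ℂ) (n M : ℕ) :
    ∑ k ∈ Finset.range (n + M + 1), f (k - n) = ∑ r ∈ Finset.Icc (-(n : ℤ)) M, f r := by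
  refine Finset.sum_nbij' (fun k => (k : ℤ) - n) (fun r => (r + n).toNat) ?_ ?_ ?_ ?_ ?_
  · intro k hk
    simp only [Finset.mem_range, Finset.mem_Icc] at *
    omega
  · intro k hk
    simp only [Finset.mem_range, Finset.mem_Icc] at *
    omega
  · intro k hk
    simp
  · intro k hk
    simp only [Finset.mem_Icc] at hk
    omega
  · intro k hk
    rfl

/-- The coefficient of `1 / (1 - w q^r)` in the partial fraction expansion of
`1 / ((w; q)_{M+1} (q/w; q)_n)`. -/
def pfCoeff (q : ℂ) (n M r : ℤ) : ℂ :=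
  (-1) ^ r * q ^ (r * (r + 1) / 2) * (qFactInv q (M - r) * qFactInv q (n + r))

theorem inv_qPoch_mul_qPoch {q w : ℂ} (hq0 : q ≠ 0) (hq : ‖q‖ < 1) (hw0 : w ≠ 0)
    (hw : ∀ r : ℤ, w * q ^ r ≠ 1) (n M : ℕ) :
    (qPoch w q (M + 1) * qPoch (q / w) q n)⁻¹ =
      ∑ r ∈ Finset.Icc (-(n : ℤ)) M, pfCoeff q n M r / (1 - w * q ^ r) := by
  have h1 := pow_div_qPoch_eq_sum hq0 hq (x := w / q ^ n) (N := n + M) (m := n) (by omega)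
    (mul_zpow_ne_one_of_nat hq0 hw n)
  rw [add_assoc, qPoch_add, div_mul_cancel₀ _ (pow_ne_zero n hq0), qPoch_div_pow hq0 hw0] at h1
  have hA : (qPoch w q (M + 1) * qPoch (q / w) q n)⁻¹ = (-1) ^ n * (q ^ n) ^ n /
      q ^ ((n + 1).choose 2) * ((w / q ^ n) ^ n /
        ((-w) ^ n / q ^ ((n + 1).choose 2) * qPoch (q / w) q n * qPoch w q (M + 1))) := by
    have h13 : ((-1 : ℂ) ^ n) * (-1) ^ n = 1 := by rw [← mul_pow]; simp
    rw [neg_pow w, div_pow]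
    have : ((-1 : ℂ) ^ n) ≠ 0 := by simp
    field_simp
  rw [hA, h1, Finset.mul_sum, ← add_assoc, ← sum_range_eq_sum_Icc]
  refine Finset.sum_congr rfl fun k _ => ?_
  have e1 : w / q ^ n * q ^ k = w * q ^ ((k : ℤ) - n) := by
    rw [zpow_sub₀ hq0, zpow_natCast, zpow_natCast]; ring
  rw [pfCoeff, e1, neg_one_zpow_eq_pow_mul,
    show (M : ℤ) - (k - n) = (n + M : ℕ) - k by push_cast; ring, add_sub_cancel]
  have e2 : q ^ (((k : ℤ) - n) * (k - n + 1) / 2) =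
      (q ^ n) ^ n / q ^ ((n + 1).choose 2) * (q ^ ((k + 1).choose 2) / (q ^ k) ^ n) := by
    simp_rw [← pow_mul, ← zpow_natCast]
    rw [← zpow_sub₀ hq0, ← zpow_sub₀ hq0, ← zpow_add₀ hq0]
    congr 1
    have a1 := two_mul_int_choose ((k : ℤ) - n)
    have a2 := two_mul_natCast_choose n
    have a3 := two_mul_natCast_choose k
    push_cast
    linarith
  rw [e2]
  ring

/-- The `q`-binomial theorem. -/
theorem qPoch_eq_sum {q : ℂ} (hq0 : q ≠ 0) (hq : ‖q‖ < 1) (x : ℂ) (N : ℕ) :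
    qPoch x q N = ∑ k ∈ Finset.range (N + 1), (-1) ^ k * q ^ (k.choose 2) * x ^ k *
      (qPoch q q N * (qFactInv q k * qFactInv q (N - k))) := by
  induction N with
  | zero => simp [qFactInv]
  | succ N ih =>
    rw [Finset.sum_range_succ']
    set a : ℕ → ℂ := fun k => (-1) ^ k * q ^ (k.choose 2) * x ^ k *
      (qPoch q q N * (qFactInv q k * qFactInv q (N - k))) with ha
    have haN : a (N + 1) = 0 := by
      simp [ha, qFactInv_of_neg]
    have hq1 : qPoch q q (N + 1) = qPoch q q N * (1 - q ^ (N + 1)) := by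
      rw [qPoch_succ, pow_succ']
    have key : ∀ k : ℕ, (-1) ^ (k + 1) * q ^ ((k + 1).choose 2) * x ^ (k + 1) *
        (qPoch q q (N + 1) * (qFactInv q (k + 1 : ℕ) * qFactInv q ((N + 1 : ℕ) - (k + 1 : ℕ)))) =
        a (k + 1) - x * q ^ N * a k := fun k => by
      have h1 : qFactInv q k = qFactInv q (k + 1) * (1 - q ^ (k + 1)) := by
        have := qFactInv_eq_mul hq (k + 1)
        rw [add_sub_cancel_right] at this
        rw [this]
        norm_cast
      have h2 : qFactInv q ((N : ℤ) - (k + 1)) =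
          qFactInv q ((N : ℤ) - k) * (1 - q ^ ((N : ℤ) - k)) := by
        rw [← qFactInv_eq_mul hq]
        congr 1
        ring
      have h5 : (k + 1).choose 2 = k + k.choose 2 := by
        rw [Nat.choose_succ_succ' k 1, Nat.choose_one_right]
      have h6 : q ^ ((N : ℤ) - k) * q ^ k = q ^ N := by
        rw [zpow_sub₀ hq0, zpow_natCast, zpow_natCast, div_mul_cancel₀ _ (pow_ne_zero _ hq0)]
      simp only [ha]
      push_cast
      rw [h1, h2, hq1, h5, show (N : ℤ) + 1 - (k + 1) = N - k by ring, pow_add q k, pow_succ q N,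
        pow_succ q k, ← h6]
      ring
    simp_rw [key]
    rw [Finset.sum_sub_distrib, ← Finset.mul_sum, qPoch_succ, ih]
    have h3 : ∑ k ∈ Finset.range (N + 1), a (k + 1) = ∑ k ∈ Finset.range (N + 1), a k - a 0 := by
      rw [eq_sub_iff_add_eq, ← Finset.sum_range_succ' a (N + 1), Finset.sum_range_succ, haN,
        add_zero]
    rw [h3]
    have h4 : (qPoch q q (N + 1))⁻¹ * qPoch q q (N + 1) = 1 :=
      inv_mul_cancel₀ (qPoch_ne_zero (mul_pow_ne_one_of_norm_lt_one hq hq) _)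
    have h5 : qPoch q q N * (qPoch q q N)⁻¹ = 1 :=
      mul_inv_cancel₀ (qPoch_ne_zero (mul_pow_ne_one_of_norm_lt_one hq hq) _)
    have h6 : a 0 = 1 := by
      simp [ha, qFactInv_natCast, ← mul_assoc, h5]
    have h7 : qFactInv q ((N + 1 : ℕ) - (0 : ℕ)) = (qPoch q q (N + 1))⁻¹ := by
      rw [← qFactInv_natCast]; simp
    rw [h6, h7]
    simp [qFactInv, mul_comm (qPoch q q (N + 1)), h4]
    ring

/-- The finite form of the Jacobi triple product identity. -/
theorem qPoch_mul_qPoch {q w : ℂ} (hq0 : q ≠ 0) (hq : ‖q‖ < 1) (hw0 : w ≠ 0) (n : ℕ) :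
    qPoch w q n * qPoch (q / w) q n =
      ∑ r ∈ Finset.Icc (-(n : ℤ)) n, (-1) ^ r * q ^ (r * (r - 1) / 2) * w ^ r *
        (qPoch q q (n + n) * (qFactInv q (n + r) * qFactInv q (n - r))) := by
  have h1 := qPoch_eq_sum hq0 hq (w / q ^ n) (n + n)
  rw [qPoch_add, div_mul_cancel₀ _ (pow_ne_zero n hq0), qPoch_div_pow hq0 hw0] at h1
  have hA : qPoch w q n * qPoch (q / w) q n = (-1) ^ n * q ^ ((n + 1).choose 2) / w ^ n *
      ((-w) ^ n / q ^ ((n + 1).choose 2) * qPoch (q / w) q n * qPoch w q n) := by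
    have h13 : ((-1 : ℂ) ^ n) * (-1) ^ n = 1 := by rw [← mul_pow]; simp
    rw [neg_pow w]
    field_simp
    linear_combination (-qPoch w q n * qPoch (q / w) q n) * h13
  rw [hA, h1, Finset.mul_sum, ← sum_range_eq_sum_Icc]
  refine Finset.sum_congr rfl fun k _ => ?_
  rw [neg_one_zpow_eq_pow_mul,
    show (n : ℤ) - (k - n) = (n + n : ℕ) - k by push_cast; ring, add_sub_cancel]
  have e2 : q ^ (((k : ℤ) - n) * (k - n - 1) / 2) =
      q ^ ((n + 1).choose 2) * (q ^ (k.choose 2) / (q ^ n) ^ k) := by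
    simp_rw [← pow_mul, ← zpow_natCast]
    rw [← zpow_sub₀ hq0, ← zpow_add₀ hq0]
    congr 1
    have a1 := two_mul_int_choose' ((k : ℤ) - n)
    have a2 := two_mul_natCast_choose n
    have a3 : 2 * ((k.choose 2 : ℕ) : ℤ) = k * (k - 1) := by
      cases k with
      | zero => simp
      | succ k => rw [two_mul_natCast_choose]; push_cast; ring
    push_cast
    linarith
  have e3 : w ^ ((k : ℤ) - n) = w ^ k / w ^ n := by
    rw [zpow_sub₀ hw0, zpow_natCast, zpow_natCast]
  rw [e2, e3, div_pow]
  ring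

lemma exists_norm_qFactInv_le {q : ℂ} (hq : ‖q‖ < 1) :
    ∃ C : ℝ, 0 < C ∧ ∀ k, ‖qFactInv q k‖ ≤ C := by
  obtain ⟨C, hC, H⟩ := exists_norm_qPoch_inv_le hq (mul_pow_ne_one_of_norm_lt_one hq hq)
  refine ⟨C, hC, fun k => ?_⟩
  unfold qFactInv
  split_ifs
  · exact H _
  · simpa using hC.le

lemma tendsto_qFactInv {q : ℂ} (hq : ‖q‖ < 1) :
    Tendsto (qFactInv q) atTop (𝓝 (qPochInf q q)⁻¹) := by
  have h := ((tendsto_qPoch q hq).inv₀ (qPochInf_ne_zero hq (mul_pow_ne_one_of_norm_lt_one hq hq)))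
  have ht : Tendsto Int.toNat atTop atTop :=
    tendsto_atTop.2 fun b => (eventually_ge_atTop (b : ℤ)).mono fun k hk => by omega
  refine (h.comp ht).congr' ?_
  filter_upwards [eventually_ge_atTop 0] with k hk
  simp [qFactInv, hk]

lemma tendsto_qFactInv_natCast_add {q : ℂ} (hq : ‖q‖ < 1) (r : ℤ) :
    Tendsto (fun n : ℕ => qFactInv q (n + r)) atTop (𝓝 (qPochInf q q)⁻¹) :=
  (tendsto_qFactInv hq).comp
    (tendsto_atTop_add_const_right _ r tendsto_natCast_atTop_atTop)

lemma int_choose_nonneg (r : ℤ) : 0 ≤ r * (r + 1) / 2 := by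
  refine Int.ediv_nonneg ?_ (by norm_num)
  rcases lt_or_ge r 0 with h | h <;> nlinarith

lemma norm_pfCoeff_le {q : ℂ} {C : ℝ} (hC : ∀ k, ‖qFactInv q k‖ ≤ C) (n M r : ℤ) :
    ‖pfCoeff q n M r‖ ≤ ‖q‖ ^ (r * (r + 1) / 2) * (C * C) := by
  have h0 : 0 ≤ C := (norm_nonneg _).trans (hC 0)
  rw [pfCoeff, norm_mul, norm_mul, norm_mul, norm_zpow, norm_zpow, norm_neg, norm_one, one_zpow,
    one_mul]
  gcongr <;> exact hC _

lemma summable_zpow_mul_zpow_choose (x : ℝ) {r : ℝ} (hr0 : 0 < r) (hr : r < 1) :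
    Summable fun k : ℤ => x ^ k * r ^ (k * (k - 1) / 2) := by
  have hch : ∀ n : ℕ, ((n : ℤ) * (n - 1) / 2) = (n.choose 2 : ℕ) := fun n => by
    have a1 := two_mul_int_choose' (n : ℤ)
    have a3 : 2 * ((n.choose 2 : ℕ) : ℤ) = n * (n - 1) := by
      cases n with
      | zero => simp
      | succ k => rw [two_mul_natCast_choose]; push_cast; ring
    omega
  refine Summable.of_nat_of_neg ?_ ?_
  · refine (summable_pow_mul_pow_choose x hr0.le hr).congr fun n => ?_
    rw [hch, zpow_natCast, zpow_natCast]
  · refine (summable_pow_mul_pow_choose (x⁻¹ * r) hr0.le hr).congr fun n => ?_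
    have : (-(n : ℤ)) * (-n - 1) / 2 = n + (n.choose 2 : ℕ) := by
      rw [← hch]
      have a1 := two_mul_int_choose' (n : ℤ)
      have a2 := two_mul_int_choose' (-(n : ℤ))
      linarith
    rw [this, zpow_add₀ hr0.ne', zpow_natCast, zpow_natCast, zpow_neg, zpow_natCast, mul_pow,
      inv_pow]
    ring

lemma exists_norm_inv_one_sub_le {q w : ℂ} (hq0 : q ≠ 0) (hq : ‖q‖ < 1) (hw0 : w ≠ 0) :
    ∃ C : ℝ, 0 < C ∧ ∀ r : ℤ, ‖(1 - w * q ^ r)⁻¹‖ ≤ C := by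
  have hpow := tendsto_pow_atTop_nhds_zero_of_norm_lt_one hq
  have h1 : Tendsto (fun n : ℕ => (1 - w * q ^ (n : ℤ))⁻¹) atTop (𝓝 (1 - w * 0)⁻¹) := by
    simp_rw [zpow_natCast]
    exact (tendsto_const_nhds.sub (hpow.const_mul w)).inv₀ (by simp)
  have h2 : Tendsto (fun n : ℕ => (1 - w * q ^ (-(n : ℤ)))⁻¹) atTop (𝓝 (0 / (0 - w))) := by
    refine (hpow.div (hpow.sub_const w) (by simpa using hw0)).congr fun n => ?_
    have h3 : q ^ n ≠ 0 := pow_ne_zero _ hq0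
    rw [zpow_neg, zpow_natCast]
    have : 1 - w * (q ^ n)⁻¹ = (q ^ n - w) / q ^ n := by field_simp
    rw [this, inv_div]
    rfl
  obtain ⟨C₁, hC₁⟩ := h1.norm.bddAbove_range
  obtain ⟨C₂, hC₂⟩ := h2.norm.bddAbove_range
  refine ⟨max (max C₁ C₂) 1, by positivity, fun r => le_max_of_le_left ?_⟩
  obtain ⟨n, rfl | rfl⟩ := r.eq_nat_or_neg
  · exact le_max_of_le_left (hC₁ ⟨n, rfl⟩)
  · exact le_max_of_le_right (hC₂ ⟨n, rfl⟩)

/-- The Jacobi triple product identity. -/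
theorem jacobi_triple_product {q w : ℂ} (hq0 : q ≠ 0) (hq : ‖q‖ < 1) (hw0 : w ≠ 0) :
    qPochInf q q * (qPochInf w q * qPochInf (q / w) q) =
      ∑' r : ℤ, (-1) ^ r * q ^ (r * (r - 1) / 2) * w ^ r := by
  have hqq := qPochInf_ne_zero hq (mul_pow_ne_one_of_norm_lt_one hq hq)
  set F : ℕ → ℤ → ℂ := fun n r => (-1) ^ r * q ^ (r * (r - 1) / 2) * w ^ r *
        (qPoch q q (n + n) * (qFactInv q (n + r) * qFactInv q (n - r))) with hF
  have hfin : ∀ n : ℕ, ∑' r, F n r = qPoch w q n * qPoch (q / w) q n := fun n => by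
    rw [qPoch_mul_qPoch hq0 hq hw0]
    refine tsum_eq_sum fun r hr => ?_
    rw [Finset.mem_Icc] at hr
    rcases lt_or_ge r (-n) with h | h
    · simp [hF, qFactInv_of_neg q (show (n : ℤ) + r < 0 by omega)]
    · simp [hF, qFactInv_of_neg q (show (n : ℤ) - r < 0 by omega)]
  obtain ⟨C₁, h1, H1⟩ := exists_norm_qPoch_le q hq
  obtain ⟨C₂, h2, H2⟩ := exists_norm_qFactInv_le hq
  have lim : Tendsto (fun n => ∑' r, F n r) atTop (𝓝 (∑' r : ℤ, (-1) ^ r * q ^ (r * (r - 1) / 2)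
      * w ^ r * (qPochInf q q * ((qPochInf q q)⁻¹ * (qPochInf q q)⁻¹)))) := by
    refine tendsto_tsum_of_dominated_convergence (bound := fun r : ℤ =>
      (‖w‖ ^ r * ‖q‖ ^ (r * (r - 1) / 2)) * (C₁ * (C₂ * C₂)))
      ((summable_zpow_mul_zpow_choose ‖w‖ (norm_pos_iff.2 hq0) hq).mul_right _)
      (fun r => ?_) (Eventually.of_forall fun n r => ?_)
    · refine Tendsto.const_mul _ (Tendsto.mul ?_ (Tendsto.mul ?_ ?_))
      · exact (tendsto_qPoch q hq).comp (tendsto_id.atTop_add_atTop tendsto_id)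
      · exact tendsto_qFactInv_natCast_add hq r
      · simpa [sub_eq_add_neg] using tendsto_qFactInv_natCast_add hq (-r)
    · simp only [hF, norm_mul, norm_zpow, norm_neg, norm_one, one_zpow, one_mul]
      rw [mul_comm (‖q‖ ^ _)]
      gcongr <;> first | exact H1 _ | exact H2 _
  simp_rw [hfin] at lim
  have e := tendsto_nhds_unique ((tendsto_qPoch w hq).mul (tendsto_qPoch (q / w) hq)) lim
  rw [e, ← tsum_mul_left]
  refine tsum_congr fun r => ?_
  field_simp

lemma inv_qPoch_mul_qPoch_eq_tsum {q w : ℂ} (hq0 : q ≠ 0) (hq : ‖q‖ < 1) (hw0 : w ≠ 0)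
    (hw : ∀ r : ℤ, w * q ^ r ≠ 1) (n M : ℕ) :
    (qPoch w q (M + 1) * qPoch (q / w) q n)⁻¹ =
      ∑' r : ℤ, pfCoeff q n M r * (1 - w * q ^ r)⁻¹ := by
  rw [inv_qPoch_mul_qPoch hq0 hq hw0 hw]
  simp_rw [← div_eq_mul_inv]
  refine (tsum_eq_sum fun r hr => ?_).symm
  rw [Finset.mem_Icc] at hr
  rcases lt_or_ge r (-n) with h | h
  · simp [pfCoeff, qFactInv_of_neg q (show (n : ℤ) + r < 0 by omega)]
  · simp [pfCoeff, qFactInv_of_neg q (show (M : ℤ) - r < 0 by omega)]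

lemma summable_norm_zpow_choose {q : ℂ} (hq0 : q ≠ 0) (hq : ‖q‖ < 1) :
    Summable fun r : ℤ => ‖q‖ ^ (r * (r + 1) / 2) := by
  have hq' := norm_pos_iff.2 hq0
  refine (summable_zpow_mul_zpow_choose ‖q‖ hq' hq).congr fun r => ?_
  rw [← zpow_add₀ hq'.ne']
  congr 1
  have a1 := two_mul_int_choose' r
  have a2 := two_mul_int_choose r
  linarith

/-- The partial fraction expansion of the reciprocal of the theta function. -/
theorem tsum_div_one_sub {q w : ℂ} (hq0 : q ≠ 0) (hq : ‖q‖ < 1) (hw0 : w ≠ 0)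
    (hw : ∀ r : ℤ, w * q ^ r ≠ 1) :
    ∑' r : ℤ, (-1) ^ r * q ^ (r * (r + 1) / 2) * (1 - w * q ^ r)⁻¹ =
      qPochInf q q ^ 2 / (qPochInf w q * qPochInf (q / w) q) := by
  have hqq := qPochInf_ne_zero hq (mul_pow_ne_one_of_norm_lt_one hq hq)
  have hw1 : qPochInf w q ≠ 0 := qPochInf_ne_zero hq fun j => by simpa using hw j
  have hw2 : qPochInf (q / w) q ≠ 0 := qPochInf_ne_zero hq fun j h => hw (-(j + 1)) (by
    rw [zpow_neg, ← div_eq_mul_inv, div_eq_one_iff_eq (zpow_ne_zero _ hq0)]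
    rw [div_mul_eq_mul_div, div_eq_one_iff_eq hw0] at h
    rw [← h]
    norm_cast
    rw [pow_succ']
    )
  obtain ⟨C₁, h1, H1⟩ := exists_norm_inv_one_sub_le hq0 hq hw0
  obtain ⟨C₂, h2, H2⟩ := exists_norm_qFactInv_le hq
  have lim : Tendsto (fun n : ℕ => ∑' r : ℤ, pfCoeff q n n r * (1 - w * q ^ r)⁻¹) atTop
      (𝓝 (∑' r : ℤ, (-1) ^ r * q ^ (r * (r + 1) / 2) *
        ((qPochInf q q)⁻¹ * (qPochInf q q)⁻¹) * (1 - w * q ^ r)⁻¹)) := by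
    refine tendsto_tsum_of_dominated_convergence (bound := fun r : ℤ =>
      ‖q‖ ^ (r * (r + 1) / 2) * (C₂ * C₂) * C₁)
      (((summable_norm_zpow_choose hq0 hq).mul_right _).mul_right _)
      (fun r => ?_) (Eventually.of_forall fun n r => ?_)
    · refine Tendsto.mul_const _ (Tendsto.const_mul _ (Tendsto.mul ?_ ?_))
      · simpa [sub_eq_add_neg] using tendsto_qFactInv_natCast_add hq (-r)
      · exact tendsto_qFactInv_natCast_add hq r
    · rw [norm_mul]
      gcongr
      exacts [norm_pfCoeff_le H2 _ _ _, H1 _]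
  simp_rw [← inv_qPoch_mul_qPoch_eq_tsum hq0 hq hw0 hw] at lim
  have l2 := ((((tendsto_add_atTop_iff_nat 1).2 (tendsto_qPoch w hq)).mul
    (tendsto_qPoch (q / w) hq)).inv₀ (mul_ne_zero hw1 hw2))
  rw [div_eq_mul_inv, tendsto_nhds_unique l2 lim, ← tsum_mul_left]
  refine tsum_congr fun r => ?_
  field_simp

/-- Interchange of summation for series of finite sums. -/
lemma tsum_mul_tsum_comm {c : ℕ → ℂ} {A : ℕ → ℤ → ℂ} {g : ℤ → ℂ} {C₁ C₂ : ℝ}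
    (hc : Summable fun n : ℕ => ‖c n‖ * (2 * n + 3)) (hA : ∀ n r, ‖A n r‖ ≤ C₁)
    (hA0 : ∀ (n : ℕ) r, r ∉ Finset.Icc (-(n + 1) : ℤ) (n + 1) → A n r = 0)
    (hg : ∀ r, ‖g r‖ ≤ C₂) :
    (Summable fun n => c n * ∑' r, A n r * g r) ∧
      ∑' n, c n * ∑' r, A n r * g r = ∑' r, (∑' n, c n * A n r) * g r := by
  have h1 : 0 ≤ C₁ := (norm_nonneg _).trans (hA 0 0)
  have h2 : 0 ≤ C₂ := (norm_nonneg _).trans (hg 0)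
  have hs : Summable fun p : ℕ × ℤ => ‖c p.1 * (A p.1 p.2 * g p.2)‖ := by
    refine (summable_prod_of_nonneg fun p => norm_nonneg _).2 ⟨fun n => ?_, ?_⟩
    · exact summable_of_ne_finset_zero (s := Finset.Icc (-(n + 1) : ℤ) (n + 1)) fun r hr => by
        simp [hA0 n r hr]
    · refine Summable.of_nonneg_of_le (fun n => tsum_nonneg fun r => norm_nonneg _) (fun n => ?_)
        (hc.mul_right (C₁ * C₂))
      rw [tsum_eq_sum (s := Finset.Icc (-(n + 1) : ℤ) (n + 1)) fun r hr => by simp [hA0 n r hr]]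
      refine (Finset.sum_le_card_nsmul _ _ (‖c n‖ * (C₁ * C₂)) fun r _ => ?_).trans_eq ?_
      · rw [norm_mul, norm_mul]
        gcongr
        exacts [hA _ _, hg _]
      · have : ((n : ℤ) + 1 + 1 - -(n + 1)).toNat = 2 * n + 3 := by omega
        rw [Int.card_Icc, this, nsmul_eq_mul]
        push_cast
        ring
  have hs' := hs.of_norm
  constructor
  · refine hs'.prod.congr fun n => ?_
    exact tsum_mul_left (f := fun r => A n r * g r) (a := c n)
  · simp_rw [← tsum_mul_left, ← tsum_mul_right]
    refine (Summable.tsum_comm' (f := fun n r => c n * (A n r * g r)) hs'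
      (fun n => hs'.prod_factor n) (fun r => hs'.prod_symm.prod_factor r)).symm.trans ?_
    exact tsum_congr fun r => tsum_congr fun n => by ring

lemma norm_sq_lt_one {q : ℂ} (hq : ‖q‖ < 1) : ‖q ^ 2‖ < 1 := by
  rw [norm_pow]
  exact pow_lt_one₀ (norm_nonneg _) hq two_ne_zero

lemma pow_mul_pow_ne_one {q : ℂ} (hq : ‖q‖ < 1) {m : ℕ} (hm : m ≠ 0) (j : ℕ) :
    q ^ m * (q ^ 2) ^ j ≠ 1 :=
  mul_pow_ne_one_of_norm_lt_one (by
    rw [norm_pow]; exact pow_lt_one₀ (norm_nonneg _) hq hm) (norm_sq_lt_one hq) j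

lemma sq_eq_add_two_mul_choose (k : ℕ) : k ^ 2 = k + 2 * k.choose 2 := by
  cases k with
  | zero => simp
  | succ k =>
    have := two_mul_natCast_choose k
    zify
    rw [this]
    ring

/-- The quotient `(q; q²)_∞ / (q²; q²)_∞`. -/
def kappa (q : ℂ) : ℂ := qPochInf q (q ^ 2) / qPochInf (q ^ 2) (q ^ 2)

lemma tsum_qPoch_mul_qFactInv {q : ℂ} (hq : ‖q‖ < 1) (s : ℕ) :
    ∑' n : ℕ, (-1) ^ n * q ^ (n ^ 2) * qPoch q (q ^ 2) n *
        (qFactInv (q ^ 2) (n - s) * qFactInv (q ^ 2) (n + s)) =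
      (-1) ^ s * q ^ (s ^ 2) * kappa q := by
  have hQ := norm_sq_lt_one hq
  rw [← (add_left_injective s).tsum_eq]
  · have e : ∀ k : ℕ, (-1) ^ (k + s) * q ^ ((k + s) ^ 2) * qPoch q (q ^ 2) (k + s) *
        (qFactInv (q ^ 2) ((k + s : ℕ) - s) * qFactInv (q ^ 2) ((k + s : ℕ) + s)) =
        (-1) ^ s * q ^ (s ^ 2) * (qPoch q (q ^ 2) s / qPoch (q ^ 2) (q ^ 2) (2 * s)) *
          phiTerm (q ^ (2 * s + 1)) (q ^ 2) (q ^ (2 * s + 1)) k := fun k => by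
      have e1 : ((k + s : ℕ) : ℤ) - s = k := by push_cast; ring
      have e2 : ((k + s : ℕ) : ℤ) + s = (2 * s + k : ℕ) := by push_cast; ring
      have e3 : (k + s) ^ 2 = s ^ 2 + (2 * s + 1) * k + 2 * k.choose 2 := by
        have := sq_eq_add_two_mul_choose k
        nlinarith
      rw [e1, e2, qFactInv_natCast, qFactInv_natCast, add_comm k s, qPoch_add, qPoch_add, phiTerm,
        add_comm s k, e3, ← pow_mul, ← pow_mul, neg_pow (q ^ (2 * s + 1)),
        show q * q ^ (2 * s) = q ^ (2 * s + 1) by ring,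
        show q ^ 2 * q ^ (2 * (2 * s)) = q ^ (2 * s + 1) * q ^ (2 * s + 1) by ring,
        pow_add q (s ^ 2 + _), pow_add q (s ^ 2), pow_add _ k s, pow_mul q (2 * s + 1) k,
        pow_mul q 2 (k.choose 2)]
      simp only [mul_inv, div_eq_mul_inv]
      ring
    simp_rw [e]
    have h1 : ∀ j : ℕ, q ^ (2 * s + 1) * q ^ (2 * s + 1) * (q ^ 2) ^ j ≠ 1 := fun j => by
      rw [← pow_add]
      exact pow_mul_pow_ne_one hq (by omega) j
    rw [tsum_mul_left, tsum_phiTerm hQ h1, kappa, qPochInf_eq_mul q hQ s,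
      qPochInf_eq_mul (q ^ 2) hQ (2 * s), ← pow_mul, ← pow_mul, ← pow_add,
      show q * q ^ (2 * s) = q ^ (2 * s + 1) by ring,
      show q ^ 2 * q ^ (2 * (2 * s)) = q ^ (2 * s + 1 + (2 * s + 1)) by ring,
      mul_div_mul_comm]
    ring
  · intro n hn
    rw [Function.mem_support] at hn
    refine ⟨n - s, Nat.sub_add_cancel ?_⟩
    by_contra h
    exact hn (by rw [qFactInv_of_neg _ (by omega : (n : ℤ) - s < 0)]; simp)

lemma tsum_qPoch_mul_qFactInv' {q : ℂ} (hq : ‖q‖ < 1) (s : ℕ) :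
    ∑' n : ℕ, (-1) ^ (n + 1) * q ^ ((n + 1) ^ 2) * qPoch q (q ^ 2) n *
        (qFactInv (q ^ 2) (n - s) * qFactInv (q ^ 2) (n + 1 + s)) =
      (-1) ^ (s + 1) * q ^ ((s + 1) ^ 2) * (kappa q / (1 - q ^ (2 * s + 1))) := by
  have hQ := norm_sq_lt_one hq
  rw [← (add_left_injective s).tsum_eq]
  · have e : ∀ k : ℕ, (-1) ^ (k + s + 1) * q ^ ((k + s + 1) ^ 2) * qPoch q (q ^ 2) (k + s) *
        (qFactInv (q ^ 2) ((k + s : ℕ) - s) * qFactInv (q ^ 2) ((k + s : ℕ) + 1 + s)) =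
        (-1) ^ (s + 1) * q ^ ((s + 1) ^ 2) *
          (qPoch q (q ^ 2) s / qPoch (q ^ 2) (q ^ 2) (2 * s + 1)) *
          phiTerm (q ^ (2 * s + 1)) (q ^ 2) (q ^ (2 * s + 3)) k := fun k => by
      have e1 : ((k + s : ℕ) : ℤ) - s = k := by push_cast; ring
      have e2 : ((k + s : ℕ) : ℤ) + 1 + s = (2 * s + 1 + k : ℕ) := by push_cast; ring
      have e3 : (k + s + 1) ^ 2 = (s + 1) ^ 2 + (2 * s + 3) * k + 2 * k.choose 2 := by
        have := sq_eq_add_two_mul_choose k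
        nlinarith
      rw [e1, e2, qFactInv_natCast, qFactInv_natCast, e3, add_comm k s, qPoch_add, qPoch_add,
        phiTerm, ← pow_mul, ← pow_mul, neg_pow (q ^ (2 * s + 3)),
        show q * q ^ (2 * s) = q ^ (2 * s + 1) by ring,
        show q ^ 2 * q ^ (2 * (2 * s + 1)) = q ^ (2 * s + 1) * q ^ (2 * s + 3) by ring,
        pow_add q ((s + 1) ^ 2 + _), pow_add q ((s + 1) ^ 2), show s + k + 1 = k + (s + 1) by ring,
        pow_add _ k (s + 1), pow_mul q (2 * s + 3) k, pow_mul q 2 (k.choose 2)]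
      simp only [mul_inv, div_eq_mul_inv]
      ring
    simp_rw [e]
    have h1 : ∀ j : ℕ, q ^ (2 * s + 1) * q ^ (2 * s + 3) * (q ^ 2) ^ j ≠ 1 := fun j => by
      rw [← pow_add]
      exact pow_mul_pow_ne_one hq (by omega) j
    have h2 : 1 - q ^ (2 * s + 1) ≠ 0 := sub_ne_zero.2 fun h =>
      pow_mul_pow_ne_one hq (show 2 * s + 1 ≠ 0 by omega) 0 (by simpa using h.symm)
    rw [tsum_mul_left, tsum_phiTerm hQ h1, kappa, qPochInf_eq_mul q hQ (s + 1), qPoch_succ q,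
      qPochInf_eq_mul (q ^ 2) hQ (2 * s + 1), ← pow_mul, ← pow_mul, ← pow_mul, ← pow_add,
      show q * q ^ (2 * (s + 1)) = q ^ (2 * s + 3) by ring,
      show q * q ^ (2 * s) = q ^ (2 * s + 1) by ring,
      show q ^ 2 * q ^ (2 * (2 * s + 1)) = q ^ (2 * s + 1 + (2 * s + 3)) by ring]
    generalize 1 - q ^ (2 * s + 1) = d at *
    field_simp
  · intro n hn
    rw [Function.mem_support] at hn
    refine ⟨n - s, Nat.sub_add_cancel ?_⟩
    by_contra h
    exact hn (by rw [qFactInv_of_neg _ (by omega : (n : ℤ) - s < 0)]; simp)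

lemma summable_norm_coeff_mul {q : ℂ} (hq : ‖q‖ < 1) {c : ℕ → ℂ} {C : ℝ}
    (hc : ∀ n, ‖c n‖ ≤ C * ‖q‖ ^ (n ^ 2)) : Summable fun n : ℕ => ‖c n‖ * (2 * n + 3) := by
  have hC : 0 ≤ C := by simpa using (norm_nonneg _).trans (hc 0)
  have h1 := summable_pow_mul_geometric_of_norm_lt_one 1 (r := ‖q‖) (by simpa using hq)
  have h0 := summable_geometric_of_lt_one (norm_nonneg q) hq
  have h2 : Summable fun n : ℕ => C * (2 * ((n : ℝ) ^ 1 * ‖q‖ ^ n) + 3 * ‖q‖ ^ n) :=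
    ((h1.mul_left 2).add (h0.mul_left 3)).mul_left C
  refine Summable.of_nonneg_of_le (fun n => by positivity) (fun n => ?_) h2
  have h3 : ‖q‖ ^ (n ^ 2) ≤ ‖q‖ ^ n :=
    pow_le_pow_of_le_one (norm_nonneg _) hq.le (Nat.le_self_pow two_ne_zero n)
  calc ‖c n‖ * (2 * n + 3) ≤ C * ‖q‖ ^ n * (2 * n + 3) := by
        gcongr
        exact (hc n).trans (by gcongr)
    _ = _ := by ring

lemma norm_pfCoeff_le' {q : ℂ} (hq : ‖q‖ < 1) {C : ℝ}
    (hC : ∀ k, ‖qFactInv q k‖ ≤ C) (n M r : ℤ) : ‖pfCoeff q n M r‖ ≤ C * C := by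
  have h0 : 0 ≤ C := (norm_nonneg _).trans (hC 0)
  refine (norm_pfCoeff_le hC n M r).trans (mul_le_of_le_one_left (by positivity) ?_)
  obtain ⟨m, hm⟩ := Int.eq_ofNat_of_zero_le (int_choose_nonneg r)
  rw [hm, zpow_natCast]
  exact pow_le_one₀ (norm_nonneg _) hq.le

lemma pfCoeff_eq_zero (q : ℂ) {n M r : ℤ} (h : r < -n ∨ M < r) : pfCoeff q n M r = 0 := by
  rcases h with h | h
  · simp [pfCoeff, qFactInv_of_neg q (show n + r < 0 by omega)]
  · simp [pfCoeff, qFactInv_of_neg q (show M - r < 0 by omega)]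

lemma sq_zpow_choose (q : ℂ) (r : ℤ) : (q ^ 2) ^ (r * (r + 1) / 2) = q ^ (r * (r + 1)) := by
  rw [← zpow_natCast q 2, ← zpow_mul]
  congr 1
  exact_mod_cast two_mul_int_choose r

lemma neg_one_zpow_mul_self (r : ℤ) : (-1 : ℂ) ^ r * (-1) ^ r = 1 := by
  rw [← mul_zpow]
  simp

/-- The expansion of `K'` as a multiple of an Appell function of level `2`. -/
theorem summable_K₁Term_and_K₁_eq {q w : ℂ} (hq0 : q ≠ 0) (hq : ‖q‖ < 1) (hw0 : w ≠ 0)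
    (hw : ∀ r : ℤ, w * (q ^ 2) ^ r ≠ 1) :
    Summable (K₁Term w q) ∧ K₁ w q =
      (1 - w) * kappa q * ∑' r : ℤ, q ^ (2 * r ^ 2 + r) * (1 - w * (q ^ 2) ^ r)⁻¹ := by
  have hQ := norm_sq_lt_one hq
  have hQ0 : q ^ 2 ≠ 0 := pow_ne_zero 2 hq0
  have hw1 : 1 - w ≠ 0 := sub_ne_zero.2 (by simpa using (hw 0).symm)
  set c : ℕ → ℂ := fun n => (1 - w) * ((-1) ^ n * q ^ (n ^ 2) * qPoch q (q ^ 2) n) with hc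
  obtain ⟨C₁, -, H1⟩ := exists_norm_qFactInv_le hQ
  obtain ⟨C₂, -, H2⟩ := exists_norm_inv_one_sub_le hQ0 hQ hw0
  obtain ⟨C₃, -, H3⟩ := exists_norm_qPoch_le q hQ
  have hcs : Summable fun n : ℕ => ‖c n‖ * (2 * n + 3) := by
    refine summable_norm_coeff_mul hq (C := ‖1 - w‖ * C₃) fun n => ?_
    simp only [hc, norm_mul, norm_pow, norm_neg, norm_one, one_pow, one_mul]
    rw [mul_assoc, mul_comm C₃]
    gcongr
    exact H3 n
  have hK : ∀ n, K₁Term w q n =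
      c n * ∑' r : ℤ, pfCoeff (q ^ 2) n n r * (1 - w * (q ^ 2) ^ r)⁻¹ := fun n => by
    rw [← inv_qPoch_mul_qPoch_eq_tsum hQ0 hQ hw0 hw, qPoch_succ', K₁Term]
    simp only [hc]
    rw [mul_assoc (1 - w) (qPoch (w * q ^ 2) (q ^ 2) n), mul_inv (1 - w), div_eq_mul_inv,
      mul_left_comm _ (1 - w)⁻¹, mul_assoc (1 - w), inv_mul_cancel_left₀ hw1]
  obtain ⟨h1, h2⟩ := tsum_mul_tsum_comm hcs
    (fun n r => norm_pfCoeff_le' hQ H1 n n r)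
    (fun n r hr => pfCoeff_eq_zero _ (by rw [Finset.mem_Icc] at hr; omega)) H2
  simp_rw [← hK] at h1 h2
  refine ⟨h1, ?_⟩
  rw [K₁, h2, ← tsum_mul_left]
  refine tsum_congr fun r => ?_
  rw [← mul_assoc]
  congr 1
  have key : ∑' n : ℕ, (-1) ^ n * q ^ (n ^ 2) * qPoch q (q ^ 2) n *
        (qFactInv (q ^ 2) (n - r) * qFactInv (q ^ 2) (n + r)) =
      (-1) ^ r * q ^ (r ^ 2) * kappa q := by
    obtain ⟨s, rfl | rfl⟩ := r.eq_nat_or_neg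
    · have := tsum_qPoch_mul_qFactInv hq s
      rw [this]
      norm_cast
    · have := tsum_qPoch_mul_qFactInv hq s
      rw [neg_sq, zpow_neg, ← inv_zpow, zpow_natCast, show ((-1 : ℂ)⁻¹) = -1 by norm_num,
        show q ^ ((s : ℤ) ^ 2) = q ^ (s ^ 2) by norm_cast, ← this]
      refine tsum_congr fun n => ?_
      rw [mul_comm (qFactInv _ _), sub_neg_eq_add, ← sub_eq_add_neg]
  have e : ∀ n : ℕ, c n * pfCoeff (q ^ 2) n n r = (1 - w) * ((-1) ^ r * q ^ (r * (r + 1))) *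
      ((-1) ^ n * q ^ (n ^ 2) * qPoch q (q ^ 2) n *
        (qFactInv (q ^ 2) (n - r) * qFactInv (q ^ 2) (n + r))) := fun n => by
    rw [pfCoeff, sq_zpow_choose]
    simp only [hc]
    ring
  simp_rw [e]
  rw [tsum_mul_left, key, show 2 * r ^ 2 + r = r * (r + 1) + r ^ 2 by ring, zpow_add₀ hq0]
  linear_combination (1 - w) * kappa q * q ^ (r * (r + 1)) * q ^ r ^ 2 * neg_one_zpow_mul_self r

lemma summable_zpow_mul_inv_one_sub {q w : ℂ} (hq0 : q ≠ 0) (hq : ‖q‖ < 1) (hw0 : w ≠ 0)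
    (b e : ℤ) : Summable fun r : ℤ => q ^ (2 * r ^ 2 + b * r + e) * (1 - w * (q ^ 2) ^ r)⁻¹ := by
  have hQ := norm_sq_lt_one hq
  obtain ⟨C, -, H⟩ := exists_norm_inv_one_sub_le (pow_ne_zero 2 hq0) hQ hw0
  have hn : ‖q‖ ≠ 0 := norm_ne_zero_iff.2 hq0
  have hs := summable_zpow_mul_zpow_choose (‖q‖ ^ (b + 2)) (r := ‖q‖ ^ 4) (by positivity)
    (pow_lt_one₀ (norm_nonneg _) hq (by norm_num))
  refine Summable.of_norm_bounded (hs.mul_right (‖q‖ ^ e * C)) fun r => ?_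
  have e1 : (‖q‖ ^ (b + 2)) ^ r * (‖q‖ ^ 4) ^ (r * (r - 1) / 2) * ‖q‖ ^ e =
      ‖q‖ ^ (2 * r ^ 2 + b * r + e) := by
    rw [← zpow_natCast ‖q‖ 4, ← zpow_mul, ← zpow_mul, ← zpow_add₀ hn, ← zpow_add₀ hn]
    congr 1
    have := two_mul_int_choose' r
    push_cast
    linarith
  rw [norm_mul, norm_zpow, ← mul_assoc, e1]
  gcongr
  exact H r

lemma odd_zpow_ne_one {q : ℂ} (hq0 : q ≠ 0) (hq : ‖q‖ < 1) (r : ℤ) : q * (q ^ 2) ^ r ≠ 1 := by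
  intro h
  have h1 : ‖q‖ ^ (2 * r + 1) = ‖q‖ ^ (0 : ℤ) := by
    have := congrArg norm h
    rw [norm_mul, norm_zpow, norm_pow, norm_one, ← zpow_natCast ‖q‖ 2, ← zpow_mul] at this
    rw [zpow_add₀ (norm_ne_zero_iff.2 hq0), zpow_one, mul_comm]
    simpa using this
  have := zpow_right_injective₀ (norm_pos_iff.2 hq0) hq.ne h1
  omega

/-- The expansion of `K''` as a multiple of an Appell function of level `2`. -/
theorem summable_K₂Term_and_K₂_eq {q w : ℂ} (hq0 : q ≠ 0) (hq : ‖q‖ < 1) (hw0 : w ≠ 0)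
    (hw : ∀ r : ℤ, w * q * (q ^ 2) ^ r ≠ 1) :
    Summable (fun n => K₂Term w q (n + 1)) ∧ K₂ w q =
      -kappa q * ∑' r : ℤ, q ^ (2 * r ^ 2 + 3 * r + 1) * (1 - q * (q ^ 2) ^ r)⁻¹ *
        (1 - w * q * (q ^ 2) ^ r)⁻¹ := by
  have hQ := norm_sq_lt_one hq
  have hQ0 : q ^ 2 ≠ 0 := pow_ne_zero 2 hq0
  have hwq0 : w * q ≠ 0 := mul_ne_zero hw0 hq0
  set c : ℕ → ℂ := fun n => (-1) ^ (n + 1) * q ^ ((n + 1) ^ 2) * qPoch q (q ^ 2) n with hc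
  obtain ⟨C₁, -, H1⟩ := exists_norm_qFactInv_le hQ
  obtain ⟨C₂, -, H2⟩ := exists_norm_inv_one_sub_le hQ0 hQ hwq0
  obtain ⟨C₃, h3, H3⟩ := exists_norm_qPoch_le q hQ
  have hcs : Summable fun n : ℕ => ‖c n‖ * (2 * n + 3) := by
    refine summable_norm_coeff_mul hq (C := C₃) fun n => ?_
    simp only [hc, norm_mul, norm_pow, norm_neg, norm_one, one_pow, one_mul]
    rw [mul_comm C₃]
    refine mul_le_mul (pow_le_pow_of_le_one (norm_nonneg _) hq.le (by gcongr; omega)) (H3 n)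
      (norm_nonneg _) (by positivity)
  have hK : ∀ n : ℕ, K₂Term w q (n + 1) =
      c n * ∑' r : ℤ, pfCoeff (q ^ 2) (n + 1 : ℕ) n r * (1 - w * q * (q ^ 2) ^ r)⁻¹ := fun n => by
    rw [← inv_qPoch_mul_qPoch_eq_tsum hQ0 hQ hwq0 hw, K₂Term, div_eq_mul_inv,
      Nat.add_sub_cancel, show q ^ 2 / (w * q) = q / w by field_simp]
  obtain ⟨h1, h2⟩ := tsum_mul_tsum_comm hcs
    (fun n r => norm_pfCoeff_le' hQ H1 (n + 1 : ℕ) n r)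
    (fun n r hr => pfCoeff_eq_zero _ (by rw [Finset.mem_Icc] at hr; push_cast; omega)) H2
  simp_rw [← hK] at h1 h2
  refine ⟨h1, ?_⟩
  rw [K₂, h2, ← tsum_mul_left]
  refine tsum_congr fun r => ?_
  rw [← mul_assoc, ← mul_assoc]
  congr 1
  have e : ∀ n : ℕ, c n * pfCoeff (q ^ 2) (n + 1 : ℕ) n r = (-1) ^ r * q ^ (r * (r + 1)) *
      ((-1) ^ (n + 1) * q ^ ((n + 1) ^ 2) * qPoch q (q ^ 2) n *
        (qFactInv (q ^ 2) (n - r) * qFactInv (q ^ 2) (n + 1 + r))) := fun n => by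
    rw [pfCoeff, sq_zpow_choose]
    simp only [hc]
    push_cast
    ring
  simp_rw [e]
  rw [tsum_mul_left]
  have hcast : ∀ s : ℕ, q * (q ^ 2) ^ (s : ℤ) = q ^ (2 * s + 1) := fun s => by
    rw [zpow_natCast, ← pow_mul]; ring
  rcases lt_or_ge r 0 with hr | hr
  · obtain ⟨s, rfl⟩ : ∃ s : ℕ, r = -(s + 1) := ⟨(-r - 1).toNat, by omega⟩
    have h4 := tsum_qPoch_mul_qFactInv' hq s
    have e2 : ∀ n : ℕ, (-1) ^ (n + 1) * q ^ ((n + 1) ^ 2) * qPoch q (q ^ 2) n *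
        (qFactInv (q ^ 2) (n - -(s + 1)) * qFactInv (q ^ 2) (n + 1 + -(s + 1))) =
        (-1) ^ (n + 1) * q ^ ((n + 1) ^ 2) * qPoch q (q ^ 2) n *
        (qFactInv (q ^ 2) (n - s) * qFactInv (q ^ 2) (n + 1 + s)) := fun n => by
      rw [mul_comm (qFactInv _ _)]
      congr 3 <;> ring
    simp_rw [e2]
    rw [h4, ← hcast]
    have h5 := odd_zpow_ne_one hq0 hq s
    have h6 : 1 - q * (q ^ 2) ^ (s : ℤ) ≠ 0 := sub_ne_zero.2 h5.symm
    have h7 : q * (q ^ 2) ^ (-((s : ℤ) + 1)) = (q * (q ^ 2) ^ (s : ℤ))⁻¹ := by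
      rw [neg_add, zpow_add₀ hQ0, zpow_neg, zpow_neg_one]
      field_simp
    have h8 : q * (q ^ 2) ^ (s : ℤ) ≠ 0 := mul_ne_zero hq0 (zpow_ne_zero _ hQ0)
    have h9 : (-1 : ℂ) ^ (-((s : ℤ) + 1)) * (-1) ^ (s + 1) = 1 := by
      rw [zpow_neg, ← zpow_natCast (-1 : ℂ) (s + 1)]
      push_cast
      exact inv_mul_cancel₀ (zpow_ne_zero _ (by norm_num))
    have h10 : q ^ (-((s : ℤ) + 1) * (-(s + 1) + 1)) * q ^ ((s + 1) ^ 2) =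
        q ^ (2 * (-((s : ℤ) + 1)) ^ 2 + 3 * (-((s : ℤ) + 1)) + 1) * (q * (q ^ 2) ^ (s : ℤ)) := by
      rw [hcast, ← zpow_natCast q, ← zpow_natCast q, ← zpow_add₀ hq0, ← zpow_add₀ hq0]
      congr 1
      push_cast
      ring
    have h11 : (1 - (q * (q ^ 2) ^ (s : ℤ))⁻¹)⁻¹ =
        -(q * (q ^ 2) ^ (s : ℤ)) / (1 - q * (q ^ 2) ^ (s : ℤ)) := by
      have : (1 - (q * (q ^ 2) ^ (s : ℤ))⁻¹) =
        (1 - q * (q ^ 2) ^ (s : ℤ)) / -(q * (q ^ 2) ^ (s : ℤ)) := by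
        generalize q * (q ^ 2) ^ (s : ℤ) = x at *
        field_simp
        ring
      rw [this, inv_div]
    rw [h7, h11]
    generalize 1 - q * (q ^ 2) ^ (s : ℤ) = d at *
    generalize q * (q ^ 2) ^ (s : ℤ) = x at *
    calc _ = ((-1 : ℂ) ^ (-((s : ℤ) + 1)) * (-1) ^ (s + 1)) *
          (q ^ (-((s : ℤ) + 1) * (-(s + 1) + 1)) * q ^ ((s + 1) ^ 2)) * (kappa q / d) := by ring
      _ = _ := by
        rw [h9, h10]
        ring
  · obtain ⟨s, rfl⟩ := Int.eq_ofNat_of_zero_le hr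
    have h9 : (-1 : ℂ) ^ s * (-1) ^ (s + 1) = -1 := by
      rw [pow_succ, ← mul_assoc, ← mul_pow]
      simp
    have h10 : q ^ ((s : ℤ) * (s + 1)) * q ^ ((s + 1) ^ 2) =
        q ^ (2 * (s : ℤ) ^ 2 + 3 * s + 1) := by
      rw [← zpow_natCast q, ← zpow_add₀ hq0]
      congr 1
      push_cast
      ring
    rw [tsum_qPoch_mul_qFactInv' hq s, hcast, ← h10, zpow_natCast]
    linear_combination (q ^ ((s : ℤ) * (s + 1)) * q ^ ((s + 1) ^ 2) *
      (kappa q / (1 - q ^ (2 * s + 1)))) * h9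

lemma tsum_zpow_mul_inv_one_sub_odd {q : ℂ} (hq0 : q ≠ 0) (hq : ‖q‖ < 1) :
    ∑' r : ℤ, q ^ (2 * r ^ 2 + 3 * r + 1) * (1 - q * (q ^ 2) ^ r)⁻¹ = 0 := by
  have hQ0 : q ^ 2 ≠ 0 := pow_ne_zero 2 hq0
  set f : ℤ → ℂ := fun r => q ^ (2 * r ^ 2 + 3 * r + 1) * (1 - q * (q ^ 2) ^ r)⁻¹ with hf
  have h : ∀ r, f (Equiv.subLeft (-1) r) = -f r := fun r => by
    have h8 : q * (q ^ 2) ^ r ≠ 0 := mul_ne_zero hq0 (zpow_ne_zero _ hQ0)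
    have h7 : q * (q ^ 2) ^ (-1 - r) = (q * (q ^ 2) ^ r)⁻¹ := by
      rw [zpow_sub₀ hQ0, zpow_neg_one]
      field_simp
    have h6 : 1 - q * (q ^ 2) ^ r ≠ 0 := sub_ne_zero.2 (odd_zpow_ne_one hq0 hq r).symm
    have h10 : q ^ (2 * r ^ 2 + 3 * r + 1) =
        q ^ (2 * (-1 - r) ^ 2 + 3 * (-1 - r) + 1) * (q * (q ^ 2) ^ r) := by
      rw [← zpow_natCast q 2, ← zpow_mul, ← zpow_one_add₀ hq0, ← zpow_add₀ hq0]
      congr 1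
      push_cast
      ring
    have h11 : (1 - (q * (q ^ 2) ^ r)⁻¹)⁻¹ = -(q * (q ^ 2) ^ r) / (1 - q * (q ^ 2) ^ r) := by
      have : (1 - (q * (q ^ 2) ^ r)⁻¹) = (1 - q * (q ^ 2) ^ r) / -(q * (q ^ 2) ^ r) := by
        generalize q * (q ^ 2) ^ r = x at *
        field_simp
        ring
      rw [this, inv_div]
    simp only [hf, Equiv.subLeft_apply]
    rw [h7, h11, h10]
    ring
  have h2 := (Equiv.subLeft (-1 : ℤ)).tsum_eq f
  simp_rw [h, tsum_neg] at h2
  exact self_eq_neg.1 h2.symm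

/-- The second summand of `F` in terms of an Appell function of level `2`. -/
theorem one_sub_mul_K₂ {q w : ℂ} (hq0 : q ≠ 0) (hq : ‖q‖ < 1) (hw0 : w ≠ 0)
    (hw : ∀ r : ℤ, w * q * (q ^ 2) ^ r ≠ 1) :
    (1 - w) * K₂ w q = kappa q * (w * ∑' r : ℤ, q ^ (2 * r ^ 2 + 3 * r + 1) *
      (1 - w * q * (q ^ 2) ^ r)⁻¹) := by
  rw [(summable_K₂Term_and_K₂_eq hq0 hq hw0 hw).2]
  have s1 := summable_zpow_mul_inv_one_sub hq0 hq (mul_ne_zero hw0 hq0) 3 1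
  have s2 := summable_zpow_mul_inv_one_sub hq0 hq hq0 3 1
  have h0 := tsum_zpow_mul_inv_one_sub_odd hq0 hq
  have h1 : ∀ r : ℤ, (1 - w) * (q ^ (2 * r ^ 2 + 3 * r + 1) * (1 - q * (q ^ 2) ^ r)⁻¹ *
        (1 - w * q * (q ^ 2) ^ r)⁻¹) =
      q ^ (2 * r ^ 2 + 3 * r + 1) * (1 - q * (q ^ 2) ^ r)⁻¹ -
      w * (q ^ (2 * r ^ 2 + 3 * r + 1) * (1 - w * q * (q ^ 2) ^ r)⁻¹) := fun r => by
    have h2 : 1 - q * (q ^ 2) ^ r ≠ 0 := sub_ne_zero.2 (odd_zpow_ne_one hq0 hq r).symm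
    have h3 : 1 - w * q * (q ^ 2) ^ r ≠ 0 := sub_ne_zero.2 (hw r).symm
    have h4 : 1 - w * q * (q ^ 2) ^ r = 1 - w * (1 - (1 - q * (q ^ 2) ^ r)) := by ring
    generalize 1 - q * (q ^ 2) ^ r = d at *
    generalize 1 - w * q * (q ^ 2) ^ r = e at *
    field_simp
    rw [h4]
    ring
  rw [mul_left_comm, ← tsum_mul_left]
  simp_rw [h1]
  rw [s2.tsum_sub (s1.mul_left w), h0, tsum_mul_left]
  ring

lemma qpow_add (τ x y : ℂ) : qpow τ (x + y) = qpow τ x * qpow τ y := by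
  simp only [qpow, ← Complex.exp_add]
  ring_nf

lemma qpow_ne_zero (τ x : ℂ) : qpow τ x ≠ 0 := Complex.exp_ne_zero _

lemma wpow_eq_qpow (α x : ℂ) : wpow α x = qpow α x := rfl

lemma wpow_ne_zero (α x : ℂ) : wpow α x ≠ 0 := Complex.exp_ne_zero _

lemma qpow_intCast (τ : ℂ) (n : ℤ) : qpow τ n = qpow τ 1 ^ n := by
  rw [qpow, qpow, ← Complex.exp_int_mul]
  ring_nf

lemma qpow_natCast (τ : ℂ) (n : ℕ) : qpow τ n = qpow τ 1 ^ n := by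
  simpa using qpow_intCast τ n

lemma qpow_mul_intCast (τ x : ℂ) (n : ℤ) : qpow τ (x * n) = qpow τ x ^ n := by
  rw [qpow, qpow, ← Complex.exp_int_mul]
  ring_nf

lemma qpow_two_mul (τ x : ℂ) : qpow (2 * τ) x = qpow τ (2 * x) := by
  rw [qpow, qpow]
  ring_nf

lemma norm_qpow_one_lt_one (τ : ℍ) : ‖qpow τ 1‖ < 1 := by
  have := norm_exp_two_pi_I_lt_one τ
  simpa [qpow] using this

lemma qPochInf_self_eq_mul {q : ℂ} (hq : ‖q‖ < 1) :
    qPochInf q q = qPochInf q (q ^ 2) * qPochInf (q ^ 2) (q ^ 2) := by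
  have hQ := norm_sq_lt_one hq
  have e : ∀ n : ℕ, qPoch q q (2 * n) = qPoch q (q ^ 2) n * qPoch (q ^ 2) (q ^ 2) n := fun n => by
    induction n with
    | zero => simp
    | succ n ih =>
      rw [mul_add_one, qPoch_succ, qPoch_succ, ih, qPoch_succ, qPoch_succ, ← pow_mul]
      ring
  have h1 := (tendsto_qPoch q hq).comp (tendsto_id.const_mul_atTop' (r := 2) two_pos)
  refine tendsto_nhds_unique h1 (((tendsto_qPoch q hQ).mul (tendsto_qPoch (q ^ 2) hQ)).congr ?_)
  intro n
  simp [e]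

lemma eta_eq (τ : ℂ) :
    ModularForm.eta τ = qpow τ (1 / 24) * qPochInf (qpow τ 1) (qpow τ 1) := by
  rw [ModularForm.eta, qPochInf]
  congr 1
  · rw [Function.Periodic.qParam, qpow]
    congr 1
    push_cast
    ring
  · refine tprod_congr fun n => ?_
    rw [ModularForm.eta_q_eq_pow, pow_succ', qpow]
    simp

lemma eta_div_eta_two_mul_sq (τ : ℍ) :
    ModularForm.eta τ / ModularForm.eta (2 * τ) ^ 2 = qpow τ (-1 / 8) * kappa (qpow τ 1) := by
  have hq := norm_qpow_one_lt_one τ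
  have hQ := norm_sq_lt_one hq
  have h1 := qPochInf_ne_zero hQ (mul_pow_ne_one_of_norm_lt_one hQ hQ)
  have h2 : qpow (2 * τ) 1 = qpow τ 1 ^ 2 := by rw [qpow_two_mul, ← qpow_natCast]; norm_num
  have h3 : qpow τ (1 / 24) = qpow (2 * τ) (1 / 24) ^ 2 * qpow τ (-1 / 8) := by
    rw [qpow_two_mul, sq, ← qpow_add, ← qpow_add]
    norm_num
  have h4 := qpow_ne_zero (2 * τ) (1 / 24)
  rw [eta_eq, eta_eq, h2, qPochInf_self_eq_mul hq, h3, kappa]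
  field_simp

lemma wpow_mul_qpow_zpow_ne_one {τ : ℍ} {α : ℂ} (h : ∀ m n : ℤ, α ≠ m * (τ : ℂ) + n) (r : ℤ) :
    wpow α 1 * qpow τ 1 ^ r ≠ 1 := by
  rw [← qpow_intCast, wpow, qpow, ← Complex.exp_add, Ne, Complex.exp_eq_one_iff]
  rintro ⟨n, hn⟩
  refine h (-r) n ?_
  have h2 : (2 * Real.pi * I : ℂ) ≠ 0 := Complex.two_pi_I_ne_zero
  apply mul_left_cancel₀ h2
  push_cast
  linear_combination hn

lemma theta_eq (α : ℂ) (τ : ℍ) : theta α τ = qpow τ (1 / 8) * wpow α (-1 / 2) *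
    (qPochInf (qpow τ 1) (qpow τ 1) * (qPochInf (wpow α 1) (qpow τ 1) *
      qPochInf (qpow τ 1 / wpow α 1) (qpow τ 1))) := by
  have hq0 := qpow_ne_zero τ 1
  have hw0 := wpow_ne_zero α 1
  rw [jacobi_triple_product hq0 (norm_qpow_one_lt_one τ) hw0, theta,
    ← (Equiv.addRight (1 : ℤ)).tsum_eq
      (fun r : ℤ => (-1) ^ r * qpow τ 1 ^ (r * (r - 1) / 2) * wpow α 1 ^ r),
    ← tsum_neg, ← tsum_mul_left]
  refine tsum_congr fun n => ?_
  have e1 : (n + 1) * (n + 1 - 1) / 2 = n * (n + 1) / 2 := by congr 1; ring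
  have e2 : qpow τ ((n : ℂ) * (n + 1) / 2 + 1 / 8) =
      qpow τ (1 / 8) * qpow τ 1 ^ (n * (n + 1) / 2) := by
    rw [← qpow_intCast, ← qpow_add]
    congr 1
    have : ((2 * (n * (n + 1) / 2) : ℤ) : ℂ) = (n * (n + 1) : ℤ) := by rw [two_mul_int_choose]
    push_cast at this
    linear_combination -this / 2
  have e3 : cexp (Real.pi * I * (2 * n + 1) * α) = wpow α (-1 / 2) * wpow α 1 ^ (n + 1) := by
    rw [wpow_eq_qpow, wpow_eq_qpow, ← qpow_intCast, ← qpow_add, qpow]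
    congr 1
    push_cast
    ring
  simp only [Equiv.coe_addRight]
  rw [e1, e2, e3, zpow_add_one₀ (by norm_num : (-1 : ℂ) ≠ 0)]
  ring

lemma qPochInf_mul_qPochInf_ne_zero {q w : ℂ} (hq0 : q ≠ 0) (hq : ‖q‖ < 1) (hw0 : w ≠ 0)
    (hw : ∀ r : ℤ, w * q ^ r ≠ 1) : qPochInf w q ≠ 0 ∧ qPochInf (q / w) q ≠ 0 := by
  refine ⟨qPochInf_ne_zero hq fun j => by simpa using hw j,
    qPochInf_ne_zero hq fun j h => hw (-(j + 1)) ?_⟩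
  rw [zpow_neg, ← div_eq_mul_inv, div_eq_one_iff_eq (zpow_ne_zero _ hq0)]
  rw [div_mul_eq_mul_div, div_eq_one_iff_eq hw0] at h
  rw [← h]
  norm_cast
  rw [pow_succ']

lemma theta_ne_zero {τ : ℍ} {α : ℂ} (h : ∀ m n : ℤ, α ≠ m * (τ : ℂ) + n) : theta α τ ≠ 0 := by
  have hq := norm_qpow_one_lt_one τ
  obtain ⟨h1, h2⟩ := qPochInf_mul_qPochInf_ne_zero (qpow_ne_zero τ 1) hq (wpow_ne_zero α 1)
    (wpow_mul_qpow_zpow_ne_one h)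
  rw [theta_eq]
  exact mul_ne_zero (mul_ne_zero (qpow_ne_zero _ _) (wpow_ne_zero _ _))
    (mul_ne_zero (qPochInf_ne_zero hq (mul_pow_ne_one_of_norm_lt_one hq hq)) (mul_ne_zero h1 h2))

lemma mul_sq_zpow_ne_one {q w : ℂ} (h : ∀ r : ℤ, w * q ^ r ≠ 1) (r : ℤ) : w * (q ^ 2) ^ r ≠ 1 := by
  have := h (2 * r)
  rwa [zpow_mul] at this

lemma mul_mul_sq_zpow_ne_one {q w : ℂ} (hq0 : q ≠ 0) (h : ∀ r : ℤ, w * q ^ r ≠ 1) (r : ℤ) :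
    w * q * (q ^ 2) ^ r ≠ 1 := by
  have := h (1 + 2 * r)
  rwa [zpow_add₀ hq0, zpow_mul, zpow_one, ← mul_assoc] at this

lemma appell₂_neg (α : ℂ) (τ : ℍ) : appell₂ α (-τ) (2 * τ) = wpow α 1 *
    ∑' r : ℤ, qpow τ 1 ^ (2 * r ^ 2 + r) * (1 - wpow α 1 * (qpow τ 1 ^ 2) ^ r)⁻¹ := by
  rw [appell₂]
  congr 1
  refine tsum_congr fun r => ?_
  have e1 : qpow (2 * τ) r = (qpow τ 1 ^ 2) ^ r := by
    rw [← zpow_natCast, ← zpow_mul, ← qpow_intCast, qpow_two_mul]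
    push_cast
    rfl
  have e2 : qpow (2 * τ) ((r : ℂ) * (r + 1)) * wpow (-τ) r = qpow τ 1 ^ (2 * r ^ 2 + r) := by
    have : wpow (-τ) r = qpow τ (-r) := by rw [wpow, qpow]; ring_nf
    rw [← qpow_intCast, qpow_two_mul, this, ← qpow_add]
    push_cast
    ring_nf
  rw [e1, e2, div_eq_mul_inv]

lemma appell₂_add (α : ℂ) (τ : ℍ) : appell₂ (α + τ) τ (2 * τ) = wpow α 1 *
    ∑' r : ℤ, qpow τ 1 ^ (2 * r ^ 2 + 3 * r + 1) *
      (1 - wpow α 1 * qpow τ 1 * (qpow τ 1 ^ 2) ^ r)⁻¹ := by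
  have e0 : wpow (α + τ) 1 = wpow α 1 * qpow τ 1 := by
    rw [wpow, wpow, qpow, ← Complex.exp_add]
    ring_nf
  rw [appell₂, e0, mul_assoc, ← tsum_mul_left]
  congr 1
  refine tsum_congr fun r => ?_
  have e1 : qpow (2 * τ) r = (qpow τ 1 ^ 2) ^ r := by
    rw [← zpow_natCast, ← zpow_mul, ← qpow_intCast, qpow_two_mul]
    push_cast
    rfl
  have e2 : qpow (2 * τ) ((r : ℂ) * (r + 1)) * wpow τ r = qpow τ 1 ^ (2 * r ^ 2 + 3 * r) := by
    rw [← qpow_intCast, qpow_two_mul, wpow_eq_qpow, ← qpow_add]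
    push_cast
    ring_nf
  rw [e1, e2, div_eq_mul_inv, zpow_add_one₀ (qpow_ne_zero _ _)]
  ring

lemma one_sub_wpow_ne_zero {τ : ℍ} {α : ℂ} (h : ∀ m n : ℤ, α ≠ m * (τ : ℂ) + n) :
    1 - wpow α 1 ≠ 0 :=
  sub_ne_zero.2 (by simpa using (wpow_mul_qpow_zpow_ne_one h 0).symm)

lemma wpow_one_eq (α : ℂ) : wpow α 1 = wpow α (1 / 2) * wpow α (1 / 2) := by
  rw [wpow_eq_qpow, wpow_eq_qpow, ← qpow_add]
  norm_num

lemma wpow_neg_half (α : ℂ) : wpow α (-1 / 2) = (wpow α (1 / 2))⁻¹ := by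
  refine eq_inv_of_mul_eq_one_left ?_
  rw [wpow_eq_qpow, wpow_eq_qpow, ← qpow_add]
  norm_num [qpow]

theorem summand₁_eq {τ : ℍ} {α : ℂ} (h : ∀ m n : ℤ, α ≠ m * (τ : ℂ) + n) :
    summand₁ α τ = wpow α (-1 / 2) * (ModularForm.eta τ / ModularForm.eta (2 * τ) ^ 2) *
      appell₂ α (-τ) (2 * τ) := by
  have h1 := wpow_mul_qpow_zpow_ne_one h
  have hw := one_sub_wpow_ne_zero h
  rw [summand₁, (summable_K₁Term_and_K₁_eq (qpow_ne_zero τ 1) (norm_qpow_one_lt_one τ)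
    (wpow_ne_zero α 1) (mul_sq_zpow_ne_one h1)).2, appell₂_neg, eta_div_eta_two_mul_sq]
  have h2 := wpow_ne_zero α (1 / 2)
  have h3 : wpow α (-1 / 2) - wpow α (1 / 2) = wpow α (-1 / 2) * (1 - wpow α 1) := by
    rw [wpow_one_eq, wpow_neg_half]
    field_simp
  have h4 := wpow_ne_zero α (-1 / 2)
  have h5 : wpow α (-1 / 2) * wpow α 1 = (wpow α (-1 / 2))⁻¹ := by
    rw [wpow_one_eq, wpow_neg_half]
    field_simp
  rw [h3]
  generalize (∑' r : ℤ, qpow τ 1 ^ (2 * r ^ 2 + r) * (1 - wpow α 1 * (qpow τ 1 ^ 2) ^ r)⁻¹) = S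
  rw [show ∀ a b c : ℂ, wpow α (-1 / 2) * (a * b) * (wpow α 1 * c) =
    (wpow α (-1 / 2) * wpow α 1) * (a * b * c) by intros; ring, h5]
  generalize 1 - wpow α 1 = d at *
  field_simp

theorem summand₂_eq {τ : ℍ} {α : ℂ} (h : ∀ m n : ℤ, α ≠ m * (τ : ℂ) + n) :
    summand₂ α τ = -(wpow α (-1 / 2) * (ModularForm.eta τ / ModularForm.eta (2 * τ) ^ 2) *
      appell₂ (α + τ) τ (2 * τ)) := by
  have h1 := wpow_mul_qpow_zpow_ne_one h
  have h2 := wpow_ne_zero α (1 / 2)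
  have h3 : wpow α (1 / 2) - wpow α (-1 / 2) = -wpow α (-1 / 2) * (1 - wpow α 1) := by
    rw [wpow_one_eq, wpow_neg_half]
    field_simp
    ring
  rw [appell₂_add, eta_div_eta_two_mul_sq, summand₂, h3]
  have := one_sub_mul_K₂ (qpow_ne_zero τ 1) (norm_qpow_one_lt_one τ)
    (wpow_ne_zero α 1) (mul_mul_sq_zpow_ne_one (qpow_ne_zero τ 1) h1)
  linear_combination (-qpow τ (-1 / 8) * wpow α (-1 / 2)) * this

lemma hasSum_int_even_add_odd {f : ℤ → ℂ} {a b : ℂ} (ha : HasSum (fun k => f (2 * k)) a)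
    (hb : HasSum (fun k => f (2 * k + 1)) b) : HasSum f (a + b) := by
  have := mul_right_injective₀ (two_ne_zero' ℤ)
  replace ha := this.hasSum_range_iff.2 ha
  replace hb := ((add_left_injective 1).comp this).hasSum_range_iff.2 hb
  refine ha.add_isCompl ?_ hb
  simpa [Function.comp_def, Set.range, Even, Odd, eq_comm, ← two_mul] using Int.isCompl_even_odd

lemma tsum_sub_tsum_eq {q w : ℂ} (hq0 : q ≠ 0) (hq : ‖q‖ < 1) (hw0 : w ≠ 0) :
    ∑' r : ℤ, q ^ (2 * r ^ 2 + r) * (1 - w * (q ^ 2) ^ r)⁻¹ -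
      ∑' r : ℤ, q ^ (2 * r ^ 2 + 3 * r + 1) * (1 - w * q * (q ^ 2) ^ r)⁻¹ =
      ∑' r : ℤ, (-1) ^ r * q ^ (r * (r + 1) / 2) * (1 - w * q ^ r)⁻¹ := by
  set f : ℤ → ℂ := fun r => (-1) ^ r * q ^ (r * (r + 1) / 2) * (1 - w * q ^ r)⁻¹ with hf
  have h1 : ∀ r : ℤ, f (2 * r) = q ^ (2 * r ^ 2 + r) * (1 - w * (q ^ 2) ^ r)⁻¹ := fun r => by
    have : 2 * r * (2 * r + 1) / 2 = 2 * r ^ 2 + r := by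
      have := two_mul_int_choose (2 * r)
      linarith
    simp only [hf]
    rw [this, zpow_mul, zpow_mul]
    norm_cast
    simp
  have h2 : ∀ r : ℤ, f (2 * r + 1) =
      -(q ^ (2 * r ^ 2 + 3 * r + 1) * (1 - w * q * (q ^ 2) ^ r)⁻¹) := fun r => by
    have : (2 * r + 1) * (2 * r + 1 + 1) / 2 = 2 * r ^ 2 + 3 * r + 1 := by
      have := two_mul_int_choose (2 * r + 1)
      linarith
    simp only [hf]
    have e : q ^ (2 * r + 1) = q * (q ^ 2) ^ r := by
      rw [zpow_add_one₀ hq0, zpow_mul, mul_comm]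
      norm_cast
    rw [this, e, zpow_add_one₀ (by norm_num), zpow_mul, mul_assoc w]
    norm_num
  have s1 := summable_zpow_mul_inv_one_sub hq0 hq hw0 1 0
  have s2 := summable_zpow_mul_inv_one_sub hq0 hq (mul_ne_zero hw0 hq0) 3 1
  simp only [add_zero, one_mul] at s1
  have s1' := s1.hasSum
  have s2' := s2.hasSum.neg
  simp_rw [← h1] at s1'
  simp_rw [← h2] at s2'
  rw [(hasSum_int_even_add_odd s1' s2').tsum_eq, sub_eq_add_neg]
  simp_rw [h1]

theorem summand₁_add_summand₂_eq {τ : ℍ} {α : ℂ} (h : ∀ m n : ℤ, α ≠ m * (τ : ℂ) + n) :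
    summand₁ α τ + summand₂ α τ =
      ModularForm.eta τ ^ 4 / (ModularForm.eta (2 * τ) ^ 2 * theta α τ) := by
  have hq := norm_qpow_one_lt_one τ
  have hq0 := qpow_ne_zero τ 1
  have hw0 := wpow_ne_zero α 1
  have h1 := wpow_mul_qpow_zpow_ne_one h
  have hqq := qPochInf_ne_zero hq (mul_pow_ne_one_of_norm_lt_one hq hq)
  obtain ⟨h2, h3⟩ := qPochInf_mul_qPochInf_ne_zero hq0 hq hw0 h1
  have h4 : ModularForm.eta (τ : ℂ) ^ 3 = qpow τ (1 / 8) * qPochInf (qpow τ 1) (qpow τ 1) ^ 3 := by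
    rw [eta_eq, mul_pow]
    congr 1
    rw [← zpow_natCast, ← qpow_mul_intCast]
    norm_num
  have h5 : ModularForm.eta (τ : ℂ) ^ 4 / (ModularForm.eta (2 * τ) ^ 2 * theta α τ) =
      ModularForm.eta τ / ModularForm.eta (2 * τ) ^ 2 * (ModularForm.eta τ ^ 3 / theta α τ) := by
    rw [pow_succ' _ 3, mul_div_mul_comm]
  have h6 := wpow_ne_zero α (1 / 2)
  have h7 := qpow_ne_zero τ (1 / 8)
  rw [h5, summand₁_eq h, summand₂_eq h, appell₂_neg, appell₂_add, h4, theta_eq]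
  have h8 := tsum_sub_tsum_eq hq0 hq hw0
  rw [tsum_div_one_sub hq0 hq hw0 h1] at h8
  rw [← sub_eq_add_neg, ← mul_sub, ← mul_sub, h8, wpow_one_eq α, wpow_neg_half]
  rw [wpow_one_eq α] at h2 h3
  field_simp

lemma det_eq_one (γ : SL(2, ℤ)) : γ 0 0 * γ 1 1 - γ 0 1 * γ 1 0 = 1 := by
  rw [← Matrix.det_fin_two]
  exact γ.det_coe

lemma det_cast_eq_one (γ : SL(2, ℤ)) :
    (γ 0 0 : ℂ) * (γ 1 1 : ℂ) - (γ 0 1 : ℂ) * (γ 1 0 : ℂ) = 1 := by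
  exact_mod_cast det_eq_one γ

lemma autFactor_eq_denom (γ : SL(2, ℤ)) (τ : ℍ) : autFactor γ τ = denom γ τ := by
  rw [ModularGroup.denom_apply]
  rfl

lemma autFactor_ne_zero (γ : SL(2, ℤ)) (τ : ℍ) : autFactor γ τ ≠ 0 := by
  rw [autFactor_eq_denom]
  exact denom_ne_zero _ _

lemma coe_smul_eq_div (γ : SL(2, ℤ)) (τ : ℍ) :
    ((γ • τ : ℍ) : ℂ) = ((γ 0 0 : ℂ) * τ + (γ 0 1 : ℂ)) / autFactor γ τ := by
  rw [coe_specialLinearGroup_apply, autFactor]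
  simp

lemma coe_smul_mul_autFactor (γ : SL(2, ℤ)) (τ : ℍ) :
    ((γ • τ : ℍ) : ℂ) * autFactor γ τ = (γ 0 0 : ℂ) * τ + (γ 0 1 : ℂ) := by
  rw [coe_smul_eq_div, div_mul_cancel₀ _ (autFactor_ne_zero γ τ)]

lemma mul_apply_one_zero (γ δ : SL(2, ℤ)) :
    (γ * δ) 1 0 = γ 1 0 * δ 0 0 + γ 1 1 * δ 1 0 := by
  simp [Matrix.SpecialLinearGroup.coe_mul, Matrix.mul_apply, Fin.sum_univ_two]

lemma mul_apply_one_one (γ δ : SL(2, ℤ)) :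
    (γ * δ) 1 1 = γ 1 0 * δ 0 1 + γ 1 1 * δ 1 1 := by
  simp [Matrix.SpecialLinearGroup.coe_mul, Matrix.mul_apply, Fin.sum_univ_two]

lemma autFactor_mul (γ δ : SL(2, ℤ)) (τ : ℍ) :
    autFactor (γ * δ) τ = autFactor γ (δ • τ) * autFactor δ τ := by
  have h := coe_smul_mul_autFactor δ τ
  rw [autFactor, autFactor, add_mul, mul_assoc, h, mul_apply_one_zero, mul_apply_one_one, autFactor]
  push_cast
  ring

lemma inv_apply_one_zero (γ : SL(2, ℤ)) : γ⁻¹ 1 0 = -γ 1 0 := by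
  rw [Matrix.SpecialLinearGroup.SL2_inv_expl]
  rfl

lemma autFactor_inv (γ : SL(2, ℤ)) (τ : ℍ) :
    autFactor γ (γ⁻¹ • τ) * autFactor γ⁻¹ τ = 1 := by
  rw [← autFactor_mul]
  simp [autFactor]

lemma theta_add (z τ : ℂ) (l m : ℤ) : theta (z + l * τ + m) τ =
    (-1) ^ (l + m) * cexp (-(Real.pi * I * (l ^ 2 * τ + 2 * l * z))) * theta z τ := by
  rw [theta, theta, mul_neg, ← tsum_mul_left, ← (Equiv.addRight l).tsum_eq (fun n : ℤ =>
    (-1) ^ (l + m) * cexp (-(Real.pi * I * (l ^ 2 * τ + 2 * l * z))) *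
    ((-1 : ℂ) ^ n * cexp (Real.pi * I * (2 * n + 1) * z) *
    qpow τ ((n : ℂ) * (n + 1) / 2 + 1 / 8)))]
  congr 1
  refine tsum_congr fun n => ?_
  have h1 : (-1 : ℂ) ^ m = cexp (Real.pi * I * (2 * n + 1) * m) := by
    rw [← Complex.exp_pi_mul_I, ← Complex.exp_int_mul, Complex.exp_eq_exp_iff_exists_int]
    refine ⟨-n * m, ?_⟩
    push_cast
    ring
  have h2 : ((-1 : ℂ) ^ l) * (-1) ^ l = 1 := neg_one_zpow_mul_self l
  simp only [Equiv.coe_addRight]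
  rw [zpow_add₀ (by norm_num), zpow_add₀ (by norm_num), h1, qpow, qpow]
  have e : cexp (Real.pi * I * (2 * n + 1) * (z + l * τ + m)) *
      cexp (2 * Real.pi * I * ((n : ℂ) * (n + 1) / 2 + 1 / 8) * τ) =
      cexp (-(Real.pi * I * (l ^ 2 * τ + 2 * l * z))) * (cexp (Real.pi * I * (2 * n + 1) * m) *
      cexp (Real.pi * I * (2 * (n + l : ℤ) + 1) * z) *
      cexp (2 * Real.pi * I * ((n + l : ℤ) * ((n + l : ℤ) + 1) / 2 + 1 / 8) * τ)) := by
    simp only [← Complex.exp_add]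
    congr 1
    push_cast
    ring
  rw [mul_assoc, e]
  linear_combination -(cexp (-(Real.pi * I * (l ^ 2 * τ + 2 * l * z))) *
    (cexp (Real.pi * I * (2 * n + 1) * m) *
      cexp (Real.pi * I * (2 * (n + l : ℤ) + 1) * z) *
      cexp (2 * Real.pi * I * ((n + l : ℤ) * ((n + l : ℤ) + 1) / 2 + 1 / 8) * τ))) * (-1) ^ n * h2

lemma theta_eq_jacobiTheta₂ (z τ : ℂ) :
    theta z τ = -cexp (Real.pi * I * (z + τ / 4)) * jacobiTheta₂ (z + τ / 2 + 1 / 2) τ := by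
  rw [theta, jacobiTheta₂, neg_mul, ← tsum_mul_left]
  congr 1
  refine tsum_congr fun n => ?_
  rw [← Complex.exp_pi_mul_I, ← Complex.exp_int_mul, jacobiTheta₂_term, qpow, ← Complex.exp_add,
    ← Complex.exp_add, ← Complex.exp_add]
  congr 1
  ring

lemma theta_add_one (z τ : ℂ) : theta z (τ + 1) = cexp (Real.pi * I / 4) * theta z τ := by
  rw [theta, theta, mul_neg, ← tsum_mul_left]
  congr 1
  refine tsum_congr fun n => ?_
  have : qpow (τ + 1) ((n : ℂ) * (n + 1) / 2 + 1 / 8) =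
      cexp (Real.pi * I / 4) * qpow τ ((n : ℂ) * (n + 1) / 2 + 1 / 8) := by
    rw [qpow, qpow, ← Complex.exp_add, Complex.exp_eq_exp_iff_exists_int]
    refine ⟨n * (n + 1) / 2, ?_⟩
    have h : ((2 * (n * (n + 1) / 2) : ℤ) : ℂ) = (n * (n + 1) : ℤ) := by rw [two_mul_int_choose]
    push_cast at h
    linear_combination (-Real.pi * I) * h
  rw [this]
  ring

lemma neg_I_mul_ne_zero (τ : ℍ) : -I * (τ : ℂ) ≠ 0 :=
  mul_ne_zero (neg_ne_zero.2 I_ne_zero) τ.ne_zero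

lemma theta_div_neg_one_div (z : ℂ) (τ : ℍ) : theta (z / τ) (-1 / τ) =
    -I * (-I * (τ : ℂ)) ^ (1 / 2 : ℂ) * cexp (Real.pi * I * z ^ 2 / τ) * theta z τ := by
  have hτ := τ.ne_zero
  have h1 := jacobiTheta₂_functional_equation (z - 1 / 2 + τ / 2) τ
  have h2 : jacobiTheta₂ (z + τ / 2 + 1 / 2) τ = jacobiTheta₂ (z - 1 / 2 + τ / 2) τ := by
    rw [← jacobiTheta₂_add_left (z - 1 / 2 + τ / 2)]
    ring_nf
  have h3 : (-I * (τ : ℂ)) ^ (1 / 2 : ℂ) ≠ 0 := by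
    rw [Ne, Complex.cpow_eq_zero_iff]
    exact fun h => neg_I_mul_ne_zero τ h.1
  rw [theta_eq_jacobiTheta₂, theta_eq_jacobiTheta₂, h2, h1,
    show z / (τ : ℂ) + -1 / τ / 2 + 1 / 2 = (z - 1 / 2 + τ / 2) / τ by field_simp; ring]
  have h4 : cexp (Real.pi * I * (z / τ + -1 / τ / 4)) = -I * (cexp (Real.pi * I * z ^ 2 / τ) *
      (cexp (Real.pi * I * (z + τ / 4)) *
        cexp (-Real.pi * I * (z - 1 / 2 + τ / 2) ^ 2 / τ))) := by
    have : -I = cexp (-Real.pi / 2 * I) := by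
      rw [Complex.exp_neg_pi_div_two_mul_I]
    rw [this, ← Complex.exp_add, ← Complex.exp_add, ← Complex.exp_add]
    congr 1
    field_simp
    ring
  rw [h4]
  field_simp

lemma eta_neg_one_div_pow_three (τ : ℍ) : ModularForm.eta (-1 / τ) ^ 3 =
    (-I * (τ : ℂ)) * (-I * (τ : ℂ)) ^ (1 / 2 : ℂ) * ModularForm.eta τ ^ 3 := by
  have h := ModularForm.eta_comp_eq_csqrt_I_inv τ.2
  simp only [Function.comp_apply, Pi.smul_apply, Pi.mul_apply, smul_eq_mul] at h
  have h1 : (-I * (τ : ℂ)) ^ (1 / 2 : ℂ) = (Complex.sqrt I)⁻¹ * Complex.sqrt τ := by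
    have hl : Complex.log (-I * τ) = Complex.log (-I) + Complex.log τ := by
      rw [Complex.log_mul_eq_add_log_iff (neg_ne_zero.2 I_ne_zero) τ.ne_zero, Complex.arg_neg_I]
      have h0 : 0 ≤ (τ : ℂ).arg := Complex.arg_nonneg_iff.2 τ.2.le
      have h2 := Complex.arg_le_pi (τ : ℂ)
      have := Real.pi_pos
      constructor <;> linarith
    rw [Complex.cpow_def_of_ne_zero (neg_I_mul_ne_zero τ), hl, Complex.sqrt, Complex.sqrt,
      Complex.cpow_def_of_ne_zero I_ne_zero, Complex.cpow_def_of_ne_zero τ.ne_zero,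
      ← Complex.exp_neg, ← Complex.exp_add, Complex.log_neg_I, Complex.log_I]
    congr 1
    ring
  have h2 : ((-I * (τ : ℂ)) ^ (1 / 2 : ℂ)) ^ 2 = -I * τ := by
    rw [← Complex.cpow_nat_mul]
    norm_num
  rw [h, ← mul_assoc, ← h1, mul_pow]
  linear_combination ((-I * (τ : ℂ)) ^ (1 / 2 : ℂ)) * ModularForm.eta τ ^ 3 * h2

lemma eta_add_one_pow_three (τ : ℂ) :
    ModularForm.eta (τ + 1) ^ 3 = cexp (Real.pi * I / 4) * ModularForm.eta τ ^ 3 := by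
  have h : qpow (τ + 1) 1 = qpow τ 1 := by
    rw [qpow, qpow, Complex.exp_eq_exp_iff_exists_int]
    exact ⟨1, by push_cast; ring⟩
  have h2 : qpow (τ + 1) (1 / 24) ^ 3 = cexp (Real.pi * I / 4) * qpow τ (1 / 24) ^ 3 := by
    rw [qpow, qpow, ← Complex.exp_nat_mul, ← Complex.exp_nat_mul, ← Complex.exp_add]
    congr 1
    push_cast
    ring
  rw [eta_eq, eta_eq, h, mul_pow, mul_pow, ← mul_assoc, h2]

lemma coe_eta_ne_zero (τ : ℍ) : ModularForm.eta τ ≠ 0 := ModularForm.eta_ne_zero τ.2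

/-- The quotient `ϑ(z; τ) / η(τ)³`, which transforms with trivial multiplier under `SL₂(ℤ)`. -/
def thetaQuot (z τ : ℂ) : ℂ := theta z τ / ModularForm.eta τ ^ 3

/-- The quotient `ϑ / η³` transforms like a Jacobi form of weight `-1` and index `1 / 2`. -/
theorem thetaQuot_smul (γ : SL(2, ℤ)) (z : ℂ) (τ : ℍ) :
    thetaQuot (z / autFactor γ τ) ((γ • τ : ℍ) : ℂ) = (autFactor γ τ)⁻¹ *
      cexp (Real.pi * I * ((γ 1 0 : ℂ) * z ^ 2 / autFactor γ τ)) * thetaQuot z τ := by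
  have hγ : γ ∈ Subgroup.closure {ModularGroup.S, ModularGroup.T} := by
    rw [SpecialLinearGroup.SL2Z_generators]
    trivial
  induction hγ using Subgroup.closure_induction generalizing z τ with
  | mem γ h =>
    rcases h with rfl | h
    · have h1 : autFactor ModularGroup.S τ = τ := by simp [autFactor, ModularGroup.S]
      have h2 : ((ModularGroup.S • τ : ℍ) : ℂ) = -1 / τ := by
        rw [modular_S_smul]
        simp [neg_div]
      have h3 : (ModularGroup.S 1 0 : ℂ) = 1 := by simp [ModularGroup.S]
      have h4 : (-I * (τ : ℂ)) ^ (1 / 2 : ℂ) ≠ 0 := by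
        rw [Ne, Complex.cpow_eq_zero_iff]
        exact fun h => neg_I_mul_ne_zero τ h.1
      have h5 := coe_eta_ne_zero τ
      have h6 := τ.ne_zero
      rw [thetaQuot, thetaQuot, h1, h2, h3, theta_div_neg_one_div, eta_neg_one_div_pow_three,
        one_mul, mul_div_assoc]
      have h7 := I_ne_zero
      field_simp
    · rw [Set.mem_singleton_iff] at h
      subst h
      have h1 : autFactor ModularGroup.T τ = 1 := by simp [autFactor, ModularGroup.T]
      have h2 : ((ModularGroup.T • τ : ℍ) : ℂ) = τ + 1 := by
        rw [modular_T_smul]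
        simp [add_comm]
      have h3 : (ModularGroup.T 1 0 : ℂ) = 0 := by simp [ModularGroup.T]
      have h5 := coe_eta_ne_zero τ
      rw [thetaQuot, thetaQuot, h1, h2, h3, div_one, theta_add_one, eta_add_one_pow_three,
        mul_div_mul_left _ _ (Complex.exp_ne_zero _)]
      simp
  | one => simp [autFactor]
  | mul γ δ _ _ hγ hδ =>
    have hJ := autFactor_ne_zero γ (δ • τ)
    have hj := autFactor_ne_zero δ τ
    rw [autFactor_mul, mul_comm (autFactor γ (δ • τ)), ← div_div, mul_smul, hγ, hδ, mul_inv]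
    have e : (γ 1 0 : ℂ) * (z / autFactor δ τ) ^ 2 / autFactor γ (δ • τ) +
        (δ 1 0 : ℂ) * z ^ 2 / autFactor δ τ =
        ((γ * δ) 1 0 : ℂ) * z ^ 2 / (autFactor δ τ * autFactor γ (δ • τ)) := by
      have h1 : (γ 1 0 : ℂ) + (δ 1 0 : ℂ) * (autFactor γ (δ • τ) * autFactor δ τ) =
          ((γ * δ) 1 0 : ℂ) * autFactor δ τ := by
        have h2 := coe_smul_mul_autFactor δ τ
        rw [mul_apply_one_zero]
        push_cast
        have h3 : autFactor γ (δ • τ) * autFactor δ τ = (γ 1 0 : ℂ) *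
          ((δ 0 0 : ℂ) * τ + (δ 0 1 : ℂ)) + (γ 1 1 : ℂ) * autFactor δ τ := by
          rw [← h2, autFactor]
          ring
        rw [h3, autFactor]
        linear_combination (-(γ 1 0 : ℂ)) * det_cast_eq_one δ
      field_simp
      linear_combination z ^ 2 * h1
    rw [← e, mul_add, Complex.exp_add]
    ring
  | inv γ _ hγ =>
    have h1 := autFactor_inv γ τ
    have hJ := autFactor_ne_zero γ (γ⁻¹ • τ)
    have hj := autFactor_ne_zero γ⁻¹ τ
    have h2 := hγ (z / autFactor γ⁻¹ τ) (γ⁻¹ • τ)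
    rw [smul_inv_smul, div_div, mul_comm (autFactor γ⁻¹ τ), h1, div_one] at h2
    have h3 : autFactor γ (γ⁻¹ • τ) = (autFactor γ⁻¹ τ)⁻¹ := eq_inv_of_mul_eq_one_left h1
    rw [h2, h3, inv_inv, inv_apply_one_zero]
    have e : (γ 1 0 : ℂ) * (z / autFactor γ⁻¹ τ) ^ 2 / (autFactor γ⁻¹ τ)⁻¹ =
      -(((-γ 1 0 : ℤ) : ℂ) * z ^ 2 / autFactor γ⁻¹ τ) := by
      push_cast
      field_simp
    rw [e, mul_neg, Complex.exp_neg]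
    field_simp

lemma eta_smul_pow (γ : SL(2, ℤ)) (τ : ℍ) : ModularForm.eta ((γ • τ : ℍ) : ℂ) ^ 24 =
    autFactor γ τ ^ 12 * ModularForm.eta τ ^ 24 := by
  have h := congrFun (SlashInvariantForm.slash_action_generators_SL2Z
    ModularForm.discriminant_S_invariant ModularForm.discriminant_T_invariant γ) τ
  rw [ModularForm.SL_slash_apply, ← autFactor_eq_denom, zpow_neg,
    mul_inv_eq_iff_eq_mul₀ (zpow_ne_zero _ (autFactor_ne_zero γ τ))] at h
  rw [mul_comm]
  exact h

lemma continuous_autFactor (γ : SL(2, ℤ)) : Continuous (autFactor γ) := by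
  unfold autFactor
  fun_prop

lemma continuous_autFactor_cpow (γ : SL(2, ℤ)) (s : ℂ) :
    Continuous fun τ => autFactor γ τ ^ s := by
  by_cases hc : γ 1 0 = 0
  · have : (fun τ => autFactor γ τ ^ s) = fun _ => (γ 1 1 : ℂ) ^ s := by
      ext τ
      simp [autFactor, hc]
    rw [this]
    exact continuous_const
  · refine (continuous_autFactor γ).cpow continuous_const fun τ => ?_
    refine Or.inr ?_
    simp [autFactor, hc, τ.im_ne_zero]

lemma continuous_smul_left (γ : SL(2, ℤ)) : Continuous fun τ : ℍ => γ • τ := by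
  refine isOpenEmbedding_coe.isInducing.continuous_iff.2 ?_
  have : (fun τ : ℍ => ((γ • τ : ℍ) : ℂ)) =
      fun τ : ℍ => ((γ 0 0 : ℂ) * τ + (γ 0 1 : ℂ)) / autFactor γ τ :=
    funext (coe_smul_eq_div γ)
  rw [Function.comp_def, this]
  exact Continuous.div (by fun_prop) (continuous_autFactor γ) (autFactor_ne_zero γ)

lemma continuous_eta : Continuous fun τ : ℍ => ModularForm.eta τ :=
  continuous_iff_continuousAt.2 fun τ =>
    (ModularForm.differentiableAt_eta_of_mem_upperHalfPlaneSet τ.2).continuousAt.comp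
      (f := fun τ : ℍ => (τ : ℂ)) continuous_coe.continuousAt

/-- A continuous function on a connected space all of whose values are `N`-th roots of unity is
constant. -/
lemma eq_of_forall_pow_eq_one {X : Type*} [TopologicalSpace X] [PreconnectedSpace X] {u : X → ℂ}
    (hu : Continuous u) {N : ℕ} (hN : 0 < N) (h : ∀ x, u x ^ N = 1) (x y : X) : u x = u y := by
  have hfin : {ζ : ℂ | ζ ^ N = 1}.Finite := by
    refine (Polynomial.nthRootsFinset N (1 : ℂ)).finite_toSet.subset fun ζ hζ => ?_
    simpa [Polynomial.mem_nthRootsFinset hN] using hζ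
  exact isPreconnected_univ.constant_of_mapsTo hfin.isDiscrete hu.continuousOn
    (fun x _ => h x) (Set.mem_univ x) (Set.mem_univ y)

lemma cpow_half_pow_two (x : ℂ) : (x ^ (1 / 2 : ℂ)) ^ 2 = x := by
  rw [← Complex.cpow_nat_mul]
  norm_num

/-- The Dedekind eta function transforms with a multiplier of order dividing `24`. -/
theorem exists_eta_smul (γ : SL(2, ℤ)) : ∃ ζ : ℂ, ζ ^ 24 = 1 ∧ ∀ τ : ℍ,
    ModularForm.eta ((γ • τ : ℍ) : ℂ) = ζ * autFactor γ τ ^ (1 / 2 : ℂ) * ModularForm.eta τ := by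
  have hj : ∀ τ : ℍ, autFactor γ τ ^ (1 / 2 : ℂ) ≠ 0 := fun τ => by
    rw [Ne, Complex.cpow_eq_zero_iff]
    exact fun h => autFactor_ne_zero γ τ h.1
  set u : ℍ → ℂ := fun τ => ModularForm.eta ((γ • τ : ℍ) : ℂ) /
    (autFactor γ τ ^ (1 / 2 : ℂ) * ModularForm.eta τ) with hu
  have hc : Continuous u := by
    refine Continuous.div (continuous_eta.comp (continuous_smul_left γ))
      ((continuous_autFactor_cpow γ _).mul continuous_eta) fun τ =>
        mul_ne_zero (hj τ) (coe_eta_ne_zero τ)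
  have h24 : ∀ τ, u τ ^ 24 = 1 := fun τ => by
    simp only [hu]
    rw [div_pow, mul_pow, show (24 : ℕ) = 2 * 12 by norm_num, pow_mul (autFactor γ τ ^ _) 2 12,
      cpow_half_pow_two, eta_smul_pow]
    exact div_self (mul_ne_zero (pow_ne_zero _ (autFactor_ne_zero γ τ))
      (pow_ne_zero _ (coe_eta_ne_zero τ)))
  refine ⟨u UpperHalfPlane.I, h24 _, fun τ => ?_⟩
  rw [eq_of_forall_pow_eq_one hc (by norm_num) h24 UpperHalfPlane.I τ]
  simp only [hu]
  rw [mul_assoc, div_mul_cancel₀ _ (mul_ne_zero (hj τ) (coe_eta_ne_zero τ))]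

/-- The values of `ϑ / η³` at the torsion point `aτ + b`, normalised by `q^{a²/2}`. -/
def thetaTorsion (a b : ℚ) (τ : ℍ) : ℂ :=
  qpow τ ((a : ℂ) ^ 2 / 2) * thetaQuot ((a : ℂ) * τ + b) τ

lemma thetaTorsion_smul (γ : SL(2, ℤ)) (a b : ℚ) (τ : ℍ) :
    thetaTorsion a b (γ • τ) = (autFactor γ τ)⁻¹ *
      cexp (Real.pi * I * (((a * γ 0 0 + b * γ 1 0) * (a * γ 0 1 + b * γ 1 1) - a * b : ℚ) : ℂ)) *
      thetaTorsion (a * γ 0 0 + b * γ 1 0) (a * γ 0 1 + b * γ 1 1) τ := by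
  have hj := autFactor_ne_zero γ τ
  have h1 := coe_smul_mul_autFactor γ τ
  set z : ℂ := ((a * γ 0 0 + b * γ 1 0 : ℚ) : ℂ) * τ + ((a * γ 0 1 + b * γ 1 1 : ℚ) : ℂ) with hz
  have h2 : (a : ℂ) * ((γ • τ : ℍ) : ℂ) + b = z / autFactor γ τ := by
    rw [eq_div_iff hj, add_mul, mul_assoc, h1, hz, autFactor]
    push_cast
    ring
  rw [thetaTorsion, thetaTorsion, h2, thetaQuot_smul, qpow, qpow, ← hz]
  have e : cexp (2 * Real.pi * I * ((a : ℂ) ^ 2 / 2) * ((γ • τ : ℍ) : ℂ)) *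
      cexp (Real.pi * I * ((γ 1 0 : ℂ) * z ^ 2 / autFactor γ τ)) =
      cexp (Real.pi * I * (((a * γ 0 0 + b * γ 1 0) * (a * γ 0 1 + b * γ 1 1) - a * b : ℚ) : ℂ)) *
      cexp (2 * Real.pi * I * (((a * γ 0 0 + b * γ 1 0 : ℚ) : ℂ) ^ 2 / 2) * τ) := by
    rw [← Complex.exp_add, ← Complex.exp_add]
    congr 1
    have h3 : (a : ℂ) ^ 2 * ((γ • τ : ℍ) : ℂ) + (γ 1 0 : ℂ) * z ^ 2 / autFactor γ τ =
        (((a * γ 0 0 + b * γ 1 0) * (a * γ 0 1 + b * γ 1 1) - a * b : ℚ) : ℂ) +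
        ((a * γ 0 0 + b * γ 1 0 : ℚ) : ℂ) ^ 2 * τ := by
      have h4 : (γ 1 0 : ℂ) * z = ((a * γ 0 0 + b * γ 1 0 : ℚ) : ℂ) * autFactor γ τ - a := by
        rw [hz, autFactor]
        push_cast
        linear_combination (-(a : ℂ)) * det_cast_eq_one γ
      rw [eq_div_iff hj] at h2
      have h5 : (γ 1 0 : ℂ) * z ^ 2 / autFactor γ τ =
          ((a * γ 0 0 + b * γ 1 0 : ℚ) : ℂ) * z - a * (a * ((γ • τ : ℍ) : ℂ) + b) := by
        rw [div_eq_iff hj]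
        linear_combination z * h4 + a * h2
      rw [h5, hz]
      push_cast
      ring
    linear_combination (Real.pi * I) * h3
  rw [show ∀ x y u v : ℂ, x * (y * u * v) = y * (x * u) * v by intros; ring, e]
  ring

lemma thetaTorsion_add_int (a b : ℚ) (l m : ℤ) (τ : ℍ) :
    thetaTorsion (a + l) (b + m) τ =
      (-1) ^ (l + m) * cexp (-(2 * Real.pi * I * (l * b))) * thetaTorsion a b τ := by
  have h1 : ((a + l : ℚ) : ℂ) * τ + ((b + m : ℚ) : ℂ) = (a * τ + b) + l * τ + m := by
    push_cast
    ring
  rw [thetaTorsion, thetaTorsion, h1, thetaQuot, thetaQuot, theta_add, qpow, qpow]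
  have e : cexp (2 * Real.pi * I * (((a + l : ℚ) : ℂ) ^ 2 / 2) * τ) *
      cexp (-(Real.pi * I * (l ^ 2 * τ + 2 * l * (a * τ + b)))) =
      cexp (-(2 * Real.pi * I * (l * b))) * cexp (2 * Real.pi * I * ((a : ℂ) ^ 2 / 2) * τ) := by
    rw [← Complex.exp_add, ← Complex.exp_add]
    congr 1
    push_cast
    ring
  rw [show ∀ x y u v w : ℂ, x * (y * u * v / w) = y * (x * u) * (v / w) by intros; ring, e]
  ring

lemma norm_cexp_pi_mul_I_mul_rat (x : ℚ) : ‖cexp (Real.pi * I * (x : ℂ))‖ = 1 := by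
  have : (Real.pi * I * (x : ℂ)) = ((Real.pi * x : ℝ) : ℂ) * I := by push_cast; ring
  rw [this, Complex.norm_exp_ofReal_mul_I]

lemma norm_thetaTorsion_add_int (a b : ℚ) (l : ℤ) (τ : ℍ) :
    ‖thetaTorsion (a + l) b τ‖ = ‖thetaTorsion a b τ‖ := by
  have h := thetaTorsion_add_int a b l 0 τ
  rw [Int.cast_zero, add_zero] at h
  have h2 : -(2 * Real.pi * I * ((l : ℂ) * b)) = Real.pi * I * ((-(2 * l * b) : ℚ) : ℂ) := by
    push_cast
    ring
  rw [h, norm_mul, norm_mul, h2, norm_cexp_pi_mul_I_mul_rat]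
  simp

lemma norm_thetaTorsion_smul (γ : SL(2, ℤ)) (a b : ℚ) (τ : ℍ) :
    ‖thetaTorsion a b (γ • τ)‖ = ‖autFactor γ τ‖⁻¹ *
      ‖thetaTorsion (a * γ 0 0 + b * γ 1 0) (a * γ 0 1 + b * γ 1 1) τ‖ := by
  rw [thetaTorsion_smul, norm_mul, norm_mul, norm_inv, norm_cexp_pi_mul_I_mul_rat, mul_one]

lemma norm_qpow (τ : ℍ) (x : ℝ) : ‖qpow τ x‖ = Real.exp (-(2 * Real.pi * x) * τ.im) := by
  rw [qpow, Complex.norm_exp]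
  congr 1
  have : (2 * Real.pi * I * x * τ : ℂ) = ((2 * Real.pi * x : ℝ) : ℂ) * (I * τ) := by
    push_cast
    ring
  rw [this, Complex.re_ofReal_mul]
  simp

lemma tendsto_qpow_atImInfty {x : ℝ} (hx : 0 < x) :
    Tendsto (fun τ : ℍ => qpow τ x) atImInfty (𝓝 0) := by
  rw [tendsto_zero_iff_norm_tendsto_zero]
  simp_rw [norm_qpow]
  refine Real.tendsto_exp_atBot.comp ?_
  refine Tendsto.const_mul_atTop_of_neg ?_ tendsto_comap
  have := Real.pi_pos
  have : 0 < 2 * Real.pi * x := by positivity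
  linarith

lemma tendsto_qPochInf_atImInfty {x : ℍ → ℂ} (hx : Tendsto x atImInfty (𝓝 0)) :
    Tendsto (fun τ : ℍ => qPochInf (x τ) (qpow τ 1)) atImInfty (𝓝 1) := by
  have hq : Tendsto (fun τ : ℍ => qpow τ 1) atImInfty (𝓝 0) := by
    simpa using tendsto_qpow_atImInfty one_pos
  have := tendsto_tprod_one_add_of_dominated_convergence (𝓕 := atImInfty) (g := fun _ => 0)
    (f := fun (τ : ℍ) (j : ℕ) => -(x τ * qpow τ 1 ^ j)) (bound := fun j => (1 / 2 : ℝ) ^ j)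
    (summable_geometric_of_lt_one (by norm_num) (by norm_num))
    (fun j => by simpa using (hx.mul (hq.pow j)).neg) (by
      filter_upwards [hx (Metric.ball_mem_nhds 0 one_pos),
        hq (Metric.ball_mem_nhds 0 (show (0 : ℝ) < 1 / 2 by norm_num))] with τ h1 h2 j
      simp only [Set.mem_preimage, Metric.mem_ball, dist_zero_right] at h1 h2
      rw [norm_neg, norm_mul, norm_pow]
      calc ‖x τ‖ * ‖qpow τ 1‖ ^ j ≤ 1 * (1 / 2) ^ j := by gcongr
        _ = (1 / 2) ^ j := one_mul _)
  simpa [qPochInf, sub_eq_add_neg] using this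

lemma tendsto_qPochInf_self :
    Tendsto (fun τ : ℍ => qPochInf (qpow τ 1) (qpow τ 1)) atImInfty (𝓝 1) :=
  tendsto_qPochInf_atImInfty (by simpa using tendsto_qpow_atImInfty one_pos)

lemma isBigO_of_norm_eq_exp_mul {f g : ℍ → ℂ} {c : ℝ} {L : ℂ} (hc : 0 ≤ c)
    (hf : ∀ τ, ‖f τ‖ = Real.exp (-c * τ.im) * ‖g τ‖) (hg : Tendsto g atImInfty (𝓝 L)) :
    f =O[atImInfty] fun _ => (1 : ℝ) := by
  have h1 : f =O[atImInfty] g := IsBigO.of_bound 1 (Eventually.of_forall fun τ => by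
    rw [hf, one_mul]
    refine mul_le_of_le_one_left (norm_nonneg _) (Real.exp_le_one_iff.2 ?_)
    rw [neg_mul, neg_nonpos]
    exact mul_nonneg hc τ.2.le)
  exact h1.trans (hg.isBigO_one ℝ)

lemma isBigO_inv_of_norm_eq_exp_mul {f g : ℍ → ℂ} {c : ℝ} {L : ℂ} (hL : L ≠ 0)
    (hf : ∀ τ, ‖f τ‖ = Real.exp (-c * τ.im) * ‖g τ‖) (hg : Tendsto g atImInfty (𝓝 L)) :
    (fun τ => (f τ)⁻¹) =O[atImInfty] fun τ => Real.exp (c * τ.im) := by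
  have h1 : (fun τ => (g τ)⁻¹) =O[atImInfty] fun _ => (1 : ℝ) := (hg.inv₀ hL).isBigO_one ℝ
  have h2 := (isBigO_refl (fun τ : ℍ => Real.exp (c * τ.im)) atImInfty).mul h1.norm_left
  simp only [mul_one] at h2
  refine IsBigO.trans (IsBigO.of_bound 1 (Eventually.of_forall fun τ => ?_)) h2
  rw [norm_inv, hf, norm_mul, norm_norm, norm_inv, Real.norm_of_nonneg (Real.exp_pos _).le, mul_inv,
    ← Real.exp_neg, neg_mul, neg_neg, one_mul]

lemma norm_eta (τ : ℍ) : ‖ModularForm.eta τ‖ =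
    Real.exp (-(Real.pi / 12) * τ.im) * ‖qPochInf (qpow τ 1) (qpow τ 1)‖ := by
  have := norm_qpow τ (1 / 24)
  push_cast at this
  rw [eta_eq, norm_mul, this]
  ring_nf

lemma isBigO_eta : (fun τ : ℍ => ModularForm.eta τ) =O[atImInfty] fun _ => (1 : ℝ) :=
  isBigO_of_norm_eq_exp_mul (by positivity) norm_eta tendsto_qPochInf_self

lemma isBigO_inv_eta : (fun τ : ℍ => (ModularForm.eta τ)⁻¹) =O[atImInfty]
    fun τ => Real.exp (Real.pi / 12 * τ.im) :=
  isBigO_inv_of_norm_eq_exp_mul one_ne_zero norm_eta tendsto_qPochInf_self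

/-- The product part of `ϑ(aτ + b; τ)`. -/
def thetaProd (a b : ℚ) (τ : ℍ) : ℂ :=
  qPochInf (qpow τ 1) (qpow τ 1) * (qPochInf (wpow (a * τ + b) 1) (qpow τ 1) *
      qPochInf (qpow τ 1 / wpow (a * τ + b) 1) (qpow τ 1))

lemma norm_thetaTorsion_mul_eta (a b : ℚ) (τ : ℍ) :
    ‖thetaTorsion a b τ * ModularForm.eta τ ^ 3‖ =
      Real.exp (-(Real.pi * (a - 1 / 2 : ℝ) ^ 2) * τ.im) * ‖thetaProd a b τ‖ := by
  have h : thetaTorsion a b τ * ModularForm.eta τ ^ 3 =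
      qpow τ (((a - 1 / 2 : ℝ) ^ 2 / 2 : ℝ) : ℂ) *
        cexp (Real.pi * I * ((-b : ℚ) : ℂ)) * thetaProd a b τ := by
    have e : qpow τ ((a : ℂ) ^ 2 / 2) * (qpow τ (1 / 8) * wpow (a * τ + b) (-1 / 2)) =
        qpow τ (((a - 1 / 2 : ℝ) ^ 2 / 2 : ℝ) : ℂ) * cexp (Real.pi * I * ((-b : ℚ) : ℂ)) := by
      rw [qpow, qpow, qpow, wpow, ← Complex.exp_add, ← Complex.exp_add, ← Complex.exp_add]
      congr 1
      push_cast
      ring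
    rw [← e, thetaTorsion, thetaQuot, mul_assoc,
      div_mul_cancel₀ _ (pow_ne_zero 3 (coe_eta_ne_zero τ)), theta_eq, thetaProd]
    ring
  rw [h, norm_mul, norm_mul, norm_cexp_pi_mul_I_mul_rat, norm_qpow]
  ring_nf

lemma wpow_torsion (a b : ℚ) (τ : ℍ) :
    wpow (a * τ + b) 1 = qpow τ ((a : ℝ) : ℂ) * cexp (2 * Real.pi * I * b) := by
  rw [wpow, qpow, ← Complex.exp_add]
  congr 1
  push_cast
  ring

lemma tendsto_thetaProd {a b : ℚ} (ha0 : 0 ≤ a) (ha1 : a < 1) :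
    ∃ L : ℂ, ((∀ m n : ℤ, ¬(a = m ∧ b = n)) → L ≠ 0) ∧
      Tendsto (thetaProd a b) atImInfty (𝓝 L) := by
  have h2 : Tendsto (fun τ : ℍ => qPochInf (qpow τ 1 / wpow (a * τ + b) 1) (qpow τ 1))
      atImInfty (𝓝 1) := by
    refine tendsto_qPochInf_atImInfty ?_
    have e : ∀ τ : ℍ, qpow τ 1 / wpow (a * τ + b) 1 =
        qpow τ ((1 - a : ℝ) : ℂ) * (cexp (2 * Real.pi * I * b))⁻¹ := fun τ => by
      rw [wpow_torsion, div_eq_mul_inv, mul_inv, ← mul_assoc]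
      congr 1
      rw [← div_eq_mul_inv, div_eq_iff (qpow_ne_zero _ _), ← qpow_add]
      push_cast
      ring_nf
    simp_rw [e]
    simpa using (tendsto_qpow_atImInfty (x := 1 - a) (by
      rw [sub_pos]; exact_mod_cast ha1)).mul_const (cexp (2 * Real.pi * I * b))⁻¹
  rcases ha0.eq_or_lt with rfl | ha
  · set w : ℂ := cexp (2 * Real.pi * I * b) with hw
    have e : ∀ τ : ℍ, wpow ((0 : ℚ) * τ + b) 1 = w := fun τ => by
      rw [wpow_torsion, qpow]
      simp [hw]
    refine ⟨1 * ((1 - w) * 1 * 1), fun h => ?_, ?_⟩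
    · simp only [mul_one, one_mul]
      rw [sub_ne_zero, ne_comm, hw, Ne, Complex.exp_eq_one_iff]
      rintro ⟨n, hn⟩
      refine h 0 n ⟨by simp, ?_⟩
      have h3 : (b : ℂ) = n := by
        apply mul_left_cancel₀ Complex.two_pi_I_ne_zero
        linear_combination hn
      exact_mod_cast h3
    · refine Tendsto.mul tendsto_qPochInf_self (Tendsto.mul ?_ h2)
      have e2 : ∀ τ : ℍ, qPochInf (wpow ((0 : ℚ) * τ + b) 1) (qpow τ 1) =
          (1 - w) * qPochInf (w * qpow τ 1) (qpow τ 1) := fun τ => by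
        rw [e, qPochInf_eq_mul w (norm_qpow_one_lt_one τ) 1]
        simp [qPoch]
      simp_rw [e2]
      refine Tendsto.const_mul _ (tendsto_qPochInf_atImInfty ?_)
      simpa using (tendsto_qpow_atImInfty one_pos).const_mul w
  · refine ⟨1 * (1 * 1), fun _ => by simp, Tendsto.mul tendsto_qPochInf_self (Tendsto.mul ?_ h2)⟩
    refine tendsto_qPochInf_atImInfty ?_
    simp_rw [wpow_torsion]
    simpa using (tendsto_qpow_atImInfty (x := a) (by exact_mod_cast ha)).mul_const
      (cexp (2 * Real.pi * I * b))

lemma norm_thetaTorsion_fract (a b : ℚ) (τ : ℍ) :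
    ‖thetaTorsion a b τ‖ = ‖thetaTorsion (Int.fract a) b τ‖ := by
  rw [← norm_thetaTorsion_add_int (Int.fract a) b ⌊a⌋ τ, Int.fract_add_floor]

lemma isBigO_thetaTorsion_mul_eta (a b : ℚ) :
    (fun τ => thetaTorsion a b τ * ModularForm.eta τ ^ 3) =O[atImInfty] fun _ => (1 : ℝ) := by
  obtain ⟨L, -, hL⟩ := tendsto_thetaProd (b := b) (Int.fract_nonneg a) (Int.fract_lt_one a)
  refine isBigO_of_norm_eq_exp_mul (c := Real.pi * ((Int.fract a : ℚ) - 1 / 2 : ℝ) ^ 2)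
    (by positivity) (fun τ => ?_) hL
  rw [← norm_thetaTorsion_mul_eta, norm_mul, norm_mul, norm_thetaTorsion_fract]

lemma exists_isBigO_inv_thetaTorsion {a b : ℚ} (h : ∀ m n : ℤ, ¬(a = m ∧ b = n)) :
    ∃ C : ℝ, (fun τ => (thetaTorsion a b τ)⁻¹) =O[atImInfty]
      fun τ => Real.exp (C * τ.im) := by
  obtain ⟨L, hL0, hL⟩ := tendsto_thetaProd (b := b) (Int.fract_nonneg a) (Int.fract_lt_one a)
  have hL1 : L ≠ 0 := hL0 fun m n ⟨h1, h2⟩ => h (m + ⌊a⌋) n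
    ⟨by rw [Int.cast_add, ← h1, Int.fract_add_floor], h2⟩
  have h1 : (fun τ => (thetaTorsion a b τ * ModularForm.eta τ ^ 3)⁻¹) =O[atImInfty]
      fun τ => Real.exp (Real.pi * ((Int.fract a : ℚ) - 1 / 2 : ℝ) ^ 2 * τ.im) := by
    refine isBigO_inv_of_norm_eq_exp_mul hL1 (fun τ => ?_) hL
    rw [← norm_thetaTorsion_mul_eta, norm_mul, norm_mul, norm_thetaTorsion_fract]
  refine ⟨Real.pi * ((Int.fract a : ℚ) - 1 / 2 : ℝ) ^ 2,
    (h1.mul (isBigO_eta.pow 3)).congr (fun τ => ?_) fun τ => ?_⟩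
  · have := coe_eta_ne_zero τ
    rw [mul_inv, mul_assoc, inv_mul_cancel₀ (pow_ne_zero 3 this), mul_one]
  · simp

/-- The affine map `τ ↦ tτ + x` of the upper half-plane. -/
def affineMap (t : ℝ) (ht : 0 < t) (x : ℝ) (τ : ℍ) : ℍ :=
  ⟨t * τ + x, by simpa using mul_pos ht τ.2⟩

lemma coe_affineMap (t : ℝ) (ht : 0 < t) (x : ℝ) (τ : ℍ) :
    (affineMap t ht x τ : ℂ) = t * τ + x := rfl

lemma im_affineMap (t : ℝ) (ht : 0 < t) (x : ℝ) (τ : ℍ) :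
    (affineMap t ht x τ).im = t * τ.im := by
  change (affineMap t ht x τ : ℂ).im = _
  simp [coe_affineMap]

lemma tendsto_affineMap (t : ℝ) (ht : 0 < t) (x : ℝ) :
    Tendsto (affineMap t ht x) atImInfty atImInfty := by
  rw [atImInfty, tendsto_comap_iff]
  have : UpperHalfPlane.im ∘ affineMap t ht x = fun τ => t * τ.im :=
    funext (im_affineMap t ht x)
  rw [this]
  exact Tendsto.const_mul_atTop ht tendsto_comap

lemma smul_affineMap {γ δ : SL(2, ℤ)} {t x κ : ℝ} (ht : 0 < t) (hκ : κ ≠ 0)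
    (ha : κ * (δ 0 0 * t) = 2 * γ 0 0) (hb : κ * (δ 0 0 * x + δ 0 1) = 2 * γ 0 1)
    (hc : κ * (δ 1 0 * t) = γ 1 0) (hd : κ * (δ 1 0 * x + δ 1 1) = γ 1 1) (τ : ℍ) :
    2 * ((γ • τ : ℍ) : ℂ) = ((δ • affineMap t ht x τ : ℍ) : ℂ) ∧
      autFactor γ τ = κ * autFactor δ (affineMap t ht x τ) := by
  have hκ' : (κ : ℂ) ≠ 0 := by exact_mod_cast hκ
  replace ha := congrArg ((↑) : ℝ → ℂ) ha
  replace hb := congrArg ((↑) : ℝ → ℂ) hb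
  replace hc := congrArg ((↑) : ℝ → ℂ) hc
  replace hd := congrArg ((↑) : ℝ → ℂ) hd
  push_cast at ha hb hc hd
  have h1 : autFactor γ τ = κ * autFactor δ (affineMap t ht x τ) := by
    rw [autFactor, autFactor, coe_affineMap]
    linear_combination (-(τ : ℂ)) * hc - hd
  refine ⟨?_, h1⟩
  have h2 := autFactor_ne_zero δ (affineMap t ht x τ)
  rw [coe_smul_eq_div, coe_smul_eq_div, h1, coe_affineMap]
  field_simp
  linear_combination (-(τ : ℂ)) * ha - hb

/-- For `γ ∈ Γ₀(2)` one has `2 γτ = δ(2τ)` with `δ ∈ SL₂(ℤ)` and the same automorphy factor. -/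
lemma exists_two_mul_smul_of_even {γ : SL(2, ℤ)} {c : ℤ} (hc : γ 1 0 = 2 * c) :
    ∃ δ : SL(2, ℤ), (δ 0 0 = γ 0 0 ∧ δ 0 1 = 2 * γ 0 1 ∧ δ 1 0 = c ∧ δ 1 1 = γ 1 1) ∧
      ∀ τ : ℍ, 2 * ((γ • τ : ℍ) : ℂ) = ((δ • affineMap 2 two_pos 0 τ : ℍ) : ℂ) ∧
        autFactor γ τ = autFactor δ (affineMap 2 two_pos 0 τ) := by
  refine ⟨⟨!![γ 0 0, 2 * γ 0 1; c, γ 1 1], ?_⟩, ⟨rfl, rfl, rfl, rfl⟩, fun τ => ?_⟩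
  · rw [Matrix.det_fin_two_of]
    have := det_eq_one γ
    rw [hc] at this
    linarith
  · have := smul_affineMap (γ := γ) (δ := ⟨!![γ 0 0, 2 * γ 0 1; c, γ 1 1], by
      rw [Matrix.det_fin_two_of]
      have := det_eq_one γ
      rw [hc] at this
      linarith⟩) (t := 2) (x := 0) (κ := 1) two_pos one_ne_zero
      (by simp; ring) (by simp) (by simp [hc]; ring) (by simp) τ
    simpa using this

/-- The cusps of `τ ↦ 2τ`: for every `γ` one has `2 γτ = δ(tτ + x)` with `δ ∈ SL₂(ℤ)`. -/
lemma exists_two_mul_smul (γ : SL(2, ℤ)) : ∃ (δ : SL(2, ℤ)) (t : ℝ) (ht : 0 < t) (x κ : ℝ),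
    κ ≠ 0 ∧ ∀ τ : ℍ, 2 * ((γ • τ : ℍ) : ℂ) = ((δ • affineMap t ht x τ : ℍ) : ℂ) ∧
      autFactor γ τ = κ * autFactor δ (affineMap t ht x τ) := by
  have hdet := det_eq_one γ
  rcases Int.even_or_odd (γ 1 0) with hc | hc
  · obtain ⟨c, hc⟩ := hc.two_dvd
    obtain ⟨δ, -, h⟩ := exists_two_mul_smul_of_even hc
    exact ⟨δ, 2, two_pos, 0, 1, one_ne_zero, by simpa using h⟩
  rcases Int.even_or_odd (γ 1 1) with hd | hd
  · obtain ⟨d, hd⟩ := hd.two_dvd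
    refine ⟨⟨!![2 * γ 0 0, γ 0 1; γ 1 0, d], ?_⟩, 1 / 2, by norm_num, 0, 2, by norm_num,
      smul_affineMap _ (by norm_num) ?_ ?_ ?_ ?_⟩
    · rw [Matrix.det_fin_two_of]
      rw [hd] at hdet
      linarith
    · simp; ring
    · simp
    · simp; ring
    · simp [hd]
  · obtain ⟨e, he⟩ := (hd.sub_odd hc).two_dvd
    have hd' : γ 1 1 = 2 * e + γ 1 0 := by linarith
    refine ⟨⟨!![2 * γ 0 0, γ 0 1 - γ 0 0; γ 1 0, e], ?_⟩, 1 / 2, by norm_num, 1 / 2, 2,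
      by norm_num, smul_affineMap _ (by norm_num) ?_ ?_ ?_ ?_⟩
    · rw [Matrix.det_fin_two_of]
      rw [hd'] at hdet
      linarith
    · simp; ring
    · simp; ring
    · simp; ring
    · simp [hd']; ring

lemma cpow_half_pow (x : ℂ) (n : ℕ) : (x ^ (1 / 2 : ℂ)) ^ n = x ^ (((n : ℤ) : ℂ) / 2) := by
  rw [← Complex.cpow_nat_mul]
  congr 1
  push_cast
  ring

lemma cpow_neg_half (x : ℂ) (n : ℕ) :
    x ^ (-((n : ℤ) : ℂ) / 2) = ((x ^ (1 / 2 : ℂ)) ^ n)⁻¹ := by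
  rw [neg_div, Complex.cpow_neg, cpow_half_pow]

lemma autFactor_cpow_half_ne_zero (γ : SL(2, ℤ)) (τ : ℍ) : autFactor γ τ ^ (1 / 2 : ℂ) ≠ 0 := by
  rw [Ne, Complex.cpow_eq_zero_iff]
  exact fun h => autFactor_ne_zero γ τ h.1

lemma norm_cpow_half_sq (x : ℂ) : ‖x ^ (1 / 2 : ℂ)‖ ^ 2 = ‖x‖ := by
  rw [← norm_pow, cpow_half_pow_two]

lemma norm_eta_smul (γ : SL(2, ℤ)) (τ : ℍ) : ‖ModularForm.eta ((γ • τ : ℍ) : ℂ)‖ =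
    ‖autFactor γ τ ^ (1 / 2 : ℂ)‖ * ‖ModularForm.eta τ‖ := by
  obtain ⟨ζ, hζ, h⟩ := exists_eta_smul γ
  rw [h, norm_mul, norm_mul, Complex.norm_eq_one_of_pow_eq_one hζ (by norm_num), one_mul]

lemma exists_norm_eta_two_mul_smul (γ : SL(2, ℤ)) :
    ∃ (t : ℝ) (ht : 0 < t) (x C : ℝ), C ≠ 0 ∧ ∀ τ : ℍ,
      ‖ModularForm.eta (2 * ((γ • τ : ℍ) : ℂ))‖ ^ 2 =
        C * (‖autFactor γ τ‖ * ‖ModularForm.eta (affineMap t ht x τ)‖ ^ 2) := by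
  obtain ⟨δ, t, ht, x, κ, hκ, h⟩ := exists_two_mul_smul γ
  refine ⟨t, ht, x, ‖κ‖⁻¹, by simpa using hκ, fun τ => ?_⟩
  obtain ⟨h1, h2⟩ := h τ
  have hκ' : ‖κ‖ ≠ 0 := by simpa using hκ
  rw [h1, norm_eta_smul, mul_pow, norm_cpow_half_sq, h2, norm_mul, Complex.norm_real]
  field_simp

lemma thetaTorsion_mul_eta (a b : ℚ) (τ : ℍ) : thetaTorsion a b τ * ModularForm.eta τ ^ 3 =
    qpow τ ((a : ℂ) ^ 2 / 2) * theta (a * τ + b) τ := by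
  rw [thetaTorsion, thetaQuot, mul_assoc, div_mul_cancel₀ _ (pow_ne_zero 3 (coe_eta_ne_zero τ))]

lemma theta_lattice (τ : ℍ) (m n : ℤ) : theta (m * (τ : ℂ) + n) τ = 0 := by
  have h0 : theta 0 τ = 0 := by
    have h1 : qPochInf (wpow 0 1) (qpow τ 1) = 0 := by
      rw [qPochInf_eq_mul _ (norm_qpow_one_lt_one τ) 1]
      simp [qPoch, wpow]
    rw [theta_eq, h1]
    simp
  have := theta_add 0 τ m n
  rwa [h0, mul_zero, zero_add] at this

lemma half_not_mem_lattice (τ : ℍ) (m n : ℤ) : (τ : ℂ) / 2 ≠ m * (τ : ℂ) + n := by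
  intro h
  have h1 := congrArg Complex.im h
  simp only [Complex.div_ofNat_im, Complex.add_im, Complex.mul_im, Complex.intCast_re,
    Complex.intCast_im, zero_mul, add_zero] at h1
  have h2 : (τ : ℂ).im ≠ 0 := τ.im_ne_zero
  have h3 : (1 : ℝ) = 2 * m := by
    field_simp at h1
    linarith
  have h4 : (1 : ℤ) = 2 * m := by exact_mod_cast h3
  omega

lemma differentiableAt_theta {p : ℂ × ℂ} (hp : 0 < p.2.im) :
    DifferentiableAt ℂ (fun p : ℂ × ℂ => theta p.1 p.2) p := by
  simp_rw [theta_eq_jacobiTheta₂]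
  have h := (hasFDerivAt_jacobiTheta₂ (p.1 + p.2 / 2 + 1 / 2) hp).differentiableAt
  have h2 : DifferentiableAt ℂ (fun p : ℂ × ℂ => jacobiTheta₂ (p.1 + p.2 / 2 + 1 / 2) p.2) p :=
    h.comp (f := fun p : ℂ × ℂ => (p.1 + p.2 / 2 + 1 / 2, p.2)) p (by fun_prop)
  exact DifferentiableAt.mul (by fun_prop) h2

lemma isJacobiForm_eta_pow_four (Γ : Subgroup SL(2, ℤ)) :
    IsJacobiForm 4 0 Γ fun _ τ => ModularForm.eta τ ^ 4 where
  holomorphic := by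
    refine DifferentiableOn.congr (f := fun p : ℂ × ℂ => ModularForm.eta p.2 ^ 4)
      (fun p hp => ?_) fun p hp => by simp only [ofComplex_apply_of_im_pos hp]
    refine DifferentiableAt.differentiableWithinAt (DifferentiableAt.pow ?_ 4)
    exact (ModularForm.differentiableAt_eta_of_mem_upperHalfPlaneSet hp).comp
      (f := fun p : ℂ × ℂ => p.2) p differentiableAt_snd
  elliptic := fun l m z τ => by simp
  modular := by
    choose ζ hζ h using exists_eta_smul
    refine ⟨fun γ => ζ γ ^ 4, 24, by norm_num, fun γ _ => ⟨?_, fun z τ => ?_⟩⟩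
    · rw [← pow_mul, mul_comm, pow_mul, hζ, one_pow]
    · rw [h, mul_pow, mul_pow, cpow_half_pow]
      simp
  growth := fun γ a b => by
    refine IsBigO.trans (IsBigO.of_bound 1 (Eventually.of_forall fun τ => ?_))
      ((isBigO_eta.pow 4).congr_right fun τ => one_pow 4)
    have h1 : ‖autFactor γ τ ^ (1 / 2 : ℂ)‖ ≠ 0 := norm_ne_zero_iff.2
      (autFactor_cpow_half_ne_zero γ τ)
    rw [slashHalf, torsionValue, show (4 : ℤ) = ((4 : ℕ) : ℤ) by rfl, cpow_neg_half, norm_mul,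
      norm_mul, norm_inv, norm_pow, norm_pow, norm_pow, norm_eta_smul]
    have h2 : ‖qpow ((γ • τ : ℍ) : ℂ) (((0 : ℤ) : ℂ) / 2 * (a : ℂ) ^ 2)‖ = 1 := by simp [qpow]
    rw [h2]
    apply le_of_eq
    field_simp

lemma isJacobiForm_eta_sq_mul_theta : IsJacobiForm 3 1 (CongruenceSubgroup.Gamma0 2)
    fun z τ => ModularForm.eta (2 * τ) ^ 2 * theta z τ where
  holomorphic := by
    refine DifferentiableOn.congr
      (f := fun p : ℂ × ℂ => ModularForm.eta (2 * p.2) ^ 2 * theta p.1 p.2)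
      (fun p hp => ?_) fun p hp => by simp only [ofComplex_apply_of_im_pos hp]
    have h2 : 0 < (2 * p.2).im := by simpa using hp
    refine DifferentiableAt.differentiableWithinAt
      (DifferentiableAt.mul (DifferentiableAt.pow ?_ 2) (differentiableAt_theta hp))
    exact (ModularForm.differentiableAt_eta_of_mem_upperHalfPlaneSet h2).comp
      (f := fun p : ℂ × ℂ => 2 * p.2) p (by fun_prop)
  elliptic := fun l m z τ => by
    rw [theta_add]
    simp only [one_mul, Int.cast_one, mul_one]
    ring
  modular := by
    have key : ∀ γ : SL(2, ℤ), ∃ ν : ℂ, γ ∈ CongruenceSubgroup.Gamma0 2 → ν ^ 24 = 1 ∧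
        ∀ (z : ℂ) (τ : ℍ), ModularForm.eta (2 * ((γ • τ : ℍ) : ℂ)) ^ 2 *
          theta (z / autFactor γ τ) ((γ • τ : ℍ) : ℂ) =
          ν * autFactor γ τ ^ (((3 : ℤ) : ℂ) / 2) *
          cexp (Real.pi * I * ((1 : ℤ) : ℂ) * (γ 1 0 : ℂ) * z ^ 2 / autFactor γ τ) *
          (ModularForm.eta (2 * τ) ^ 2 * theta z τ) := by
      intro γ
      by_cases hγ : γ ∈ CongruenceSubgroup.Gamma0 2
      · have h0 : ((2 : ℕ) : ℤ) ∣ γ 1 0 := by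
          rw [← ZMod.intCast_zmod_eq_zero_iff_dvd]
          exact CongruenceSubgroup.Gamma0_mem.1 hγ
        obtain ⟨c, hc⟩ := h0
        obtain ⟨δ, -, hδ⟩ := exists_two_mul_smul_of_even (c := c) (by simpa using hc)
        obtain ⟨ζ, hζ, h⟩ := exists_eta_smul γ
        obtain ⟨ξ, hξ, h'⟩ := exists_eta_smul δ
        refine ⟨ξ ^ 2 * ζ ^ 3, fun _ => ⟨?_, fun z τ => ?_⟩⟩
        · rw [mul_pow, ← pow_mul, ← pow_mul, mul_comm 2, mul_comm 3, pow_mul, pow_mul, hζ, hξ]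
          simp
        · obtain ⟨e1, e2⟩ := hδ τ
          have e3 : ((affineMap 2 two_pos 0 τ : ℍ) : ℂ) = 2 * τ := by simp [coe_affineMap]
          have e4 : ∀ (z : ℂ) (τ : ℍ), theta z τ = thetaQuot z τ * ModularForm.eta τ ^ 3 :=
            fun z τ => (div_mul_cancel₀ _ (pow_ne_zero 3 (coe_eta_ne_zero τ))).symm
          have e5 := autFactor_ne_zero γ τ
          rw [e1, h', ← e2, e3, e4, e4, thetaQuot_smul, h, mul_pow, mul_pow, mul_pow, mul_pow,
            cpow_half_pow_two, cpow_half_pow]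
          simp only [Int.cast_one, mul_one, mul_div_assoc, ← mul_assoc]
          push_cast
          field_simp
      · exact ⟨0, fun h => absurd h hγ⟩
    choose ν hν using key
    exact ⟨ν, 24, by norm_num, fun γ hγ => hν γ hγ⟩
  growth := fun γ a b => by
    obtain ⟨t, ht, x, C, -, h⟩ := exists_norm_eta_two_mul_smul γ
    have h1 := ((isBigO_eta.comp_tendsto (tendsto_affineMap t ht x)).pow 2).mul
      (isBigO_thetaTorsion_mul_eta (a * γ 0 0 + b * γ 1 0) (a * γ 0 1 + b * γ 1 1))
    refine IsBigO.trans (IsBigO.of_bound C (Eventually.of_forall fun τ => ?_))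
      (h1.congr_right fun τ => by simp)
    have h2 : ‖autFactor γ τ ^ (1 / 2 : ℂ)‖ ≠ 0 := norm_ne_zero_iff.2
      (autFactor_cpow_half_ne_zero γ τ)
    have h3 : ‖autFactor γ τ‖ ≠ 0 := norm_ne_zero_iff.2 (autFactor_ne_zero γ τ)
    have h4 : torsionValue 1 (fun z τ => ModularForm.eta (2 * τ) ^ 2 * theta z τ) a b (γ • τ) =
        ModularForm.eta (2 * ((γ • τ : ℍ) : ℂ)) ^ 2 *
          (thetaTorsion a b (γ • τ) * ModularForm.eta ((γ • τ : ℍ) : ℂ) ^ 3) := by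
      rw [thetaTorsion_mul_eta, torsionValue]
      ring_nf
    rw [slashHalf, h4, show (3 : ℤ) = ((3 : ℕ) : ℤ) by rfl, cpow_neg_half]
    simp only [norm_mul, norm_inv, norm_pow, Function.comp_apply]
    rw [h, norm_thetaTorsion_smul, norm_eta_smul]
    apply le_of_eq
    field_simp

theorem isMeromorphicJacobiForm_summand₁_add_summand₂ :
    IsMeromorphicJacobiForm 1 (-1) (CongruenceSubgroup.Gamma0 2)
      (fun α τ => summand₁ α τ + summand₂ α τ) := by
  refine ⟨4, 3, 0, 1, _, _, isJacobiForm_eta_pow_four _, isJacobiForm_eta_sq_mul_theta,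
    by norm_num, by norm_num, fun τ => ⟨τ / 2, mul_ne_zero (pow_ne_zero 2 ?_)
      (theta_ne_zero (half_not_mem_lattice τ))⟩, fun z τ hz => ?_⟩
  · have := coe_eta_ne_zero (affineMap 2 two_pos 0 τ)
    rw [coe_affineMap] at this
    simpa using this
  · refine summand₁_add_summand₂_eq fun m n h => hz ?_
    rw [h, theta_lattice, mul_zero]

lemma torsion_not_mem_lattice {r s : ℚ} (h : ∀ m n : ℤ, ¬(r = m ∧ s = n)) (τ : ℍ) (m n : ℤ) :
    (r : ℂ) * τ + s ≠ m * (τ : ℂ) + n := by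
  intro e
  have hre := congrArg Complex.re e
  have him := congrArg Complex.im e
  simp only [Complex.add_im, Complex.add_re, Complex.mul_im, Complex.mul_re, Complex.intCast_re,
    Complex.intCast_im, Complex.ratCast_re, Complex.ratCast_im, zero_mul, add_zero,
    sub_zero] at hre him
  have h1 : (r : ℝ) = m := mul_right_cancel₀ (b := (τ : ℂ).im) τ.im_ne_zero him
  have h2 : (s : ℝ) = n := by
    rw [h1] at hre
    linarith
  exact h m n ⟨by exact_mod_cast h1, by exact_mod_cast h2⟩

lemma thetaTorsion_ne_zero {r s : ℚ} (h : ∀ m n : ℤ, ¬(r = m ∧ s = n)) (τ : ℍ) :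
    thetaTorsion r s τ ≠ 0 :=
  mul_ne_zero (qpow_ne_zero _ _) (div_ne_zero (theta_ne_zero (torsion_not_mem_lattice h τ))
    (pow_ne_zero 3 (coe_eta_ne_zero τ)))

lemma cexp_pow_eq_one {x : ℚ} {n : ℕ} {k : ℤ} (h : n * x = k) :
    cexp (Real.pi * I * (x : ℂ)) ^ (2 * n) = 1 := by
  rw [← Complex.exp_nat_mul, Complex.exp_eq_one_iff]
  refine ⟨k, ?_⟩
  have h' : (n : ℂ) * x = k := by exact_mod_cast h
  push_cast
  linear_combination (2 * Real.pi * I) * h'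

/-- Powers of the torsion values transform with trivial multiplier under principal congruence
subgroups. -/
lemma thetaTorsion_smul_pow {N : ℕ} {a b : ℚ} {A B : ℤ} (hA : N * a = A) (hB : N * b = B)
    {γ : SL(2, ℤ)} (h00 : (N : ℤ) ∣ γ 0 0 - 1) (h01 : (N : ℤ) ∣ γ 0 1) (h10 : (N : ℤ) ∣ γ 1 0)
    (h11 : (N : ℤ) ∣ γ 1 1 - 1) (τ : ℍ) :
    thetaTorsion a b (γ • τ) ^ (2 * N ^ 2) * autFactor γ τ ^ (2 * N ^ 2) =
      thetaTorsion a b τ ^ (2 * N ^ 2) := by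
  obtain ⟨p, hp⟩ := h00
  obtain ⟨u, hu⟩ := h01
  obtain ⟨q, hq⟩ := h10
  obtain ⟨v, hv⟩ := h11
  have hp' : (γ 0 0 : ℚ) = 1 + N * p := by exact_mod_cast (eq_add_of_sub_eq' hp)
  have hu' : (γ 0 1 : ℚ) = N * u := by exact_mod_cast hu
  have hq' : (γ 1 0 : ℚ) = N * q := by exact_mod_cast hq
  have hv' : (γ 1 1 : ℚ) = 1 + N * v := by exact_mod_cast (eq_add_of_sub_eq' hv)
  have ha : a * γ 0 0 + b * γ 1 0 = a + ((A * p + B * q : ℤ) : ℚ) := by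
    rw [hp', hq']
    push_cast
    linear_combination (p : ℚ) * hA + q * hB
  have hb : a * γ 0 1 + b * γ 1 1 = b + ((A * u + B * v : ℤ) : ℚ) := by
    rw [hu', hv']
    push_cast
    linear_combination (u : ℚ) * hA + v * hB
  set l : ℤ := A * p + B * q
  set m : ℤ := A * u + B * v
  have h1 : cexp (Real.pi * I * ((((a + l) * (b + m) - a * b : ℚ)) : ℂ)) ^ (2 * N ^ 2) = 1 := by
    refine cexp_pow_eq_one (k := A * N * m + B * N * l + N ^ 2 * l * m) ?_
    push_cast
    linear_combination (N * m : ℚ) * hA + (N * l : ℚ) * hB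
  have h2 : cexp (-(2 * Real.pi * I * (l * b))) ^ (2 * N ^ 2) = 1 := by
    have : -(2 * Real.pi * I * ((l : ℂ) * b)) = Real.pi * I * ((-(2 * l * b) : ℚ) : ℂ) := by
      push_cast
      ring
    rw [this]
    refine cexp_pow_eq_one (k := -(2 * l * N * B)) ?_
    push_cast
    linear_combination (-2 * l * N : ℚ) * hB
  have h3 : (((-1 : ℂ) ^ (l + m)) ^ (2 * N ^ 2)) = 1 := by
    rw [pow_mul, sq, neg_one_zpow_mul_self, one_pow]
  rw [thetaTorsion_smul, ha, hb, thetaTorsion_add_int]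
  simp only [mul_pow, h1, h2, h3, mul_one, one_mul]
  rw [mul_right_comm, ← mul_pow, inv_mul_cancel₀ (autFactor_ne_zero γ τ), one_pow, one_mul]

lemma thetaConst_eq (τ : ℍ) : thetaConst τ = -I * ModularForm.eta (2 * τ) ^ 3 *
    thetaTorsion (-1 / 2) (-1 / 2) (affineMap 2 two_pos 0 τ) := by
  have e : ((affineMap 2 two_pos 0 τ : ℍ) : ℂ) = 2 * τ := by simp [coe_affineMap]
  have h1 : thetaConst τ = jacobiTheta₂ 0 (2 * τ) := by
    rw [thetaConst, jacobiTheta₂]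
    refine tsum_congr fun n => ?_
    rw [qpow, jacobiTheta₂_term]
    congr 1
    ring
  have h2 := thetaTorsion_mul_eta (-1 / 2) (-1 / 2) (affineMap 2 two_pos 0 τ)
  rw [e, theta_eq_jacobiTheta₂] at h2
  have h3 : ((-1 / 2 : ℚ) : ℂ) * (2 * τ) + ((-1 / 2 : ℚ) : ℂ) + 2 * τ / 2 + 1 / 2 = 0 := by
    push_cast
    ring
  rw [h3, ← h1, neg_mul, mul_neg, ← mul_assoc, qpow, ← Complex.exp_add] at h2
  have h4 : 2 * Real.pi * I * (((-1 / 2 : ℚ) : ℂ) ^ 2 / 2) * (2 * (τ : ℂ)) + Real.pi * I *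
      (((-1 / 2 : ℚ) : ℂ) * (2 * τ) + ((-1 / 2 : ℚ) : ℂ) + 2 * τ / 4) = -Real.pi / 2 * I := by
    push_cast
    ring
  rw [h4, Complex.exp_neg_pi_div_two_mul_I] at h2
  linear_combination I * h2 + thetaConst τ * Complex.I_mul_I

lemma neg_half_not_int (m n : ℤ) : ¬((-1 / 2 : ℚ) = m ∧ (-1 / 2 : ℚ) = n) := by
  rintro ⟨h, -⟩
  have h2 : ((-1 : ℤ) : ℚ) = ((2 * m : ℤ) : ℚ) := by
    push_cast
    linarith
  have h3 : -1 = 2 * m := by exact_mod_cast h2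
  omega

lemma eta_two_mul_ne_zero (τ : ℍ) : ModularForm.eta (2 * τ) ≠ 0 := by
  have := coe_eta_ne_zero (affineMap 2 two_pos 0 τ)
  rw [coe_affineMap] at this
  simpa using this

lemma thetaConst_ne_zero (τ : ℍ) : thetaConst τ ≠ 0 := by
  rw [thetaConst_eq]
  exact mul_ne_zero (mul_ne_zero (neg_ne_zero.2 I_ne_zero) (pow_ne_zero 3 (eta_two_mul_ne_zero τ)))
    (thetaTorsion_ne_zero neg_half_not_int _)

/-- The modular form `q^{-r²/2} F(rτ + s; τ)` as a quotient of eta and theta functions. -/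
def torsionForm (r s : ℚ) (τ : ℍ) : ℂ :=
  ModularForm.eta τ / (ModularForm.eta (2 * τ) ^ 2 * thetaTorsion r s τ)

lemma torsionForm_eq {r s : ℚ} (h : ∀ m n : ℤ, ¬(r = m ∧ s = n)) (τ : ℍ) :
    qpow τ (-(r : ℂ) ^ 2 / 2) *
      (summand₁ ((r : ℂ) * τ + s) τ + summand₂ ((r : ℂ) * τ + s) τ) = torsionForm r s τ := by
  have h1 := torsion_not_mem_lattice h τ
  have h2 := thetaTorsion_ne_zero h τ
  have h3 := coe_eta_ne_zero τ
  have h4 := eta_two_mul_ne_zero τ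
  have h5 := theta_ne_zero h1
  have h6 := thetaTorsion_mul_eta r s τ
  have h7 : qpow τ (-(r : ℂ) ^ 2 / 2) * qpow τ ((r : ℂ) ^ 2 / 2) = 1 := by
    rw [← qpow_add, qpow]
    ring_nf
    simp
  rw [summand₁_add_summand₂_eq h1, torsionForm]
  generalize qpow τ (-(r : ℂ) ^ 2 / 2) = Q at *
  generalize theta (r * τ + s) τ = Θ at *
  field_simp
  linear_combination Q * h6 + Θ * h7

lemma differentiableAt_thetaQuot (a b : ℚ) {t : ℂ} (ht : 0 < t.im) :
    DifferentiableAt ℂ (fun t => qpow t ((a : ℂ) ^ 2 / 2) * thetaQuot (a * t + b) t) t := by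
  have h1 : DifferentiableAt ℂ (fun t : ℂ => theta (a * t + b) t) t :=
    (differentiableAt_theta (p := (a * t + b, t)) ht).comp
      (f := fun t : ℂ => ((a * t + b : ℂ), t)) t (by fun_prop)
  have h2 := ModularForm.differentiableAt_eta_of_mem_upperHalfPlaneSet ht
  unfold thetaQuot
  exact DifferentiableAt.mul (by unfold qpow; fun_prop)
    (h1.div (h2.pow 3) (pow_ne_zero 3 (ModularForm.eta_ne_zero ht)))

lemma continuous_thetaTorsion (a b : ℚ) : Continuous (thetaTorsion a b) :=
  continuous_iff_continuousAt.2 fun τ =>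
    (differentiableAt_thetaQuot a b τ.2).continuousAt.comp
      (f := fun τ : ℍ => (τ : ℂ)) continuous_coe.continuousAt

lemma continuous_affineMap (t : ℝ) (ht : 0 < t) (x : ℝ) : Continuous (affineMap t ht x) := by
  refine isOpenEmbedding_coe.isInducing.continuous_iff.2 ?_
  rw [Function.comp_def]
  simp_rw [coe_affineMap]
  fun_prop

lemma continuous_eta_two_mul : Continuous fun τ : ℍ => ModularForm.eta (2 * τ) := by
  have := continuous_eta.comp (continuous_affineMap 2 two_pos 0)
  simpa [Function.comp_def, coe_affineMap] using this

lemma differentiableOn_torsionForm {r s : ℚ} (h : ∀ m n : ℤ, ¬(r = m ∧ s = n)) :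
    DifferentiableOn ℂ (fun t : ℂ => torsionForm r s (ofComplex t)) {t | 0 < t.im} := by
  refine DifferentiableOn.congr (f := fun t : ℂ => ModularForm.eta t /
      (ModularForm.eta (2 * t) ^ 2 * (qpow t ((r : ℂ) ^ 2 / 2) * thetaQuot (r * t + s) t)))
    (fun t ht => ?_) fun t ht => by
      simp only [torsionForm, thetaTorsion, ofComplex_apply_of_im_pos ht]
  have h2 : 0 < (2 * t).im := by simpa using ht
  have h3 : DifferentiableAt ℂ (fun t => ModularForm.eta (2 * t)) t :=
    (ModularForm.differentiableAt_eta_of_mem_upperHalfPlaneSet h2).comp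
      (f := fun t : ℂ => 2 * t) t (by fun_prop)
  refine (DifferentiableAt.div (ModularForm.differentiableAt_eta_of_mem_upperHalfPlaneSet ht)
    ((h3.pow 2).mul (differentiableAt_thetaQuot r s ht)) ?_).differentiableWithinAt
  exact mul_ne_zero (pow_ne_zero 2 (ModularForm.eta_ne_zero h2))
    (thetaTorsion_ne_zero h ⟨t, ht⟩)

/-- The quotient of `torsionForm` by the theta constant, of weight `0`. -/
def torsionQuot (r s : ℚ) (τ : ℍ) : ℂ := torsionForm r s τ / thetaConst τ

lemma torsionQuot_ne_zero {r s : ℚ} (h : ∀ m n : ℤ, ¬(r = m ∧ s = n)) (τ : ℍ) :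
    torsionQuot r s τ ≠ 0 :=
  div_ne_zero (div_ne_zero (coe_eta_ne_zero τ) (mul_ne_zero (pow_ne_zero 2 (eta_two_mul_ne_zero τ))
    (thetaTorsion_ne_zero h τ))) (thetaConst_ne_zero τ)

lemma continuous_torsionQuot {r s : ℚ} (h : ∀ m n : ℤ, ¬(r = m ∧ s = n)) :
    Continuous (torsionQuot r s) := by
  refine Continuous.div (Continuous.div continuous_eta
    ((continuous_eta_two_mul.pow 2).mul (continuous_thetaTorsion r s)) fun τ =>
      mul_ne_zero (pow_ne_zero 2 (eta_two_mul_ne_zero τ)) (thetaTorsion_ne_zero h τ)) ?_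
      thetaConst_ne_zero
  rw [show thetaConst = _ from funext thetaConst_eq]
  exact (continuous_const.mul (continuous_eta_two_mul.pow 3)).mul
    ((continuous_thetaTorsion _ _).comp (continuous_affineMap 2 two_pos 0))

lemma dvd_of_mem_Gamma {N : ℕ} {γ : SL(2, ℤ)} (h : γ ∈ CongruenceSubgroup.Gamma N) :
    (N : ℤ) ∣ γ 0 0 - 1 ∧ (N : ℤ) ∣ γ 0 1 ∧ (N : ℤ) ∣ γ 1 0 ∧ (N : ℤ) ∣ γ 1 1 - 1 := by
  rw [CongruenceSubgroup.Gamma_mem] at h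
  simp only [← ZMod.intCast_zmod_eq_zero_iff_dvd]
  push_cast
  exact ⟨sub_eq_zero.2 h.1, h.2.1, h.2.2.1, sub_eq_zero.2 h.2.2.2⟩

/-- A common level of the characteristics `(r, s)` and `(1/2, 1/2)`. -/
def level (r s : ℚ) : ℕ := 2 * (r.den * s.den)

instance (r s : ℚ) : NeZero (level r s) :=
  ⟨by simp [level, r.den_nz, s.den_nz]⟩

lemma torsionQuot_smul_pow {r s : ℚ} (h : ∀ m n : ℤ, ¬(r = m ∧ s = n)) {γ : SL(2, ℤ)}
    (hγ : γ ∈ CongruenceSubgroup.Gamma (2 * level r s)) (τ : ℍ) :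
    torsionQuot r s (γ • τ) ^ (24 * (2 * level r s ^ 2)) =
      torsionQuot r s τ ^ (24 * (2 * level r s ^ 2)) := by
  set N := level r s with hN
  obtain ⟨h00, h01, h10, h11⟩ := dvd_of_mem_Gamma hγ
  push_cast at h00 h01 h10 h11
  have h2N : (N : ℤ) ∣ 2 * N := dvd_mul_left _ _
  obtain ⟨c, hc⟩ := h10
  rw [mul_assoc] at hc
  obtain ⟨δ, ⟨e00, e01, e10, e11⟩, hδ⟩ := exists_two_mul_smul_of_even hc
  obtain ⟨d1, d2⟩ := hδ τ
  have hr : (N : ℚ) * r = ((2 * (r.num * s.den) : ℤ) : ℚ) := by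
    have := Rat.mul_den_eq_num r
    rw [hN, level]
    push_cast
    linear_combination (2 * s.den : ℚ) * this
  have hs : (N : ℚ) * s = ((2 * (s.num * r.den) : ℤ) : ℚ) := by
    have := Rat.mul_den_eq_num s
    rw [hN, level]
    push_cast
    linear_combination (2 * r.den : ℚ) * this
  have hh : (N : ℚ) * (-1 / 2) = ((-(r.den * s.den) : ℤ) : ℚ) := by
    rw [hN, level]
    push_cast
    ring
  have t1 := thetaTorsion_smul_pow hr hs (γ := γ) (h2N.trans h00) (h2N.trans h01)
    (by rw [hc]; exact ⟨2 * c, by ring⟩) (h2N.trans h11) τ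
  have t2 := thetaTorsion_smul_pow hh hh (γ := δ) (by rw [e00]; exact h2N.trans h00)
    (by rw [e01]; exact (h2N.trans h01).mul_left 2) (by rw [e10]; exact dvd_mul_right _ _)
    (by rw [e11]; exact h2N.trans h11) (affineMap 2 two_pos 0 τ)
  have u1 := eta_smul_pow γ τ
  have u2 := eta_smul_pow δ (affineMap 2 two_pos 0 τ)
  have d3 : affineMap 2 two_pos 0 (γ • τ) = δ • affineMap 2 two_pos 0 τ := by
    ext1
    rw [← d1]
    simp [coe_affineMap]
  have d4 : ((affineMap 2 two_pos 0 τ : ℍ) : ℂ) = 2 * τ := by simp [coe_affineMap]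
  rw [← d1, d4, ← d2] at u2
  rw [← d2] at t2
  have hj := autFactor_ne_zero γ τ
  have n1 := coe_eta_ne_zero τ
  have n2 := eta_two_mul_ne_zero τ
  have n3 := thetaTorsion_ne_zero h τ
  have n4 := thetaTorsion_ne_zero neg_half_not_int (affineMap 2 two_pos 0 τ)
  rw [← eq_div_iff (pow_ne_zero _ hj)] at t1 t2
  rw [torsionQuot, torsionQuot, torsionForm, torsionForm, thetaConst_eq, thetaConst_eq, d3]
  simp only [div_pow, mul_pow, ← pow_mul]
  generalize 2 * N ^ 2 = M at *
  have k1 : ∀ (x : ℂ) (k : ℕ), x ^ (k * (24 * M)) = (x ^ 24) ^ (k * M) := fun x k => by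
    rw [← pow_mul]
    ring_nf
  have k2 : ∀ x : ℂ, x ^ (24 * M) = (x ^ M) ^ 24 := fun x => by rw [← pow_mul, mul_comm]
  rw [k1, k1, k1, k1, k2 (thetaTorsion r s _), k2 (thetaTorsion r s _),
    k2 (thetaTorsion _ _ _), k2 (thetaTorsion _ _ _), t1, t2, u2, pow_mul _ 24 M, pow_mul _ 24 M,
    pow_mul _ 24 M, u1]
  simp only [div_pow, mul_pow, ← pow_mul]
  field_simp
  ring

/-- The character of `Γ(N)` through which the weight `0` form `torsionQuot` transforms. -/
lemma exists_torsionQuot_character {r s : ℚ} (h : ∀ m n : ℤ, ¬(r = m ∧ s = n)) :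
    ∃ χ : CongruenceSubgroup.Gamma (2 * level r s) →* ℂˣ, Finite χ.range ∧
      ∀ (γ : CongruenceSubgroup.Gamma (2 * level r s)) (τ : ℍ),
        torsionQuot r s ((γ : SL(2, ℤ)) • τ) = χ γ * torsionQuot r s τ := by
  have hne := torsionQuot_ne_zero h
  set M := 24 * (2 * level r s ^ 2) with hM
  have hM0 : 0 < M := by
    have := Nat.pos_of_ne_zero (NeZero.ne (level r s))
    positivity
  have hpow : ∀ (γ : CongruenceSubgroup.Gamma (2 * level r s)) (τ : ℍ),
      (torsionQuot r s ((γ : SL(2, ℤ)) • τ) / torsionQuot r s τ) ^ M = 1 := fun γ τ => by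
    rw [div_pow, torsionQuot_smul_pow h γ.2, div_self (pow_ne_zero _ (hne τ))]
  have hconst : ∀ (γ : CongruenceSubgroup.Gamma (2 * level r s)) (τ : ℍ),
      torsionQuot r s ((γ : SL(2, ℤ)) • τ) =
        torsionQuot r s ((γ : SL(2, ℤ)) • UpperHalfPlane.I) / torsionQuot r s UpperHalfPlane.I *
          torsionQuot r s τ := fun γ τ => by
    have hc := continuous_torsionQuot h
    rw [← div_eq_iff (hne τ)]
    exact eq_of_forall_pow_eq_one ((hc.comp (continuous_smul_left γ)).div hc hne) hM0 (hpow γ) _ _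
  let χ : CongruenceSubgroup.Gamma (2 * level r s) →* ℂ :=
    { toFun := fun γ => torsionQuot r s ((γ : SL(2, ℤ)) • UpperHalfPlane.I) /
        torsionQuot r s UpperHalfPlane.I
      map_one' := by simp [hne]
      map_mul' := fun γ δ => by
        rw [Subgroup.coe_mul, mul_smul, hconst γ, mul_div_assoc] }
  refine ⟨χ.toHomUnits, ?_, hconst⟩
  have : NeZero M := ⟨hM0.ne'⟩
  have hle : (χ.toHomUnits.range : Set ℂˣ) ⊆ (rootsOfUnity M ℂ : Set ℂˣ) := by
    rintro _ ⟨γ, rfl⟩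
    rw [SetLike.mem_coe, mem_rootsOfUnity']
    exact hpow γ _
  have hfin : Finite (rootsOfUnity M ℂ) := inferInstance
  exact Set.Finite.subset (s := (rootsOfUnity M ℂ : Set ℂˣ)) hfin hle

lemma torsionForm_meromorphic_at_cusps {r s : ℚ} (h : ∀ m n : ℤ, ¬(r = m ∧ s = n))
    (γ : SL(2, ℤ)) : ∃ C : ℝ,
      slashHalf 1 γ (torsionForm r s) =O[atImInfty] fun τ : ℍ => Real.exp (C * τ.im) := by
  have h' : ∀ m n : ℤ, ¬(r * γ 0 0 + s * γ 1 0 = m ∧ r * γ 0 1 + s * γ 1 1 = n) := by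
    rintro m n ⟨h1, h2⟩
    have hdet : (γ 0 0 : ℚ) * γ 1 1 - γ 0 1 * γ 1 0 = 1 := by exact_mod_cast det_eq_one γ
    refine h (m * γ 1 1 - n * γ 1 0) (n * γ 0 0 - m * γ 0 1) ⟨?_, ?_⟩
    · push_cast
      linear_combination (γ 1 1 : ℚ) * h1 - γ 1 0 * h2 - r * hdet
    · push_cast
      linear_combination (γ 0 0 : ℚ) * h2 - γ 0 1 * h1 - s * hdet
  obtain ⟨t, ht, x, C, hC, hη⟩ := exists_norm_eta_two_mul_smul γ
  obtain ⟨D, hD⟩ := exists_isBigO_inv_thetaTorsion h'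
  have h1 := (isBigO_eta.mul
    ((isBigO_inv_eta.comp_tendsto (tendsto_affineMap t ht x)).pow 2)).mul hD
  refine ⟨2 * (Real.pi / 12 * t) + D, ?_⟩
  refine IsBigO.trans (IsBigO.of_bound C⁻¹ (Eventually.of_forall fun τ => ?_))
    (h1.congr_right fun τ => ?_)
  · have h2 : ‖autFactor γ τ ^ (1 / 2 : ℂ)‖ ≠ 0 := norm_ne_zero_iff.2
      (autFactor_cpow_half_ne_zero γ τ)
    have h3 : ‖autFactor γ τ‖ ≠ 0 := norm_ne_zero_iff.2 (autFactor_ne_zero γ τ)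
    have h4 := cpow_neg_half (autFactor γ τ) 1
    rw [Nat.cast_one, pow_one] at h4
    rw [slashHalf, torsionForm, h4]
    simp only [norm_mul, norm_inv, norm_div, norm_pow, Function.comp_apply]
    rw [hη, norm_thetaTorsion_smul, norm_eta_smul]
    apply le_of_eq
    field_simp
  · rw [one_mul, Function.comp_apply, im_affineMap, ← Real.exp_nat_mul, ← Real.exp_add]
    congr 1
    push_cast
    ring

theorem exists_isWeaklyHolomorphicModularForm_torsionForm {r s : ℚ}
    (h : ∀ m n : ℤ, ¬(r = m ∧ s = n)) :
    ∃ Γ : Subgroup SL(2, ℤ), IsWeaklyHolomorphicModularForm 1 Γ (torsionForm r s) := by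
  obtain ⟨χ, hfin, hχ⟩ := exists_torsionQuot_character h
  refine ⟨χ.ker.map (CongruenceSubgroup.Gamma (2 * level r s)).subtype, ?_, ?_,
    differentiableOn_torsionForm h, ?_, torsionForm_meromorphic_at_cusps h⟩
  · rintro _ ⟨γ, -, rfl⟩
    rw [CongruenceSubgroup.Gamma0_mem, ZMod.intCast_zmod_eq_zero_iff_dvd]
    refine dvd_trans ⟨r.den * s.den, ?_⟩ (dvd_of_mem_Gamma γ.2).2.2.1
    rw [level]
    push_cast
    ring
  · have : NeZero (2 * level r s) := ⟨mul_ne_zero two_ne_zero (NeZero.ne _)⟩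
    refine ⟨?_⟩
    rw [Subgroup.index_map_subtype]
    exact mul_ne_zero Subgroup.FiniteIndex.index_ne_zero Subgroup.FiniteIndex.index_ne_zero
  · rintro _ ⟨γ, hγ, rfl⟩ τ
    have h1 := hχ γ τ
    have h2 := thetaConst_ne_zero τ
    have h3 := thetaConst_ne_zero ((γ : SL(2, ℤ)) • τ)
    rw [show χ γ = 1 from hγ, Units.val_one, one_mul, torsionQuot, torsionQuot,
      div_eq_div_iff h3 h2] at h1
    rw [zpow_one, Subgroup.subtype_apply, div_mul_eq_mul_div, eq_div_iff h2, h1, mul_comm]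

end AppellCompletion

end

theorem theorem1p5 :
    (∀ (τ : ℍ) (α : ℂ), (∀ m n : ℤ, α ≠ m * (τ : ℂ) + n) →
      Summable (fun n : ℕ =>
        AppellCompletion.K₁Term (AppellCompletion.wpow α 1) (AppellCompletion.qpow τ 1) n) ∧
      Summable (fun n : ℕ =>
        AppellCompletion.K₂Term (AppellCompletion.wpow α 1) (AppellCompletion.qpow τ 1) (n + 1)) ∧
      AppellCompletion.theta α τ ≠ 0 ∧
      AppellCompletion.summand₁ α τ + AppellCompletion.summand₂ α τ =
        ModularForm.eta τ ^ 4 /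
          (ModularForm.eta (2 * τ) ^ 2 * AppellCompletion.theta α τ) ∧
      AppellCompletion.summand₁ α τ =
        AppellCompletion.wpow α (-1 / 2) * (ModularForm.eta τ / ModularForm.eta (2 * τ) ^ 2) *
          AppellCompletion.appell₂ α (-τ) (2 * τ) ∧
      AppellCompletion.summand₂ α τ =
        -(AppellCompletion.wpow α (-1 / 2) *
          (ModularForm.eta τ / ModularForm.eta (2 * τ) ^ 2) *
          AppellCompletion.appell₂ (α + τ) τ (2 * τ))) ∧
    AppellCompletion.IsMeromorphicJacobiForm 1 (-1) (CongruenceSubgroup.Gamma0 2)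
      (fun α τ => AppellCompletion.summand₁ α τ + AppellCompletion.summand₂ α τ) ∧
    (∀ r s : ℚ, (∀ m n : ℤ, ¬(r = m ∧ s = n)) →
      ∃ Γ : Subgroup SL(2, ℤ),
        AppellCompletion.IsWeaklyHolomorphicModularForm 1 Γ
          (fun τ => AppellCompletion.qpow τ (-(r : ℂ) ^ 2 / 2) *
            (AppellCompletion.summand₁ ((r : ℂ) * τ + s) τ +
              AppellCompletion.summand₂ ((r : ℂ) * τ + s) τ))) := by
  refine ⟨fun τ α h => ?_, AppellCompletion.isMeromorphicJacobiForm_summand₁_add_summand₂,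
    fun r s h => ?_⟩
  · have h1 := fun r => AppellCompletion.wpow_mul_qpow_zpow_ne_one h r
    have hq0 := AppellCompletion.qpow_ne_zero τ 1
    have hq := AppellCompletion.norm_qpow_one_lt_one τ
    have hw0 := AppellCompletion.wpow_ne_zero α 1
    exact ⟨(AppellCompletion.summable_K₁Term_and_K₁_eq hq0 hq hw0
        (AppellCompletion.mul_sq_zpow_ne_one h1)).1,
      (AppellCompletion.summable_K₂Term_and_K₂_eq hq0 hq hw0
        (AppellCompletion.mul_mul_sq_zpow_ne_one hq0 h1)).1,
      AppellCompletion.theta_ne_zero h, AppellCompletion.summand₁_add_summand₂_eq h,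
      AppellCompletion.summand₁_eq h, AppellCompletion.summand₂_eq h⟩
  · obtain ⟨Γ, hΓ⟩ := AppellCompletion.exists_isWeaklyHolomorphicModularForm_torsionForm h
    refine ⟨Γ, ?_⟩
    rwa [← funext (AppellCompletion.torsionForm_eq h)] at hΓ
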